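/- **Theorem 2 (Type 2).** *Model.* Let $\mathcal K_1,\mathcal K_2$ be disjoint finite index sets of base station (BS) tiers, $\mathcal K=\mathcal K_1\cup\mathcal K_2$, and $q\in\mathcal K_1$. For $k\in\mathcal K_2$, $\Phi_k$ is a homogeneous Poisson point process (PPP) in $\mathbb R^2$ of intensity $\lambda_k>0$. For $k\in\mathcal K_1$, $\Phi_k=\bigcup_{\mathbf z\in\Phi_{\mathrm p_k}}(\mathbf z+\mathcal B_k^{\mathbf z})$ is a Poisson cluster process: $\Phi_{\mathrm p_k}$ is a homogeneous PPP of intensity $\lambda_{\mathrm p_k}>0$ (the parent process), and the clusters $\mathcal B_k^{\mathbf z}$ are i.i.d., each consisting of a $\mathrm{Poisson}(\bar m_k)$ number ($\bar m_k>0$) of i.i.d. points with isotropic density $g_k$ on $\mathbb R^2$. The users form a Poisson cluster process with the same parent process $\Phi_{\mathrm p_q}$, with $\mathrm{Poisson}(\bar m_{\mathrm u})$ users per cluster ($\bar m_{\mathrm u}>0$) and density $g_{\mathrm u}$ of a user's position relative to its cluster centre; given $\Phi_{\mathrm p_q}$, the users and $\Phi_q$ are independent. The tiers are independent, and the fading variables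 $h$ of all user-BS links are i.i.d. $\mathrm{Exp}(1)$ and independent of everything else. A BS of tier $k$ has power $P_k>0$ and threshold $\tau_k>0$; the path-loss exponent is $\alpha>2$ and the noise power is $\mathtt N_0\ge0$. A user at the origin is served by the BS $\mathbf x^*$ that maximizes $P_k\|\mathbf x\|^{-\alpha}$ over all $k\in\mathcal K$ and $\mathbf x\in\Phi_k$; $\mathcal S_i$ is the event $\mathbf x^*\in\Phi_i$, on which $$\mathtt{SINR}=\frac{P_ih_{\mathbf x^*}\|\mathbf x^*\|^{-\alpha}}{\mathtt N_0+\sum_{j\in\mathcal K}\sum_{\mathbf x\in\Phi_j\setminus\{\mathbf x^*\}}P_jh_{\mathbf x}\|\mathbf x\|^{-\alpha}} .$$ For a user elsewhere, replace all positions by positions relative to that user. Let the *modified network* be the network in which tier $q$ is replaced by $\Phi_q\cup(\mathbf z_0+\mathcal B_q^{\mathbf z_0})$, where $-\mathbf z_0$ has density $g_{\mathrm u}$ and $\mathbf z_0$ and the representative cluster $\mathcal B_q^{\mathbf z_0}$ (distributed as the other clusters of tier $q$) are independent of each other and of everything else; the typical user is at the origin, and $\mathbb P(\mathtt{SINR}>\tau_i,\mathcal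 S_i)$ and $\mathtt{P_c}=\mathbb P\big(\bigcup_{i\in\mathcal K}\{\mathtt{SINR}>\tau_i,\mathcal S_i\}\big)$ refer to this network. *Notation.* $f_{\mathrm d_k}(\cdot|z)$ is the density of $\|\mathbf z+\mathbf s\|$, where $\mathbf s$ has density $g_k$ and $\|\mathbf z\|=z$; $f_{\mathrm d_{\mathrm u}}(\cdot|0)$ is the density of $\|\mathbf s\|$, where $\mathbf s$ has density $g_{\mathrm u}$; $\bar P_{j,i}=(P_j/P_i)^{1/\alpha}$; $\rho(\tau,\alpha)=1+\tau^{2/\alpha}\int_{\tau^{-2/\alpha}}^\infty\frac{\mathrm dt}{1+t^{\alpha/2}}$; $$\mathcal C_{j,i}(r,z)=\exp\Big(-\bar m_j\Big(1-\int_{\bar P_{j,i}r}^\infty\frac{f_{\mathrm d_j}(y|z)}{1+\tau_i(\bar P_{j,i}r)^\alpha y^{-\alpha}}\,\mathrm dy\Big)\Big).$$ Put $$A_i(r)=\exp\Big(-\frac{\tau_i\mathtt N_0r^\alpha}{P_i}\Big)\prod_{j\in\mathcal K_1}\exp\Big(-2\pi\lambda_{\mathrm p_j}\int_0^\infty(1-\mathcal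 C_{j,i}(r,z))z\,\mathrm dz\Big)\exp\Big(-\pi r^2\sum_{j\in\mathcal K_2}\lambda_j\bar P_{j,i}^2\rho(\tau_i,\alpha)\Big).$$ *Claim.* (a) The typical user of the original network sees the modified network: for every Borel set $B\subset\mathbb R^2$ with $0<|B|<\infty$ and every $i\in\mathcal K$, the expected number of users in $B$ that are served by tier $i$ with $\mathtt{SINR}>\tau_i$, divided by the expected number of users in $B$ (the Palm probability), equals $\mathbb P(\mathtt{SINR}>\tau_i,\mathcal S_i)$, and the same ratio for the users that are covered by any tier equals $\mathtt{P_c}$. (b) $\mathtt{P_c}=\sum_{i\in\mathcal K}\mathbb P(\mathtt{SINR}>\tau_i,\mathcal S_i)$, where $\mathbb P(\mathtt{SINR}>\tau_i,\mathcal S_i)$ equals for $i\in\mathcal K_1\setminus\{q\}$: $$2\pi\lambda_{\mathrm p_i}\bar m_i\int_0^\infty A_i(r)\int_0^\infty\mathcal C_{q,i}(r,z_0)f_{\mathrm d_{\mathrm u}}(z_0|0)\,\mathrm dz_0\int_0^\infty f_{\mathrm d_i}(r|z)\,\mathcal C_{i,i}(r,z)\,z\,\mathrm dz\,\mathrm dr;$$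 for $i=q$: $$\bar m_q\int_0^\infty A_q(r)\Big(\int_0^\infty f_{\mathrm d_q}(r|z_0)\,\mathcal C_{q,q}(r,z_0)f_{\mathrm d_{\mathrm u}}(z_0|0)\,\mathrm dz_0+2\pi\lambda_{\mathrm p_q}\int_0^\infty f_{\mathrm d_q}(r|z)\,\mathcal C_{q,q}(r,z)z\,\mathrm dz\int_0^\infty\mathcal C_{q,q}(r,z_0)f_{\mathrm d_{\mathrm u}}(z_0|0)\,\mathrm dz_0\Big)\mathrm dr;$$ for $i\in\mathcal K_2$: $$2\pi\lambda_i\int_0^\infty A_i(r)\int_0^\infty\mathcal C_{q,i}(r,z_0)f_{\mathrm d_{\mathrm u}}(z_0|0)\,\mathrm dz_0\;r\,\mathrm dr.$$ -/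

import Mathlib

open MeasureTheory ProbabilityTheory
open scoped ENNReal

noncomputable section

namespace HetNet

/-- The plane with its Euclidean norm and Lebesgue measure. -/
abbrev Plane : Type := EuclideanSpace ℝ (Fin 2)

/-- `g` is a probability density on the plane. -/
structure IsDensity (g : Plane → ℝ) : Prop where
  measurable : Measurable g
  nonneg : ∀ x, 0 ≤ g x
  lintegral_eq_one : ∫⁻ x, ENNReal.ofReal (g x) = 1

/-- The probability distribution on the plane with density `g`. -/
def densityLaw (g : Plane → ℝ) : Measure Plane :=
  volume.withDensity fun x => ENNReal.ofReal (g x)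

/-- The random points `X 0, X 1, …` enumerate a homogeneous Poisson point process of intensity
`lam`: the numbers of points in disjoint measurable sets `A 0, …, A (m - 1)` of finite area are
independent Poisson variables with means `lam * area`. -/
structure IsPPP {Ω : Type*} [MeasurableSpace Ω] (lam : ℝ) (X : ℕ → Ω → Plane)
    (μ : Measure Ω) : Prop where
  measurable : ∀ n, Measurable (X n)
  counts : ∀ (m : ℕ) (A : Fin m → Set Plane), (∀ a, MeasurableSet (A a)) →
    (∀ a, volume (A a) < ∞) → Pairwise (fun a b => Disjoint (A a) (A b)) →
    ∀ c : Fin m → ℕ,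
      μ {ω | ∀ a, {n | X n ω ∈ A a}.encard = (c a : ℕ∞)} =
        ∏ a, poissonMeasure (lam * (volume (A a)).toReal).toNNReal {c a}

/-- Parameters of the network. `K₁` indexes the base station (BS) tiers that are Poisson cluster
processes, `K₂` those that are Poisson point processes; the set of all tiers is `K₁ ⊕ K₂`. -/
structure Params (K₁ K₂ : Type*) where
  /-- intensity of the parent process of a cluster tier -/
  lamP : K₁ → ℝ
  /-- mean number of points of a cluster -/
  mbar : K₁ → ℝ
  /-- density of the position of an offspring point relative to its cluster centre -/
  g : K₁ → Plane → ℝ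
  /-- intensity of a Poisson tier -/
  lam : K₂ → ℝ
  /-- transmit powers -/
  P : K₁ ⊕ K₂ → ℝ
  /-- coverage thresholds -/
  τ : K₁ ⊕ K₂ → ℝ
  /-- path-loss exponent -/
  α : ℝ
  /-- thermal noise power -/
  N₀ : ℝ
  /-- the tier that has the same parent process as the users -/
  q : K₁
  /-- mean number of users of a user cluster -/
  mbarU : ℝ
  /-- density of the position of a user relative to its cluster centre -/
  gU : Plane → ℝ
  lamP_pos : ∀ k, 0 < lamP k
  mbar_pos : ∀ k, 0 < mbar k
  g_density : ∀ k, IsDensity (g k)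
  /-- offspring points are isotropic around the cluster centre -/
  g_isotropic : ∀ k x y, ‖x‖ = ‖y‖ → g k x = g k y
  lam_pos : ∀ k, 0 < lam k
  P_pos : ∀ k, 0 < P k
  τ_pos : ∀ k, 0 < τ k
  two_lt_α : 2 < α
  N₀_nonneg : 0 ≤ N₀
  mbarU_pos : 0 < mbarU
  gU_density : IsDensity gU

/-- Labels of potential base stations: the `l`-th point of the `n`-th cluster of tier `k`, the
`l`-th point of the representative cluster (which belongs to tier `q`), and the `n`-th point of
the Poisson tier `k`. -/
inductive BS (K₁ K₂ : Type*) where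
  | clustered (k : K₁) (n l : ℕ)
  | representative (l : ℕ)
  | poisson (k : K₂) (n : ℕ)

/-- The random variables of the model. A user label `(n, l)` stands for the `l`-th user of the
`n`-th user cluster, whose centre is the `n`-th parent point of tier `q`. -/
structure Data (K₁ K₂ Ω : Type*) where
  /-- parent points -/
  parent : K₁ → ℕ → Ω → Plane
  /-- numbers of points of the clusters -/
  size : K₁ → ℕ → Ω → ℕ
  /-- positions of the points of a cluster relative to the cluster centre -/
  disp : K₁ → ℕ → ℕ → Ω → Plane
  /-- points of the Poisson tiers -/
  point : K₂ → ℕ → Ω → Plane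
  /-- numbers of users of the user clusters -/
  userSize : ℕ → Ω → ℕ
  /-- positions of the users relative to their cluster centre -/
  userDisp : ℕ → ℕ → Ω → Plane
  /-- fading on the link between a user and a base station -/
  linkFade : ℕ × ℕ → BS K₁ K₂ → Ω → ℝ
  /-- centre of the representative cluster, for a typical user at the origin -/
  z₀ : Ω → Plane
  /-- number of base stations of the representative cluster -/
  repSize : Ω → ℕ
  /-- positions of these base stations relative to `z₀` -/
  repDisp : ℕ → Ω → Plane
  /-- fading on the link between the typical user at the origin and a base station -/
  fade : BS K₁ K₂ → Ω → ℝ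

/-- Labels of the independent sources of randomness. -/
inductive Source (K₁ K₂ : Type*) where
  | parents (k : K₁)
  | size (k : K₁) (n : ℕ)
  | disp (k : K₁) (n l : ℕ)
  | points (k : K₂)
  | userSize (n : ℕ)
  | userDisp (n l : ℕ)
  | linkFade (u : ℕ × ℕ) (b : BS K₁ K₂)
  | z₀
  | repSize
  | repDisp (l : ℕ)
  | fade (b : BS K₁ K₂)

/-- The σ-algebra generated by a source of randomness. -/
@[reducible] def Data.sigma {K₁ K₂ Ω : Type*} (D : Data K₁ K₂ Ω) : Source K₁ K₂ → MeasurableSpace Ω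
  | .parents k => MeasurableSpace.comap (fun ω n => D.parent k n ω) inferInstance
  | .size k n => MeasurableSpace.comap (D.size k n) inferInstance
  | .disp k n l => MeasurableSpace.comap (D.disp k n l) inferInstance
  | .points k => MeasurableSpace.comap (fun ω n => D.point k n ω) inferInstance
  | .userSize n => MeasurableSpace.comap (D.userSize n) inferInstance
  | .userDisp n l => MeasurableSpace.comap (D.userDisp n l) inferInstance
  | .linkFade u b => MeasurableSpace.comap (D.linkFade u b) inferInstance
  | .z₀ => MeasurableSpace.comap D.z₀ inferInstance
  | .repSize => MeasurableSpace.comap D.repSize inferInstance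
  | .repDisp l => MeasurableSpace.comap (D.repDisp l) inferInstance
  | .fade b => MeasurableSpace.comap (D.fade b) inferInstance

/-- The random variables have the distributions of the model and are independent. The users and
tier `q` are Poisson cluster processes with the same parent process. -/
structure IsModel {K₁ K₂ Ω : Type*} [MeasurableSpace Ω] (p : Params K₁ K₂)
    (D : Data K₁ K₂ Ω) (μ : Measure Ω) : Prop where
  parent_ppp : ∀ k, IsPPP (p.lamP k) (D.parent k) μ
  size_measurable : ∀ k n, Measurable (D.size k n)
  size_law : ∀ k n, HasLaw (D.size k n) (poissonMeasure (p.mbar k).toNNReal) μ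
  disp_measurable : ∀ k n l, Measurable (D.disp k n l)
  disp_law : ∀ k n l, HasLaw (D.disp k n l) (densityLaw (p.g k)) μ
  point_ppp : ∀ k, IsPPP (p.lam k) (D.point k) μ
  userSize_measurable : ∀ n, Measurable (D.userSize n)
  userSize_law : ∀ n, HasLaw (D.userSize n) (poissonMeasure p.mbarU.toNNReal) μ
  userDisp_measurable : ∀ n l, Measurable (D.userDisp n l)
  userDisp_law : ∀ n l, HasLaw (D.userDisp n l) (densityLaw p.gU) μ
  linkFade_measurable : ∀ u b, Measurable (D.linkFade u b)
  linkFade_law : ∀ u b, HasLaw (D.linkFade u b) (expMeasure 1) μ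
  z₀_measurable : Measurable D.z₀
  /-- the typical user, at the origin, has position `-z₀` relative to its cluster centre -/
  z₀_law : HasLaw (fun ω => -D.z₀ ω) (densityLaw p.gU) μ
  repSize_measurable : Measurable D.repSize
  repSize_law : HasLaw D.repSize (poissonMeasure (p.mbar p.q).toNNReal) μ
  repDisp_measurable : ∀ l, Measurable (D.repDisp l)
  repDisp_law : ∀ l, HasLaw (D.repDisp l) (densityLaw (p.g p.q)) μ
  fade_measurable : ∀ b, Measurable (D.fade b)
  fade_law : ∀ b, HasLaw (D.fade b) (expMeasure 1) μ
  indep : iIndep D.sigma μ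

/-- The network as one user sees it. -/
structure View (K₁ K₂ : Type*) where
  /-- which of the potential base stations exist -/
  present : BS K₁ K₂ → Prop
  /-- positions of the base stations -/
  pos : BS K₁ K₂ → Plane
  /-- fading on the links to the user -/
  fade : BS K₁ K₂ → ℝ
  /-- position of the user -/
  user : Plane

section View

variable {K₁ K₂ : Type*}

/-- The tier of a base station. -/
def BS.tier (p : Params K₁ K₂) : BS K₁ K₂ → K₁ ⊕ K₂
  | .clustered k _ _ => Sum.inl k
  | .representative _ => Sum.inl p.q
  | .poisson k _ => Sum.inr k

/-- Received power averaged over fading, `P_k ‖x‖ ^ (-α)`. -/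
def View.meanPower (p : Params K₁ K₂) (v : View K₁ K₂) (b : BS K₁ K₂) : ℝ≥0∞ :=
  ENNReal.ofReal (p.P (b.tier p)) * ‖v.pos b - v.user‖ₑ ^ (-p.α)

/-- Received power `P_k h_x ‖x‖ ^ (-α)`. -/
def View.power (p : Params K₁ K₂) (v : View K₁ K₂) (b : BS K₁ K₂) : ℝ≥0∞ :=
  ENNReal.ofReal (v.fade b) * v.meanPower p b

/-- Signal-to-interference-and-noise ratio of the user when it is served by `b`. -/
def View.sinr (p : Params K₁ K₂) (v : View K₁ K₂) (b : BS K₁ K₂) : ℝ≥0∞ :=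
  v.power p b /
    (ENNReal.ofReal p.N₀ + ∑' b' : {b' : BS K₁ K₂ // v.present b' ∧ b' ≠ b}, v.power p b')

/-- `b` is the serving base station: it provides the maximum received power averaged over
fading. -/
def View.Serves (p : Params K₁ K₂) (v : View K₁ K₂) (b : BS K₁ K₂) : Prop :=
  v.present b ∧ ∀ b', v.present b' → v.meanPower p b' ≤ v.meanPower p b

/-- The serving base station belongs to tier `i` and the SINR exceeds the threshold of the tier. -/
def View.Covered (p : Params K₁ K₂) (v : View K₁ K₂) (i : K₁ ⊕ K₂) : Prop :=
  ∃ b, b.tier p = i ∧ v.Serves p b ∧ ENNReal.ofReal (p.τ i) < v.sinr p b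

variable {Ω : Type*}

/-- The typical user at the origin; tier `q` is the original tier together with the
representative cluster, and all other tiers are the original ones. -/
def Data.typicalView (D : Data K₁ K₂ Ω) (ω : Ω) : View K₁ K₂ where
  present b := match b with
    | .clustered k n l => l < D.size k n ω
    | .representative l => l < D.repSize ω
    | .poisson _ _ => True
  pos b := match b with
    | .clustered k n l => D.parent k n ω + D.disp k n l ω
    | .representative l => D.z₀ ω + D.repDisp l ω
    | .poisson k n => D.point k n ω
  fade b := D.fade b ω
  user := 0

/-- Position of user `u`. -/
def Data.userPos (p : Params K₁ K₂) (D : Data K₁ K₂ Ω) (u : ℕ × ℕ) (ω : Ω) : Plane :=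
  D.parent p.q u.1 ω + D.userDisp u.1 u.2 ω

/-- The original network (without a representative cluster), seen by its user `u`. -/
def Data.userView (p : Params K₁ K₂) (D : Data K₁ K₂ Ω) (u : ℕ × ℕ) (ω : Ω) : View K₁ K₂ where
  present b := match b with
    | .clustered k n l => l < D.size k n ω
    | .representative _ => False
    | .poisson _ _ => True
  pos b := match b with
    | .clustered k n l => D.parent k n ω + D.disp k n l ω
    | .representative _ => 0
    | .poisson k n => D.point k n ω
  fade b := D.linkFade u b ω
  user := D.userPos p u ω

/-- Expected number of users in `B` whose view has the property `Q`. -/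
def Data.meanUsers [MeasurableSpace Ω] (p : Params K₁ K₂) (D : Data K₁ K₂ Ω) (μ : Measure Ω)
    (B : Set Plane) (Q : View K₁ K₂ → Prop) : ℝ≥0∞ :=
  ∫⁻ ω, ({u : ℕ × ℕ | u.2 < D.userSize u.1 ω ∧ D.userPos p u ω ∈ B ∧
    Q (D.userView p u ω)}.encard : ℝ≥0∞) ∂μ

/-- The Palm probability, given by averaging over the users in `B`, that a user of the original
network has a view with the property `Q`. -/
def Data.palmProb [MeasurableSpace Ω] (p : Params K₁ K₂) (D : Data K₁ K₂ Ω) (μ : Measure Ω)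
    (B : Set Plane) (Q : View K₁ K₂ → Prop) : ℝ≥0∞ :=
  D.meanUsers p μ B Q / D.meanUsers p μ B (fun _ => True)

/-- The tier-`i` coverage probability `P(SINR > τ_i, S_i)` of the typical user at the origin. -/
def Data.tierCoverage [MeasurableSpace Ω] (p : Params K₁ K₂) (D : Data K₁ K₂ Ω)
    (μ : Measure Ω) (i : K₁ ⊕ K₂) : ℝ :=
  μ.real {ω | (D.typicalView ω).Covered p i}

/-- The coverage probability of the typical user at the origin. -/
def Data.coverage [MeasurableSpace Ω] (p : Params K₁ K₂) (D : Data K₁ K₂ Ω)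
    (μ : Measure Ω) : ℝ :=
  μ.real {ω | ∃ i, (D.typicalView ω).Covered p i}

end View

section Formulas

/-- Density at `r` of the distance from the origin of a point whose position relative to its
cluster centre has density `g`, when the centre is at `(z, 0)`. For isotropic `g` this is the
density for every centre at distance `z` from the origin. -/
def distDensity (g : Plane → ℝ) (r z : ℝ) : ℝ :=
  r * ∫ θ in (0 : ℝ)..(2 * Real.pi), g !₂[r * Real.cos θ - z, r * Real.sin θ]

variable {K₁ K₂ : Type*}

/-- `f_{d_k}(r | z)` -/
def Params.fd (p : Params K₁ K₂) (k : K₁) (r z : ℝ) : ℝ := distDensity (p.g k) r z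

/-- `f_{d_u}(z₀ | 0)` -/
def Params.fdU (p : Params K₁ K₂) (z₀ : ℝ) : ℝ := distDensity p.gU z₀ 0

/-- `P̄_{j,i} = (P_j / P_i) ^ (1 / α)` -/
def Params.Pbar (p : Params K₁ K₂) (j i : K₁ ⊕ K₂) : ℝ := (p.P j / p.P i) ^ (1 / p.α)

/-- `ρ(τ, α)` -/
def rho (τ α : ℝ) : ℝ :=
  1 + τ ^ (2 / α) * ∫ t in Set.Ioi (τ ^ (-(2 / α))), 1 / (1 + t ^ (α / 2))

/-- `C_{j,i}(r, z)` -/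
def Params.C (p : Params K₁ K₂) (j : K₁) (i : K₁ ⊕ K₂) (r z : ℝ) : ℝ :=
  Real.exp (-p.mbar j * (1 - ∫ y in Set.Ioi (p.Pbar (.inl j) i * r),
    p.fd j y z / (1 + p.τ i * ((p.Pbar (.inl j) i * r) ^ p.α / y ^ p.α))))

end Formulas

end HetNet

end

open HetNet

/-! The proof counts base stations instead of working with the coverage event itself. Apart from
ties and a user located exactly at a station, a present station `b` with mean power `t` covers the
user if and only if no other station has larger mean power and the fading of `b` exceeds noise plus
interference, multiplied by the threshold and divided by `t`. Charging an infinite penalty for every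
preferred competitor merges both conditions into one inequality `A < h_b` with `A` in `[0, ∞]`.
Since `h_b` is exponential and independent of `A`, its probability is the mean of `exp (-A)`
(`lintegral_lt_fade`), and the whole problem becomes one of Laplace functionals.

These factorise over independent sources. A Poisson cluster with centre `x` has exponent `mbar * (1
- meanFactor)`, and a Poisson process carrying an additive functional `f` has exponent `∫ lam * (1 -
exp (-f))` (`IsPPP.laplace`). The sum over the candidates `b` is evaluated by Mecke formulas: size
biasing inside a Poisson cluster (`IsMarks.tsum_lintegral_expNeg_clusterPenalty`) and the reduced
Campbell–Mecke formula for centres and points (`IsPPP.lintegral_tsum_erase`). In both, removing the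
candidate leaves a process with the original law. The outcome is `typicalMean`, the mean count given
the centre of the representative cluster.

For the Palm statement the sum runs over users. The centre of a user's cluster is also a parent
point of tier `q`; by Mecke and stationarity the user sees this centre at `-u`, where `u` is the
displacement of the user, together with an independent copy of all other parents
(`Params.lintegral_tsum_tierMean`). The result is `typicalMean (-u)` averaged over the law of `u`,
times the mean number of users, and the same average describes the typical user of the modified
network.

Ties are treated by a sandwich. The strict count lets a tie disqualify a station and totals at most
one over all tiers; the loose count ignores ties. The indicator of coverage lies between them, and
both have the same mean because circles are Lebesgue null (`Params.typicalMean_eq`). Neither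
measurability of the coverage event nor almost sure uniqueness of the server is required, and
additivity over tiers comes for free.

Finally, isotropy and polar coordinates reduce the plane integrals to integrals over distances. The
passage from `[0, ∞]` to real integrals is legitimate because the totals are probabilities. -/

noncomputable section
namespace HetNet
open Filter Topology

/-! ### Exponentials with values in `[0, ∞]` -/

section ExpNeg

/-- `exp (-x)` for `x ∈ [0, ∞]`. -/
def expNeg (x : ℝ≥0∞) : ℝ≥0∞ := (EReal.exp (x : EReal))⁻¹

@[simp] lemma expNeg_zero : expNeg 0 = 1 := by simp [expNeg]

@[simp] lemma expNeg_top : expNeg ⊤ = 0 := by simp [expNeg]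

/-- The product rule survives infinite arguments because `EReal.exp` does not vanish here, so
inverting the product never meets `0 * ∞`. -/
lemma expNeg_add (x y : ℝ≥0∞) : expNeg (x + y) = expNeg x * expNeg y := by
  have h (x : ℝ≥0∞) : EReal.exp (x : EReal) ≠ 0 := by simp
  rw [expNeg, EReal.coe_ennreal_add, EReal.exp_add, ENNReal.mul_inv (.inl (h x)) (.inr (h y))]
  rfl

lemma expNeg_antitone : Antitone expNeg := fun _ _ h =>
  ENNReal.inv_le_inv.2 (EReal.exp_monotone (EReal.coe_ennreal_le_coe_ennreal_iff.2 h))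

lemma expNeg_le_one (x : ℝ≥0∞) : expNeg x ≤ 1 := expNeg_zero ▸ expNeg_antitone zero_le

lemma expNeg_ne_top (x : ℝ≥0∞) : expNeg x ≠ ⊤ := ne_top_of_le_ne_top ENNReal.one_ne_top (expNeg_le_one x)

lemma continuous_expNeg : Continuous expNeg :=
  continuous_inv.comp (ENNReal.continuous_exp.comp continuous_coe_ennreal_ereal)

@[fun_prop] lemma measurable_expNeg : Measurable expNeg := continuous_expNeg.measurable

lemma expNeg_ofReal {x : ℝ} (hx : 0 ≤ x) : expNeg (ENNReal.ofReal x) = ENNReal.ofReal (Real.exp (-x)) := by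
  rw [expNeg, EReal.coe_ennreal_ofReal, max_eq_left hx, EReal.exp_coe,
    ← ENNReal.ofReal_inv_of_pos (Real.exp_pos _), Real.exp_neg]

lemma expNeg_sum {ι : Type*} (s : Finset ι) (f : ι → ℝ≥0∞) :
    expNeg (∑ i ∈ s, f i) = ∏ i ∈ s, expNeg (f i) := by
  classical
  induction s using Finset.induction_on with
  | empty => simp
  | insert a s ha ih => rw [Finset.sum_insert ha, Finset.prod_insert ha, expNeg_add, ih]

/-- Stands in for an infinite product: by continuity of `expNeg`, also at `⊤`, the finite
subproducts converge whether or not the sum of the exponents is finite. -/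
lemma tendsto_expNeg_tsum {ι : Type*} (f : ι → ℝ≥0∞) :
    Tendsto (fun s : Finset ι => ∏ i ∈ s, expNeg (f i)) atTop (𝓝 (expNeg (∑' i, f i))) := by
  simp_rw [← expNeg_sum]
  exact (continuous_expNeg.tendsto _).comp ENNReal.summable.hasSum

/-- `-log v` for `v ∈ [0, 1]`. -/
def negLog (v : ℝ≥0∞) : ℝ≥0∞ := if v = 0 then ⊤ else ENNReal.ofReal (-Real.log v.toReal)

@[fun_prop] lemma measurable_negLog : Measurable negLog :=
  Measurable.ite (measurableSet_singleton 0) measurable_const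
    ((Real.measurable_log.comp ENNReal.measurable_toReal).neg.ennreal_ofReal)

/-- Writes a factor in `[0, 1]`, zero included, as an exponential, so that product formulas can be
stated with sums of exponents. -/
lemma expNeg_negLog {v : ℝ≥0∞} (hv : v ≤ 1) : expNeg (negLog v) = v := by
  unfold negLog
  split_ifs with h
  · simp [h]
  · have hv' : v ≠ ⊤ := ne_top_of_le_ne_top ENNReal.one_ne_top hv
    have h1 : v.toReal ≤ 1 := ENNReal.toReal_le_of_le_ofReal zero_le_one (by simpa using hv)
    have h0 : 0 < v.toReal := ENNReal.toReal_pos h hv'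
    rw [expNeg_ofReal (by simpa using Real.log_nonpos h0.le h1), neg_neg, Real.exp_log h0,
      ENNReal.ofReal_toReal hv']

end ExpNeg

/-! ### Expectations under independence -/

section Independence

variable {Ω : Type*} [mΩ : MeasurableSpace Ω] {μ : Measure Ω}

/-- Each `f i` reads only the sources in `T i`. As these sets are disjoint, `f a` is independent of
the product over the remaining indices, and induction peels off one factor at a time. -/
lemma lintegral_prod_of_iIndep {S ι : Type*} {m : S → MeasurableSpace Ω} (h_le : ∀ s, m s ≤ mΩ)
    (hm : iIndep m μ) {T : ι → Set S} (hT : Pairwise (fun i j => Disjoint (T i) (T j)))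
    {f : ι → Ω → ℝ≥0∞} (hf : ∀ i, Measurable[⨆ s ∈ T i, m s] (f i)) (F : Finset ι) :
    ∫⁻ ω, ∏ i ∈ F, f i ω ∂μ = ∏ i ∈ F, ∫⁻ ω, f i ω ∂μ := by
  classical
  have := hm.isProbabilityMeasure
  induction F using Finset.induction_on with
  | empty => simp
  | insert a F ha ih =>
    have hle (U : Set S) : (⨆ s ∈ U, m s) ≤ mΩ := iSup₂_le fun s _ => h_le s
    simp_rw [Finset.prod_insert ha]
    rw [← ih]
    have hd : Disjoint (T a) (⋃ i ∈ F, T i) := by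
      simp only [Set.disjoint_iUnion_right]
      exact fun i hi => hT (fun h => ha (h ▸ hi))
    refine lintegral_mul_eq_lintegral_mul_lintegral_of_independent_measurableSpace
      (hle _) (hle _) (indep_iSup_of_disjoint h_le hm hd) (hf a) ?_
    refine @Finset.measurable_fun_prod _ _ _ _ _ _ (⨆ s ∈ ⋃ i ∈ F, T i, m s) _ F fun i hi => ?_
    refine (hf i).mono ?_ le_rfl
    exact biSup_mono fun s hs => Set.mem_biUnion hi hs

/-- Laplace functional of a sum of independent terms. -/
lemma lintegral_expNeg_tsum {S ι : Type*} [Countable ι] {m : S → MeasurableSpace Ω}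
    (h_le : ∀ s, m s ≤ mΩ)
    (hm : iIndep m μ) {T : ι → Set S} (hT : Pairwise (fun i j => Disjoint (T i) (T j)))
    {f : ι → Ω → ℝ≥0∞} (hf : ∀ i, Measurable[⨆ s ∈ T i, m s] (f i)) {l : ι → ℝ≥0∞}
    (hl : ∀ i, ∫⁻ ω, expNeg (f i ω) ∂μ = expNeg (l i)) :
    ∫⁻ ω, expNeg (∑' i, f i ω) ∂μ = expNeg (∑' i, l i) := by
  have := hm.isProbabilityMeasure
  have hf' i : Measurable (f i) := (hf i).mono (iSup₂_le fun s _ => h_le s) le_rfl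
  -- Dominated convergence with bound `1`, along the finite subsets of a countable index type.
  have h1 : Tendsto (fun s : Finset ι => ∫⁻ ω, ∏ i ∈ s, expNeg (f i ω) ∂μ) atTop
      (𝓝 (∫⁻ ω, expNeg (∑' i, f i ω) ∂μ)) := by
    refine tendsto_lintegral_filter_of_dominated_convergence (fun _ => 1)
      (.of_forall fun s => Finset.measurable_fun_prod _ fun i _ => measurable_expNeg.comp (hf' i))
      (.of_forall fun s => .of_forall fun ω => ?_) (by simp) (.of_forall fun ω => tendsto_expNeg_tsum _)
    rw [← expNeg_sum]
    exact expNeg_le_one _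
  refine tendsto_nhds_unique h1 ?_
  have h2 (s : Finset ι) : ∫⁻ ω, ∏ i ∈ s, expNeg (f i ω) ∂μ = ∏ i ∈ s, expNeg (l i) := by
    rw [lintegral_prod_of_iIndep h_le hm hT (f := fun i ω => expNeg (f i ω))]
    · simp_rw [hl]
    · exact fun i => measurable_expNeg.comp (hf i)
  simp_rw [h2]
  exact tendsto_expNeg_tsum l

/-- Conditioning in the form used throughout: freeze `X` at the outer sample and average `Y` over an
independent copy. It is Fubini for the joint law, so conditional expectations are avoided. -/
lemma lintegral_of_indepFun [IsProbabilityMeasure μ] {α β : Type*} [MeasurableSpace α]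
    [MeasurableSpace β] {X : Ω → α} {Y : Ω → β} (hX : Measurable X) (hY : Measurable Y)
    (h : IndepFun X Y μ) {F : α → β → ℝ≥0∞} (hF : Measurable (Function.uncurry F)) :
    ∫⁻ ω, F (X ω) (Y ω) ∂μ = ∫⁻ ω, ∫⁻ ω', F (X ω) (Y ω') ∂μ ∂μ := by
  have h1 := (indepFun_iff_map_prod_eq_prod_map_map hX.aemeasurable hY.aemeasurable).1 h
  have := Measure.isProbabilityMeasure_map (μ := μ) hX.aemeasurable
  have := Measure.isProbabilityMeasure_map (μ := μ) hY.aemeasurable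
  calc ∫⁻ ω, F (X ω) (Y ω) ∂μ = ∫⁻ z, Function.uncurry F z ∂(μ.map fun ω => (X ω, Y ω)) := by
        rw [lintegral_map hF (by fun_prop)]; rfl
    _ = ∫⁻ a, ∫⁻ b, F a b ∂(μ.map Y) ∂(μ.map X) := by
        rw [h1, lintegral_prod _ hF.aemeasurable]; rfl
    _ = _ := by
        rw [lintegral_map hF.lintegral_prod_right hX]
        refine lintegral_congr fun ω => ?_
        exact lintegral_map (f := F (X ω)) (hF.comp measurable_prodMk_left) hY

lemma lintegral_of_indepFun_hasLaw [IsProbabilityMeasure μ] {α β : Type*} [MeasurableSpace α]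
    [MeasurableSpace β] {X : Ω → α} {Y : Ω → β} {ν : Measure α} (hX : Measurable X)
    (hXν : HasLaw X ν μ) (hY : Measurable Y)
    (h : IndepFun X Y μ) {F : α → β → ℝ≥0∞} (hF : Measurable (Function.uncurry F)) :
    ∫⁻ ω, F (X ω) (Y ω) ∂μ = ∫⁻ x, ∫⁻ ω, F x (Y ω) ∂μ ∂ν := by
  rw [lintegral_of_indepFun hX hY h hF]
  refine hXν.lintegral_comp (f := fun x => ∫⁻ ω, F x (Y ω) ∂μ) (Measurable.aemeasurable ?_)
  exact (hF.comp (measurable_fst.prodMk (hY.comp measurable_snd))).lintegral_prod_right'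

end Independence

/-! ### Exponential and Poisson laws -/

section Laws

/-- The exponential tail, including the level `⊤`, where both sides vanish. It turns a threshold
condition on the fading into a Laplace transform of the level. -/
lemma expMeasure_lt (a : ℝ≥0∞) : expMeasure 1 {x | a < ENNReal.ofReal x} = expNeg a := by
  have := isProbabilityMeasure_expMeasure (r := 1) one_pos
  rcases eq_or_ne a ⊤ with rfl | ha
  · simp
  have h1 : {x : ℝ | a < ENNReal.ofReal x} = (Set.Iic a.toReal)ᶜ := by
    ext x
    simp [ENNReal.lt_ofReal_iff_toReal_lt ha]
  rw [h1, prob_compl_eq_one_sub measurableSet_Iic, ← ofReal_cdf, cdf_expMeasure_eq one_pos,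
    if_pos ENNReal.toReal_nonneg, ← ENNReal.ofReal_one, ← ENNReal.ofReal_sub _ (by simp)]
  rw [one_mul, sub_sub_cancel, ← expNeg_ofReal ENNReal.toReal_nonneg, ENNReal.ofReal_toReal ha]

lemma lintegral_poissonMeasure (r : NNReal) (f : ℕ → ℝ≥0∞) :
    ∫⁻ n, f n ∂(poissonMeasure r) = ∑' n, poissonMeasure r {n} * f n := by
  rw [lintegral_countable']
  exact tsum_congr fun n => mul_comm _ _

/-- The recursion behind all the Mecke formulas: weighting a Poisson law by its value is, up to the
mean, a shift by one. -/
lemma poissonMeasure_singleton_succ (r : NNReal) (n : ℕ) :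
    poissonMeasure r {n + 1} * ((n + 1 : ℕ) : ℝ≥0∞) = r * poissonMeasure r {n} := by
  rw [poissonMeasure_singleton, poissonMeasure_singleton, ← ENNReal.ofReal_natCast,
    ← ENNReal.ofReal_mul (by positivity), ← ENNReal.ofReal_coe_nnreal,
    ← ENNReal.ofReal_mul (by positivity)]
  congr 1
  rw [Nat.factorial_succ]
  push_cast
  have : (n.factorial : ℝ) ≠ 0 := by positivity
  field_simp
  ring

lemma lintegral_pow_poissonMeasure (r : NNReal) {v : ℝ≥0∞} (hv : v ≤ 1) :
    ∫⁻ n, v ^ n ∂(poissonMeasure r) = expNeg (r * (1 - v)) := by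
  obtain ⟨x, rfl⟩ : ∃ x : NNReal, (x : ℝ≥0∞) = v :=
    ⟨v.toNNReal, ENNReal.coe_toNNReal (ne_top_of_le_ne_top ENNReal.one_ne_top hv)⟩
  have hx : x ≤ 1 := by exact_mod_cast hv
  rw [lintegral_poissonMeasure]
  have h1 (n : ℕ) : poissonMeasure r {n} * (x : ℝ≥0∞) ^ n
      = ENNReal.ofReal (Real.exp (-r) * ((r * x : ℝ) ^ n / n.factorial)) := by
    rw [poissonMeasure_singleton, ← ENNReal.ofReal_coe_nnreal, ← ENNReal.ofReal_pow (by positivity),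
      ← ENNReal.ofReal_mul (by positivity)]
    congr 1
    rw [mul_pow]; ring
  have h2 : HasSum (fun n : ℕ => (r * x : ℝ) ^ n / n.factorial) (Real.exp (r * x)) := by
    have := NormedSpace.expSeries_div_hasSum_exp (r * x : ℝ)
    rwa [← Real.exp_eq_exp_ℝ] at this
  have h3 : (r : ℝ≥0∞) * (1 - x) = ENNReal.ofReal (r * (1 - x)) := by
    rw [ENNReal.ofReal_mul (by positivity), ENNReal.ofReal_sub _ (by positivity)]
    simp
  simp_rw [h1]
  rw [← ENNReal.ofReal_tsum_of_nonneg (fun n => by positivity) (h2.mul_left _).summable,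
    (h2.mul_left _).tsum_eq, h3, expNeg_ofReal, ← Real.exp_add]
  · congr 2; ring
  · have : (x : ℝ) ≤ 1 := by exact_mod_cast hx
    have : (0 : ℝ) ≤ 1 - x := by linarith
    positivity

/-- Size biasing. The term `n = 0` vanishes, so the truncated `n - 1` is harmless, and the shift
from `n + 1` to `n` returns the generating function. -/
lemma lintegral_mul_pow_poissonMeasure (r : NNReal) {v : ℝ≥0∞} (hv : v ≤ 1) :
    ∫⁻ n : ℕ, (n : ℝ≥0∞) * v ^ (n - 1) ∂(poissonMeasure r) = r * expNeg (r * (1 - v)) := by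
  rw [← lintegral_pow_poissonMeasure r hv, lintegral_poissonMeasure, lintegral_poissonMeasure,
    tsum_eq_zero_add' ENNReal.summable, ← ENNReal.tsum_mul_left]
  simp only [Nat.cast_zero, zero_mul, mul_zero, zero_add]
  refine tsum_congr fun n => ?_
  rw [← mul_assoc, poissonMeasure_singleton_succ, Nat.add_sub_cancel, mul_assoc]

end Laws

/-! ### Counting measures of families of points -/

section PointMeasure

/-- The counting measure of a family of points. -/
def pointMeasure {ι : Type*} (x : ι → Plane) : Measure Plane := Measure.sum fun i => Measure.dirac (x i)

lemma lintegral_pointMeasure {ι : Type*} (x : ι → Plane) (f : Plane → ℝ≥0∞) :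
    ∫⁻ y, f y ∂(pointMeasure x) = ∑' i, f (x i) := by
  simp [pointMeasure, lintegral_sum_measure]

lemma pointMeasure_apply {ι : Type*} (x : ι → Plane) {A : Set Plane} (hA : MeasurableSet A) :
    pointMeasure x A = ∑' i, A.indicator 1 (x i) := by
  rw [← lintegral_indicator_one hA, lintegral_pointMeasure]

lemma pointMeasure_apply_eq_encard {ι : Type*} (x : ι → Plane) {A : Set Plane} (hA : MeasurableSet A) :
    pointMeasure x A = ({i | x i ∈ A}.encard : ℝ≥0∞) := by
  rw [pointMeasure_apply x hA, ← ENNReal.tsum_set_one]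
  exact (tsum_subtype {i | x i ∈ A} fun _ => (1 : ℝ≥0∞)).symm

lemma pointMeasure_apply_eq_natCast {ι : Type*} (x : ι → Plane) {A : Set Plane}
    (hA : MeasurableSet A) (h : pointMeasure x A ≠ ⊤) : ∃ n : ℕ, pointMeasure x A = n := by
  rw [pointMeasure_apply_eq_encard x hA] at h ⊢
  have h' : {i | x i ∈ A}.encard ≠ ⊤ := by simpa using h
  exact ⟨_, by rw [← ENat.natCast_toNat h', ENat.toENNReal_coe]⟩

/-- The counting measure of a family of points without the point `n`. -/
abbrev eraseMeasure {ι : Type*} (x : ι → Plane) (n : ι) : Measure Plane :=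
  pointMeasure fun m : {m // m ≠ n} => x m

/-- Erasing an index rather than a location keeps the identity valid when points coincide. -/
lemma pointMeasure_eq_add_erase {ι : Type*} (x : ι → Plane) (n : ι) :
    pointMeasure x = Measure.dirac (x n) + eraseMeasure x n := by
  classical
  ext A hA
  rw [Measure.add_apply, pointMeasure_apply _ hA, pointMeasure_apply _ hA,
    ENNReal.tsum_eq_add_tsum_ite n, Measure.dirac_apply' _ hA]
  congr 1
  refine Eq.trans (tsum_congr fun m => ?_)
    (tsum_subtype {m | m ≠ n} fun i => A.indicator (1 : Plane → ℝ≥0∞) (x i)).symm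
  by_cases h : m = n <;> simp [Set.indicator_apply, h]

lemma pointMeasure_erase_le {ι : Type*} (x : ι → Plane) (n : ι) (A : Set Plane) :
    eraseMeasure x n A ≤ pointMeasure x A := by
  rw [pointMeasure_eq_add_erase x n, Measure.add_apply]
  exact le_add_self

lemma measurable_pointMeasure {ι : Type*} [Countable ι] :
    Measurable (pointMeasure : (ι → Plane) → Measure Plane) := by
  refine Measure.measurable_of_measurable_coe _ fun A hA => ?_
  simp_rw [pointMeasure_apply _ hA]
  exact Measurable.tsum fun i =>
    (measurable_one.indicator hA).comp (measurable_pi_apply i)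

@[fun_prop] lemma measurable_pointMeasure' {ι α : Type*} [Countable ι] [MeasurableSpace α]
    {x : ι → α → Plane} (hx : ∀ i, Measurable (x i)) :
    Measurable fun a => pointMeasure fun i => x i a :=
  measurable_pointMeasure.comp (measurable_pi_lambda _ hx)

end PointMeasure

/-! ### Joint law of the counts of a Poisson process -/

section Counts

variable {Ω : Type*} [MeasurableSpace Ω] {μ : Measure Ω} {lam : ℝ} {X : ℕ → Ω → Plane}

lemma IsPPP.measurable_pointMeasure (h : IsPPP lam X μ) :
    Measurable fun ω => pointMeasure fun n => X n ω := measurable_pointMeasure' h.measurable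

lemma IsPPP.measurable_pointMeasure_erase (h : IsPPP lam X μ) (n : ℕ) :
    Measurable fun ω => eraseMeasure (fun m => X m ω) n :=
  measurable_pointMeasure' fun m => h.measurable m

lemma IsPPP.measurable_apply (h : IsPPP lam X μ) {A : Set Plane} (hA : MeasurableSet A) :
    Measurable fun ω => pointMeasure (fun n => X n ω) A :=
  (Measure.measurable_coe hA).comp h.measurable_pointMeasure

/-- Mean number of points in a set of finite area. -/
def rate (lam : ℝ) (A : Set Plane) : NNReal := (lam * (volume A).toReal).toNNReal

lemma coe_rate (lam : ℝ) {A : Set Plane} (hA : volume A < ∞) :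
    (rate lam A : ℝ≥0∞) = ENNReal.ofReal lam * volume A := by
  rw [rate, ← ENNReal.ofReal, ENNReal.ofReal_mul' ENNReal.toReal_nonneg, ENNReal.ofReal_toReal hA.ne]

lemma IsPPP.counts_fintype (h : IsPPP lam X μ) {ι : Type*} [Fintype ι] {A : ι → Set Plane}
    (hA : ∀ a, MeasurableSet (A a)) (hv : ∀ a, volume (A a) < ∞)
    (hd : Pairwise (fun a b => Disjoint (A a) (A b))) (c : ι → ℕ) :
    μ {ω | ∀ a, pointMeasure (fun n => X n ω) (A a) = c a} = ∏ a, poissonMeasure (rate lam (A a)) {c a} := by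
  let e := Fintype.equivFin ι
  have := h.counts _ (fun k => A (e.symm k)) (fun k => hA _) (fun k => hv _)
    (fun a b hab => hd (e.symm.injective.ne hab)) (fun k => c (e.symm k))
  rw [← Equiv.prod_comp e.symm (fun a => poissonMeasure (rate lam (A a)) {c a})]
  refine Eq.trans ?_ this
  congr 1
  ext ω
  simp only [Set.mem_ofPred_eq, pointMeasure_apply_eq_encard _ (hA _)]
  rw [e.symm.forall_congr_left]
  simp only [Equiv.symm_symm, Equiv.symm_apply_apply]
  refine forall_congr' fun a => ?_
  rw [← ENat.toENNReal_coe, ENat.toENNReal_inj]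

/-- Local finiteness is not part of `IsPPP`. It follows because the Poisson masses of the finite
counts add up to one. -/
lemma IsPPP.ae_lt_top [IsProbabilityMeasure μ] (h : IsPPP lam X μ) {A : Set Plane}
    (hA : MeasurableSet A) (hv : volume A < ∞) :
    ∀ᵐ ω ∂μ, pointMeasure (fun n => X n ω) A < ∞ := by
  have h1 (c : ℕ) : μ {ω | pointMeasure (fun n => X n ω) A = c} = poissonMeasure (rate lam A) {c} := by
    simpa using h.counts_fintype (ι := Unit) (A := fun _ => A) (fun _ => hA) (fun _ => hv)
      (fun a b hab => (hab rfl).elim) (fun _ => c)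
  have hm (c : ℕ) : MeasurableSet {ω | pointMeasure (fun n => X n ω) A = c} :=
    h.measurable_apply hA (measurableSet_singleton _)
  have h2 : μ (⋃ c : ℕ, {ω | pointMeasure (fun n => X n ω) A = c}) = 1 := by
    rw [measure_iUnion _ hm]
    · simp_rw [h1]
      have := lintegral_poissonMeasure (rate lam A) 1
      simpa using this.symm
    · intro a b hab
      refine Set.disjoint_left.2 fun ω (h1 : _ = _) (h2 : _ = _) => hab ?_
      exact_mod_cast h1.symm.trans h2
  have h3 := (mem_ae_iff_prob_eq_one (MeasurableSet.iUnion hm)).2 h2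
  filter_upwards [h3] with ω hω
  obtain ⟨c, hc⟩ := Set.mem_iUnion.1 hω
  rw [show pointMeasure (fun n => X n ω) A = c from hc]
  exact ENNReal.natCast_lt_top c

/-- Joint law of the counts in disjoint sets. -/
lemma IsPPP.map_counts [IsProbabilityMeasure μ] (h : IsPPP lam X μ) {ι : Type*} [Fintype ι]
    {A : ι → Set Plane} (hA : ∀ a, MeasurableSet (A a)) (hv : ∀ a, volume (A a) < ∞)
    (hd : Pairwise (fun a b => Disjoint (A a) (A b))) :
    ∃ N : ι → Ω → ℕ, (∀ a, Measurable (N a)) ∧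
      (∀ᵐ ω ∂μ, ∀ a, pointMeasure (fun n => X n ω) (A a) = N a ω) ∧
      μ.map (fun ω a => N a ω) = Measure.pi fun a => poissonMeasure (rate lam (A a)) := by
  -- The default `0` given to an infinite count matters only on a null set.
  let N : ι → Ω → ℕ := fun a ω => ⌊(pointMeasure (fun n => X n ω) (A a)).toReal⌋₊
  have hN a : Measurable (N a) :=
    Nat.measurable_floor.comp (ENNReal.measurable_toReal.comp (h.measurable_apply (hA a)))
  have hae : ∀ᵐ ω ∂μ, ∀ a, pointMeasure (fun n => X n ω) (A a) = N a ω := by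
    rw [ae_all_iff]
    intro a
    filter_upwards [h.ae_lt_top (hA a) (hv a)] with ω hω
    obtain ⟨n, hn⟩ := pointMeasure_apply_eq_natCast _ (hA a) hω.ne
    simp [N, hn]
  refine ⟨N, hN, hae, Measure.ext_of_singleton fun c => ?_⟩
  rw [Measure.map_apply (measurable_pi_lambda _ hN) (measurableSet_singleton _), Measure.pi_singleton,
    ← h.counts_fintype hA hv hd c]
  refine measure_congr ?_
  filter_upwards [hae] with ω hω
  refine propext ?_
  change (fun a => N a ω) = c ↔ ∀ a, _ = _
  simp_rw [hω, funext_iff, Nat.cast_inj]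

lemma IsPPP.lintegral_prod_counts [IsProbabilityMeasure μ] (h : IsPPP lam X μ) {ι : Type*} [Fintype ι]
    {A : ι → Set Plane} (hA : ∀ a, MeasurableSet (A a)) (hv : ∀ a, volume (A a) < ∞)
    (hd : Pairwise (fun a b => Disjoint (A a) (A b))) (r : ι → ℝ≥0∞) :
    ∫⁻ ω, expNeg (∑ a, r a * pointMeasure (fun n => X n ω) (A a)) ∂μ =
      expNeg (∑ a, ENNReal.ofReal lam * volume (A a) * (1 - expNeg (r a))) := by
  obtain ⟨N, hN, hae, hmap⟩ := h.map_counts hA hv hd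
  have h1 (r : ℝ≥0∞) (n : ℕ) : expNeg (r * n) = expNeg r ^ n := by
    have := expNeg_sum (Finset.range n) (fun _ => r)
    simpa [mul_comm] using this
  calc ∫⁻ ω, expNeg (∑ a, r a * pointMeasure (fun n => X n ω) (A a)) ∂μ
      = ∫⁻ ω, ∏ a, expNeg (r a) ^ N a ω ∂μ := by
        refine lintegral_congr_ae ?_
        filter_upwards [hae] with ω hω
        simp_rw [hω, expNeg_sum, h1]
    _ = ∫⁻ c : ι → ℕ, ∏ a, expNeg (r a) ^ c a ∂(Measure.pi fun a => poissonMeasure (rate lam (A a))) := by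
        rw [← hmap, lintegral_map (.of_discrete) (measurable_pi_lambda _ hN)]
    _ = ∏ a, ∫⁻ c : ι → ℕ, expNeg (r a) ^ c a ∂(Measure.pi fun a => poissonMeasure (rate lam (A a))) := by
        refine lintegral_prod_eq_prod_lintegral_of_indepFun _
          (fun a (c : ι → ℕ) => expNeg (r a) ^ c a) ?_ fun a => .of_discrete
        exact iIndepFun_pi (X := fun a (n : ℕ) => expNeg (r a) ^ n) fun a => Measurable.aemeasurable .of_discrete
    _ = _ := by
        rw [expNeg_sum]
        refine Finset.prod_congr rfl fun a _ => ?_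
        rw [← coe_rate lam (hv a), ← lintegral_pow_poissonMeasure _ (expNeg_le_one _)]
        exact (measurePreserving_eval (fun a => poissonMeasure (rate lam (A a))) a).lintegral_comp
          (f := fun n : ℕ => expNeg (r a) ^ n) .of_discrete

end Counts

/-! ### Laplace functional of a Poisson process -/

section Laplace

variable {Ω : Type*} [MeasurableSpace Ω] {μ : Measure Ω} [IsProbabilityMeasure μ] {lam : ℝ}
  {X : ℕ → Ω → Plane}

/-- The nonzero level sets are disjoint and of finite area, so the integral of `φ` against the
points is a linear combination of independent Poisson counts. The level `0` has infinite area; it is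
left out and contributes nothing on either side. -/
lemma IsPPP.laplace_simpleFunc (h : IsPPP lam X μ) (φ : SimpleFunc Plane ℝ≥0∞)
    (hφ : volume (φ ⁻¹' {0}ᶜ) < ∞) :
    ∫⁻ ω, expNeg (∫⁻ y, φ y ∂(pointMeasure fun n => X n ω)) ∂μ =
      expNeg (∫⁻ y, ENNReal.ofReal lam * (1 - expNeg (φ y))) := by
  classical
  let s := φ.range.erase 0
  let A : s → Set Plane := fun r => φ ⁻¹' {r.1}
  have hA a : MeasurableSet (A a) := φ.measurableSet_fiber _
  have hsub (a : s) : A a ⊆ φ ⁻¹' {0}ᶜ := fun y hy => by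
    have : φ y = a := hy
    simpa [this] using (Finset.mem_erase.1 a.2).1
  have hv a : volume (A a) < ∞ := (measure_mono (hsub a)).trans_lt hφ
  have hd : Pairwise (fun a b => Disjoint (A a) (A b)) := fun a b hab =>
    Set.disjoint_left.2 fun y (h1 : φ y = a) (h2 : φ y = b) => hab (Subtype.ext (h1.symm.trans h2))
  have hl (F : ℝ≥0∞ → ℝ≥0∞) (hF : F 0 = 0) (ν : Measure Plane) :
      ∫⁻ y, F (φ y) ∂ν = ∑ a : s, F a * ν (A a) := by
    rw [Finset.univ_eq_attach, Finset.sum_attach s fun r => F r * ν (φ ⁻¹' {r})]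
    have := (φ.map F).lintegral_eq_lintegral ν
    rw [SimpleFunc.map_lintegral] at this
    simp only [SimpleFunc.map_apply] at this
    rw [this]
    by_cases h0 : (0 : ℝ≥0∞) ∈ φ.range
    · rw [← Finset.add_sum_erase _ _ h0, hF, zero_mul, zero_add]
    · rw [show s = φ.range from Finset.erase_eq_of_notMem h0]
  have hl' ν : ∫⁻ y, φ y ∂ν = ∑ a : s, a.1 * ν (A a) := hl id rfl ν
  rw [hl (fun r => ENNReal.ofReal lam * (1 - expNeg r)) (by simp)]
  simp_rw [hl']
  refine (h.lintegral_prod_counts hA hv hd fun a => a.1).trans ?_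
  congr 1
  exact Finset.sum_congr rfl fun a _ => by ring

/-- Laplace functional of a Poisson point process. -/
lemma IsPPP.laplace (h : IsPPP lam X μ) {f : Plane → ℝ≥0∞} (hf : Measurable f) :
    ∫⁻ ω, expNeg (∑' n, f (X n ω)) ∂μ = expNeg (∫⁻ y, ENNReal.ofReal lam * (1 - expNeg (f y))) := by
  simp_rw [← lintegral_pointMeasure]
  -- Restricting to growing balls gives the approximations a support of finite area.
  let φ : ℕ → SimpleFunc Plane ℝ≥0∞ := fun k => (SimpleFunc.eapprox f k).restrict (Metric.ball 0 k)
  have hφ k y : φ k y = (Metric.ball (0 : Plane) k).indicator (SimpleFunc.eapprox f k) y := by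
    rw [SimpleFunc.restrict_apply _ measurableSet_ball]
  have hmono : Monotone fun k y => φ k y := by
    intro k l hkl y
    change φ k y ≤ φ l y
    rw [hφ, hφ]
    refine (Set.indicator_le_indicator (SimpleFunc.monotone_eapprox f hkl y)).trans
      (Set.indicator_le_indicator_of_subset (Metric.ball_subset_ball (by exact_mod_cast hkl))
        (fun _ => zero_le) y)
  have hsup y : Tendsto (fun k => φ k y) atTop (𝓝 (f y)) := by
    have h1 : Tendsto (fun k => SimpleFunc.eapprox f k y) atTop (𝓝 (f y)) := by
      have := tendsto_atTop_iSup fun k l hkl => SimpleFunc.monotone_eapprox f hkl y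
      rwa [SimpleFunc.iSup_eapprox_apply hf] at this
    refine h1.congr' ?_
    obtain ⟨k, hk⟩ := exists_nat_gt ‖y‖
    filter_upwards [eventually_ge_atTop k] with l hl
    rw [hφ, Set.indicator_of_mem]
    simpa using hk.trans_le (by exact_mod_cast hl)
  have hfin k : volume (φ k ⁻¹' {0}ᶜ) < ∞ := by
    refine (measure_mono ?_).trans_lt (measure_ball_lt_top (x := (0 : Plane)) (r := k))
    intro y hy
    by_contra hc
    exact hy (by simp [hφ, hc])
  have key k := h.laplace_simpleFunc (φ k) (hfin k)
  have hlim (ν : Measure Plane) : Tendsto (fun k => ∫⁻ y, φ k y ∂ν) atTop (𝓝 (∫⁻ y, f y ∂ν)) :=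
    lintegral_tendsto_of_tendsto_of_monotone (fun k => (φ k).measurable.aemeasurable)
      (.of_forall fun y => fun k l hkl => hmono hkl y) (.of_forall hsup)
  have hL : Tendsto (fun k => ∫⁻ ω, expNeg (∫⁻ y, φ k y ∂(pointMeasure fun n => X n ω)) ∂μ) atTop
      (𝓝 (∫⁻ ω, expNeg (∫⁻ y, f y ∂(pointMeasure fun n => X n ω)) ∂μ)) := by
    refine tendsto_lintegral_of_dominated_convergence (fun _ => 1) (fun k => ?_)
      (fun k => .of_forall fun ω => expNeg_le_one _) (by simp)
      (.of_forall fun ω => (continuous_expNeg.tendsto _).comp (hlim _))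
    exact measurable_expNeg.comp
      ((Measure.measurable_lintegral (φ k).measurable).comp h.measurable_pointMeasure)
  -- `1 - expNeg` is increasing and continuous, so the right-hand side converges monotonically as
  -- well.
  have hR : Tendsto (fun k => ∫⁻ y, ENNReal.ofReal lam * (1 - expNeg (φ k y))) atTop
      (𝓝 (∫⁻ y, ENNReal.ofReal lam * (1 - expNeg (f y)))) := by
    refine lintegral_tendsto_of_tendsto_of_monotone (fun k => ?_) (.of_forall fun y k l hkl => ?_)
      (.of_forall fun y => ?_)
    · have := (φ k).measurable
      fun_prop
    · exact mul_le_mul_right (tsub_le_tsub_left (expNeg_antitone (hmono hkl y)) _) _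
    · refine ENNReal.Tendsto.const_mul ?_ (.inr ENNReal.ofReal_ne_top)
      exact ENNReal.Tendsto.sub tendsto_const_nhds ((continuous_expNeg.tendsto _).comp (hsup y))
        (.inl ENNReal.one_ne_top)
  simp_rw [key] at hL
  exact tendsto_nhds_unique hL ((continuous_expNeg.tendsto _).comp hR)

end Laplace

/-! ### Campbell–Mecke formula and stationarity -/

section Mecke

variable {Ω : Type*} [MeasurableSpace Ω] {μ : Measure Ω} {lam : ℝ}
  {X : ℕ → Ω → Plane}

/-- The heart of the Mecke formula. Each point found in `A a₀` raises one count by one, and the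
Poisson recursion trades the number of such points for the mean of that count. -/
lemma IsPPP.sum_measure_counts_erase (h : IsPPP lam X μ) {ι : Type*} [Fintype ι] {A : ι → Set Plane}
    (hA : ∀ a, MeasurableSet (A a)) (hv : ∀ a, volume (A a) < ∞)
    (hd : Pairwise (fun a b => Disjoint (A a) (A b))) (a₀ : ι) (c : ι → ℕ) :
    ∑' n, μ {ω | X n ω ∈ A a₀ ∧ ∀ a, eraseMeasure (fun m => X m ω) n (A a) = c a} =
      ENNReal.ofReal lam * volume (A a₀) * μ {ω | ∀ a, pointMeasure (fun n => X n ω) (A a) = c a} := by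
  classical
  -- With the point `X n` put back, the count in `A a₀` is one larger and the other counts are
  -- unchanged.
  let c' := Function.update c a₀ (c a₀ + 1)
  let E : Set Ω := {ω | ∀ a, pointMeasure (fun n => X n ω) (A a) = c' a}
  have hE : MeasurableSet E := by
    have : E = ⋂ a, {ω | pointMeasure (fun n => X n ω) (A a) = c' a} := by
      ext; simp [E]
    rw [this]
    exact MeasurableSet.iInter fun a => h.measurable_apply (hA a) (measurableSet_singleton _)
  have h1 n : {ω | X n ω ∈ A a₀ ∧ ∀ a, eraseMeasure (fun m => X m ω) n (A a) = c a} =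
      X n ⁻¹' A a₀ ∩ E := by
    ext ω
    simp only [Set.mem_ofPred_eq, Set.mem_inter_iff, Set.mem_preimage, E]
    refine and_congr_right fun hn => forall_congr' fun a => ?_
    rw [pointMeasure_eq_add_erase (fun n => X n ω) n, Measure.add_apply, Measure.dirac_apply' _ (hA a)]
    rcases eq_or_ne a a₀ with rfl | ha
    · simp only [hn, Set.indicator_of_mem, Pi.one_apply, c', Function.update_self, Nat.cast_add,
        Nat.cast_one]
      rw [add_comm, ENNReal.add_left_inj ENNReal.one_ne_top]
    · have : X n ω ∉ A a := fun h' => Set.disjoint_left.1 (hd ha) h' hn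
      simp [this, c', ha]
  simp_rw [h1]
  -- On `E` exactly `c a₀ + 1` indices have their point in `A a₀`, so summing over `n` produces this
  -- constant.
  have h2 : ∑' n, μ (X n ⁻¹' A a₀ ∩ E) = (c a₀ + 1 : ℕ) * μ E := by
    calc ∑' n, μ (X n ⁻¹' A a₀ ∩ E) = ∑' n, ∫⁻ ω in E, (A a₀).indicator 1 (X n ω) ∂μ := by
          refine tsum_congr fun n => ?_
          rw [← Measure.restrict_apply (h.measurable n (hA a₀)),
            ← lintegral_indicator_one (h.measurable n (hA a₀))]
          rfl
      _ = ∫⁻ ω in E, pointMeasure (fun n => X n ω) (A a₀) ∂μ := by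
          rw [← lintegral_tsum]
          · simp_rw [pointMeasure_apply _ (hA a₀)]
          · exact fun n => ((measurable_one.indicator (hA a₀)).comp (h.measurable n)).aemeasurable
      _ = ∫⁻ ω in E, (c a₀ + 1 : ℕ) ∂μ := by
          refine setLIntegral_congr_fun hE fun ω hω => ?_
          have h3 : pointMeasure (fun n => X n ω) (A a₀) = c' a₀ := hω a₀
          simpa only [c', Function.update_self] using h3
      _ = _ := by rw [setLIntegral_const]
  rw [h2, h.counts_fintype hA hv hd, h.counts_fintype hA hv hd,
    ← Finset.mul_prod_erase _ _ (Finset.mem_univ a₀), ← Finset.mul_prod_erase _ _ (Finset.mem_univ a₀),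
    ← mul_assoc, mul_comm ((c a₀ + 1 : ℕ) : ℝ≥0∞), ← coe_rate lam (hv a₀), ← mul_assoc]
  congr 1
  · simp only [c', Function.update_self]
    exact poissonMeasure_singleton_succ _ _
  · refine Finset.prod_congr rfl fun a ha => ?_
    simp [c', Finset.ne_of_mem_erase ha]

/-- Almost surely `Y` takes values in a countable set of natural vectors. Splitting over these
values makes an arbitrary `W` admissible. -/
lemma measure_inter_preimage_eq_tsum {ι : Type*} [Fintype ι] {Y : Ω → ι → ℝ≥0∞} (hY : Measurable Y)
    (hN : ∀ᵐ ω ∂μ, ∃ c : ι → ℕ, ∀ a, Y ω a = c a) (E : Set Ω)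
    {W : Set (ι → ℝ≥0∞)} :
    μ (E ∩ Y ⁻¹' W) = ∑' c : {c : ι → ℕ // (fun a => (c a : ℝ≥0∞)) ∈ W},
      μ (E ∩ {ω | ∀ a, Y ω a = c.1 a}) := by
  have hm (c : {c : ι → ℕ // (fun a => (c a : ℝ≥0∞)) ∈ W}) : MeasurableSet {ω | ∀ a, Y ω a = c.1 a} := by
    have : {ω | ∀ a, Y ω a = c.1 a} = Y ⁻¹' {fun a => (c.1 a : ℝ≥0∞)} := by
      ext ω; simp [funext_iff]
    rw [this]
    exact hY (measurableSet_singleton _)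
  have h1 : μ (E ∩ Y ⁻¹' W) = μ (E ∩ ⋃ c : {c : ι → ℕ // (fun a => (c a : ℝ≥0∞)) ∈ W},
      {ω | ∀ a, Y ω a = c.1 a}) := by
    refine measure_congr ?_
    filter_upwards [hN] with ω ⟨c, hc⟩
    refine propext (and_congr_right fun _ => ?_)
    change Y ω ∈ W ↔ ω ∈ _
    simp only [Set.mem_iUnion, Set.mem_ofPred_eq, Subtype.exists]
    constructor
    · intro hw
      refine ⟨c, ?_, hc⟩
      rwa [← show Y ω = fun a => (c a : ℝ≥0∞) from funext hc]
    · rintro ⟨c', hw, hc'⟩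
      rwa [show Y ω = fun a => (c' a : ℝ≥0∞) from funext hc']
  rw [h1, Set.inter_comm, ← Measure.restrict_apply (MeasurableSet.iUnion hm), measure_iUnion _ hm]
  · exact tsum_congr fun c => by rw [Measure.restrict_apply (hm c), Set.inter_comm]
  · intro c d hcd
    refine Set.disjoint_left.2 fun ω (h1 : ∀ a, _ = _) (h2 : ∀ a, _ = _) => hcd ?_
    ext a
    exact_mod_cast (h1 a).symm.trans (h2 a)

lemma IsPPP.sum_measure_preimage_erase [IsProbabilityMeasure μ] (h : IsPPP lam X μ) {ι : Type*} [Fintype ι] {A : ι → Set Plane}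
    (hA : ∀ a, MeasurableSet (A a)) (hv : ∀ a, volume (A a) < ∞)
    (hd : Pairwise (fun a b => Disjoint (A a) (A b))) (a₀ : ι) {W : Set (ι → ℝ≥0∞)} :
    ∑' n, μ {ω | X n ω ∈ A a₀ ∧ (fun a => eraseMeasure (fun m => X m ω) n (A a)) ∈ W} =
      ENNReal.ofReal lam * volume (A a₀) * μ {ω | (fun a => pointMeasure (fun n => X n ω) (A a)) ∈ W} := by
  have hfin : ∀ᵐ ω ∂μ, ∀ a, pointMeasure (fun n => X n ω) (A a) < ∞ :=
    ae_all_iff.2 fun a => h.ae_lt_top (hA a) (hv a)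
  have h1 n := measure_inter_preimage_eq_tsum (μ := μ)
    (Y := fun ω a => eraseMeasure (fun m => X m ω) n (A a))
    (measurable_pi_lambda _ fun a => (Measure.measurable_coe (hA a)).comp
      (h.measurable_pointMeasure_erase n))
    (by
      filter_upwards [hfin] with ω hω
      choose c hc using fun a => pointMeasure_apply_eq_natCast _ (hA a)
        ((pointMeasure_erase_le (fun n => X n ω) n (A a)).trans_lt (hω a)).ne
      exact ⟨c, hc⟩) (X n ⁻¹' A a₀) (W := W)
  have h2 := measure_inter_preimage_eq_tsum (μ := μ)
    (Y := fun ω a => pointMeasure (fun n => X n ω) (A a))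
    (measurable_pi_lambda _ fun a => h.measurable_apply (hA a))
    (by
      filter_upwards [hfin] with ω hω
      choose c hc using fun a => pointMeasure_apply_eq_natCast _ (hA a) (hω a).ne
      exact ⟨c, hc⟩) Set.univ (W := W)
  rw [Set.univ_inter] at h2
  simp_rw [Set.univ_inter] at h2
  have h3 (c : ι → ℕ) := h.sum_measure_counts_erase hA hv hd a₀ c
  have h4 n : μ {ω | X n ω ∈ A a₀ ∧ (fun a => eraseMeasure (fun m => X m ω) n (A a)) ∈ W} =
      ∑' c : {c : ι → ℕ // (fun a => (c a : ℝ≥0∞)) ∈ W}, μ {ω | X n ω ∈ A a₀ ∧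
        ∀ a, eraseMeasure (fun m => X m ω) n (A a) = c.1 a} := h1 n
  have h5 : μ {ω | (fun a => pointMeasure (fun n => X n ω) (A a)) ∈ W} =
      ∑' c : {c : ι → ℕ // (fun a => (c a : ℝ≥0∞)) ∈ W}, μ {ω |
        ∀ a, pointMeasure (fun n => X n ω) (A a) = c.1 a} := h2
  rw [h5, ← ENNReal.tsum_mul_left, tsum_congr h4, ENNReal.tsum_comm]
  exact tsum_congr fun c => h3 c.1

/-- Evaluations at sets of finite area, as σ-algebras. -/
@[reducible] def evalSigma (B : Set Plane) : MeasurableSpace (Measure Plane) :=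
  MeasurableSpace.comap (fun ζ => ζ B) inferInstance

/-- Balls exhaust the plane, so the mass of a measurable set is a supremum of masses of sets of
finite area, the only ones that `IsPPP` controls. -/
lemma iSup_evalSigma :
    (⨆ B ∈ {B : Set Plane | MeasurableSet B ∧ volume B < ∞}, evalSigma B) =
      (inferInstance : MeasurableSpace (Measure Plane)) := by
  apply le_antisymm
  · exact iSup₂_le fun B hB => (Measure.measurable_coe hB.1).comap_le
  · refine iSup₂_le fun s hs => ?_
    rw [← BorelSpace.measurable_eq (α := ℝ≥0∞)]
    refine Measurable.comap_le ?_
    have h1 : (fun ζ : Measure Plane => ζ s) = fun ζ => ⨆ k : ℕ, ζ (s ∩ Metric.ball 0 k) := by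
      ext ζ
      rw [← Monotone.measure_iUnion, ← Set.inter_iUnion, Metric.iUnion_ball_nat, Set.inter_univ]
      intro k l hkl
      exact Set.inter_subset_inter_right _ (Metric.ball_subset_ball (by exact_mod_cast hkl))
    rw [h1]
    have hm (m : MeasurableSpace (Measure Plane)) (f : ℕ → Measure Plane → ℝ≥0∞)
        (hf : ∀ k, Measurable[m] (f k)) : Measurable[m] fun ζ => ⨆ k, f k ζ := Measurable.iSup hf
    refine hm _ _ fun k => ?_
    refine Measurable.mono (comap_measurable (fun ζ : Measure Plane => ζ (s ∩ Metric.ball 0 k))) ?_ le_rfl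
    refine le_iSup₂_of_le (s ∩ Metric.ball 0 k) ⟨hs.inter measurableSet_ball, ?_⟩ le_rfl
    exact (measure_mono Set.inter_subset_right).trans_lt measure_ball_lt_top

/-- The sets of `t` and the set `s` may overlap, whereas the counts are known for disjoint sets. The
atoms of the algebra they generate are disjoint, each set is a union of atoms, and conditions on the
sets become conditions on the atom counts. -/
lemma IsPPP.sum_measure_cylinder_erase [IsProbabilityMeasure μ] (h : IsPPP lam X μ) {s : Set Plane} (hs : MeasurableSet s)
    (hsv : volume s < ∞) (t : Finset (Set Plane)) (ht : ∀ B ∈ t, MeasurableSet B ∧ volume B < ∞)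
    (V : Set Plane → Set ℝ≥0∞) (hV : ∀ B ∈ t, MeasurableSet (V B)) :
    ∑' n, μ {ω | X n ω ∈ s ∧ ∀ B ∈ t, eraseMeasure (fun m => X m ω) n B ∈ V B} =
      ENNReal.ofReal lam * volume s * μ {ω | ∀ B ∈ t, pointMeasure (fun n => X n ω) B ∈ V B} := by
  classical
  let t' := insert s t
  have ht' : ∀ B ∈ t', MeasurableSet B ∧ volume B < ∞ := by
    intro B hB
    rcases Finset.mem_insert.1 hB with rfl | hB
    exacts [⟨hs, hsv⟩, ht B hB]
  let pat : Plane → t' → Bool := fun x B => decide (x ∈ B.1)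
  have hpat : Measurable pat := measurable_pi_lambda _ fun B =>
    Measurable.comp (g := fun p : Prop => decide p) .of_discrete (measurable_to_prop (by
      simpa [Set.preimage] using (ht' B B.2).1))
  -- The pattern of points in none of the sets is dropped, as its atom has infinite area.
  let κ := {f : t' → Bool // ∃ B, f B = true}
  let A : κ → Set Plane := fun f => pat ⁻¹' {f.1}
  have hA a : MeasurableSet (A a) := hpat (measurableSet_singleton _)
  have hsub (a : κ) (B : t') (hB : a.1 B = true) : A a ⊆ B.1 := fun x (hx : pat x = a.1) => by
    have := congrFun hx B
    rw [hB] at this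
    simpa [pat] using this
  have hv a : volume (A a) < ∞ := by
    obtain ⟨B, hB⟩ := a.2
    exact (measure_mono (hsub a B hB)).trans_lt (ht' B B.2).2
  have hd : Pairwise (fun a b => Disjoint (A a) (A b)) := fun a b hab =>
    Set.disjoint_left.2 fun y (h1 : pat y = a.1) (h2 : pat y = b.1) => hab (Subtype.ext (h1.symm.trans h2))
  have hun (B : t') : B.1 = ⋃ a ∈ Finset.univ.filter (fun a : κ => a.1 B = true), A a := by
    ext x
    simp only [Finset.mem_filter, Finset.mem_univ, true_and, Set.mem_iUnion, exists_prop]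
    constructor
    · intro hx
      have : pat x B = true := by simpa [pat] using hx
      exact ⟨⟨pat x, B, this⟩, this, rfl⟩
    · rintro ⟨a, ha, hx⟩
      exact hsub a B ha hx
  have hsum (B : t') (ζ : Measure Plane) :
      ζ B.1 = ∑ a ∈ Finset.univ.filter (fun a : κ => a.1 B = true), ζ (A a) := by
    conv_lhs => rw [hun B]
    exact measure_biUnion_finset (fun a _ b _ hab => hd hab) fun a _ => hA a
  -- Only sets of `t` impose a condition; `s` was adjoined so that it, too, is a union of atoms.
  let W : Set (κ → ℝ≥0∞) := ⋂ B : t', {y | B.1 ∈ t →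
    ∑ a ∈ Finset.univ.filter (fun a : κ => a.1 B = true), y a ∈ V B.1}
  have hmem (ζ : Measure Plane) : (fun a => ζ (A a)) ∈ W ↔ ∀ B ∈ t, ζ B ∈ V B := by
    simp only [W, Set.mem_iInter, Set.mem_ofPred_eq, ← hsum]
    exact ⟨fun H B hB => H ⟨B, Finset.mem_insert_of_mem hB⟩ hB, fun H B hB => H _ hB⟩
  have key a₀ := h.sum_measure_preimage_erase hA hv hd a₀ (W := W)
  simp_rw [hmem] at key
  let B₀ : t' := ⟨s, Finset.mem_insert_self _ _⟩
  let F := Finset.univ.filter (fun a : κ => a.1 B₀ = true)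
  have hm n : MeasurableSet {ω | ∀ B ∈ t, eraseMeasure (fun m => X m ω) n B ∈ V B} := by
    have : {ω | ∀ B ∈ t, eraseMeasure (fun m => X m ω) n B ∈ V B} =
        ⋂ B ∈ t, {ω | eraseMeasure (fun m => X m ω) n B ∈ V B} := by ext; simp
    rw [this]
    exact Finset.measurableSet_biInter _ fun B hB =>
      ((Measure.measurable_coe (ht B hB).1).comp (h.measurable_pointMeasure_erase n)) (hV B hB)
  calc _ = ∑' n, ∑ a ∈ F, μ {ω | X n ω ∈ A a ∧ ∀ B ∈ t,
        eraseMeasure (fun m => X m ω) n B ∈ V B} := by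
        refine tsum_congr fun n => ?_
        rw [← measure_biUnion_finset]
        · congr 1
          ext ω
          have := Set.ext_iff.1 (hun B₀) (X n ω)
          simp only [B₀] at this
          simp only [Set.mem_ofPred_eq, this, Set.mem_iUnion, exists_prop, F, B₀]
          constructor
          · rintro ⟨⟨a, ha, hx⟩, hr⟩
            exact ⟨a, ha, hx, hr⟩
          · rintro ⟨a, ha, hx, hr⟩
            exact ⟨⟨a, ha, hx⟩, hr⟩
        · exact fun a _ b _ hab => Set.disjoint_left.2 fun ω h1 h2 => Set.disjoint_left.1 (hd hab) h1.1 h2.1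
        · exact fun a _ => (h.measurable n (hA a)).inter (hm n)
    _ = ∑ a ∈ F, ENNReal.ofReal lam * volume (A a) *
          μ {ω | ∀ B ∈ t, pointMeasure (fun n => X n ω) B ∈ V B} := by
        rw [Summable.tsum_finsetSum fun _ _ => ENNReal.summable]
        exact Finset.sum_congr rfl fun a _ => key a
    _ = _ := by
        rw [← Finset.sum_mul, ← Finset.mul_sum]
        congr 2
        exact (hsum B₀ volume).symm

/-- Reduced Campbell–Mecke formula for a Poisson point process. -/
lemma IsPPP.lintegral_tsum_erase [IsProbabilityMeasure μ] (h : IsPPP lam X μ) {F : Plane → Measure Plane → ℝ≥0∞}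
    (hF : Measurable (Function.uncurry F)) :
    ∫⁻ ω, ∑' n, F (X n ω) (eraseMeasure (fun m => X m ω) n) ∂μ =
      ENNReal.ofReal lam * ∫⁻ x, ∫⁻ ω, F x (pointMeasure fun n => X n ω) ∂μ := by
  have hξ := h.measurable_pointMeasure
  have hpair n : Measurable fun ω => (X n ω, eraseMeasure (fun m => X m ω) n) :=
    (h.measurable n).prodMk (h.measurable_pointMeasure_erase n)
  let M₁ : Measure (Plane × Measure Plane) :=
    Measure.sum fun n => μ.map fun ω => (X n ω, eraseMeasure (fun m => X m ω) n)
  have : IsProbabilityMeasure (μ.map fun ω => pointMeasure fun n => X n ω) :=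
    Measure.isProbabilityMeasure_map hξ.aemeasurable
  -- The formula asserts that two measures on pairs of a point and a point measure coincide:
  -- intensity times the law of the whole process, and the sum over `n` of the laws of `X n` paired
  -- with the remaining points. Products of a set of finite area with a cylinder form a generating
  -- π-system, on which the claim is the cylinder case.
  have hMM : (ENNReal.ofReal lam • volume).prod (μ.map fun ω => pointMeasure fun n => X n ω) = M₁ := by
    let S : Set (Set Plane) := {B | MeasurableSet B ∧ volume B < ∞}
    refine Measure.prod_eq_generateFrom (C := S)
      (D := piiUnionInter (fun B => {s | MeasurableSet[evalSigma B] s}) S) ?_ ?_ ?_ ?_ ?_ ?_ ?_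
    · apply le_antisymm
      · exact MeasurableSpace.generateFrom_le fun B hB => hB.1
      · intro s hs
        have : s = ⋃ k : ℕ, s ∩ Metric.ball 0 k := by
          rw [← Set.inter_iUnion, Metric.iUnion_ball_nat, Set.inter_univ]
        rw [this]
        refine @MeasurableSet.iUnion _ _ (_) _ _ fun k => MeasurableSpace.measurableSet_generateFrom ?_
        exact ⟨hs.inter measurableSet_ball,
          (measure_mono Set.inter_subset_right).trans_lt measure_ball_lt_top⟩
    · exact (generateFrom_piiUnionInter_measurableSet evalSigma S).trans iSup_evalSigma
    · intro a ha b hb _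
      exact ⟨ha.1.inter hb.1, (measure_mono Set.inter_subset_left).trans_lt ha.2⟩
    · exact isPiSystem_piiUnionInter _ (fun B => @MeasurableSpace.isPiSystem_measurableSet _ (_)) _
    · refine ⟨fun k => Metric.ball 0 k, fun k => ⟨measurableSet_ball, measure_ball_lt_top⟩,
        fun k => ?_, Metric.iUnion_ball_nat 0⟩
      rw [Measure.smul_apply, smul_eq_mul]
      exact ENNReal.mul_lt_top ENNReal.ofReal_lt_top measure_ball_lt_top
    -- The whole space is the cylinder over no evaluations.
    · refine ⟨fun _ => Set.univ, fun _ => ⟨∅, by simp, fun _ => Set.univ, by simp, by simp⟩,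
        fun _ => measure_lt_top _ _, by simp [Set.iUnion_const]⟩
    · rintro s ⟨hs, hsv⟩ G ⟨t, htS, f, hf, rfl⟩
      have hf' : ∀ B, ∃ V : Set ℝ≥0∞, B ∈ t → MeasurableSet V ∧ (fun ζ : Measure Plane => ζ B) ⁻¹' V = f B := by
        intro B
        by_cases hB : B ∈ t
        · obtain ⟨V, hV⟩ := hf B hB
          exact ⟨V, fun _ => hV⟩
        · exact ⟨∅, fun h => (hB h).elim⟩
      choose V hV using hf'
      have ht : ∀ B ∈ t, MeasurableSet B ∧ volume B < ∞ := fun B hB => htS hB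
      have hG : MeasurableSet (⋂ B ∈ t, f B) := by
        refine Finset.measurableSet_biInter _ fun B hB => ?_
        rw [← (hV B hB).2]
        exact Measure.measurable_coe (ht B hB).1 (hV B hB).1
      have hmem (ζ : Measure Plane) : ζ ∈ (⋂ B ∈ t, f B) ↔ ∀ B ∈ t, ζ B ∈ V B := by
        simp only [Set.mem_iInter]
        refine forall₂_congr fun B hB => ?_
        rw [← (hV B hB).2]; rfl
      have key := h.sum_measure_cylinder_erase hs hsv t ht V fun B hB => (hV B hB).1
      simp_rw [← hmem] at key
      rw [Measure.sum_apply _ (hs.prod hG), Measure.smul_apply, smul_eq_mul,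
        Measure.map_apply hξ hG]
      refine Eq.trans (tsum_congr fun n => ?_) key
      rw [Measure.map_apply (hpair n) (hs.prod hG)]
      rfl
  calc _ = ∫⁻ z, Function.uncurry F z ∂M₁ := by
        rw [lintegral_sum_measure]
        refine (lintegral_tsum fun n => (hF.comp (hpair n)).aemeasurable).trans ?_
        refine tsum_congr fun n => ?_
        rw [lintegral_map hF (hpair n)]
        rfl
    _ = _ := by
        rw [← hMM, lintegral_prod _ hF.aemeasurable, lintegral_smul_measure, smul_eq_mul]
        congr 1
        refine lintegral_congr fun x => ?_
        exact lintegral_map (f := F x) (hF.comp measurable_prodMk_left) hξ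

/-- Stationarity, from translation invariance of Lebesgue measure. It allows the network to be
recentred at a user. -/
lemma IsPPP.sub_const (h : IsPPP lam X μ) (o : Plane) : IsPPP lam (fun n ω => X n ω - o) μ where
  measurable n := (h.measurable n).sub_const o
  counts m A hA hv hd c := by
    have hvol a : volume ((fun x => x - o) ⁻¹' A a) = volume (A a) := by
      simp_rw [sub_eq_add_neg]
      exact measure_preimage_add_right volume (-o) (A a)
    have := h.counts m (fun a => (fun x => x - o) ⁻¹' A a)
      (fun a => (measurable_id.sub_const o) (hA a)) (fun a => by rw [hvol]; exact hv a)
      (fun a b hab => (hd hab).preimage _) c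
    simp_rw [hvol] at this
    exact this

end Mecke

/-! ### Measurability of integrals against random measures -/

section LocallyFinite

/-- A measure, or `0` if it is not finite on bounded sets. -/
def locFin (ζ : Measure Plane) : Measure Plane :=
  open Classical in if ∀ k : ℕ, ζ (Metric.ball 0 k) < ∞ then ζ else 0

lemma locFin_apply_ball (ζ : Measure Plane) (k : ℕ) : locFin ζ (Metric.ball 0 k) < ∞ := by
  unfold locFin
  split_ifs with h
  · exact h k
  · simp

lemma measurable_locFin : Measurable locFin := by
  unfold locFin
  refine Measurable.ite ?_ measurable_id measurable_const
  have : {ζ : Measure Plane | ∀ k : ℕ, ζ (Metric.ball 0 k) < ∞} =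
      ⋂ k : ℕ, {ζ | ζ (Metric.ball 0 k) < ∞} := by ext; simp
  rw [this]
  exact MeasurableSet.iInter fun k =>
    measurableSet_lt (Measure.measurable_coe measurableSet_ball) measurable_const

/-- `locFin` as a kernel. -/
def locFinKernel : Kernel (Measure Plane) Plane := ⟨locFin, measurable_locFin⟩

/-- Joint measurability of integrals against a varying measure needs an s-finite kernel. The rings
between consecutive balls have finite but not uniformly bounded mass, so each piece is first divided
by its mass, which gives a kernel of mass at most `1`, and the mass is then restored as a finite
density. -/
instance : IsSFiniteKernel locFinKernel := by
  let A : ℕ → Set Plane := disjointed fun k : ℕ => Metric.ball 0 k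
  have hA k : MeasurableSet (A k) := MeasurableSet.disjointed (fun _ => measurableSet_ball) k
  have hfin k ζ : locFin ζ (A k) < ∞ :=
    (measure_mono (disjointed_subset _ k)).trans_lt (locFin_apply_ball ζ k)
  have hr k : Measurable fun ζ => locFin ζ (A k) :=
    (Measure.measurable_coe (hA k)).comp measurable_locFin
  let κ' : ℕ → Kernel (Measure Plane) Plane := fun k =>
    ⟨fun ζ => (locFin ζ (A k))⁻¹ • (locFin ζ).restrict (A k), by
      refine Measure.measurable_of_measurable_coe _ fun s hs => ?_
      simp_rw [Measure.smul_apply, smul_eq_mul, Measure.restrict_apply hs]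
      exact (hr k).inv.mul ((Measure.measurable_coe (hs.inter (hA k))).comp measurable_locFin)⟩
  have hκ' k : IsFiniteKernel (κ' k) := by
    refine ⟨1, ENNReal.one_lt_top, fun ζ => ?_⟩
    change ((locFin ζ (A k))⁻¹ • (locFin ζ).restrict (A k)) Set.univ ≤ 1
    rw [Measure.smul_apply, smul_eq_mul, Measure.restrict_apply_univ]
    exact ENNReal.inv_mul_le_one _
  let f : ℕ → Measure Plane → Plane → ℝ≥0∞ := fun k ζ _ => locFin ζ (A k)
  have hs k : IsSFiniteKernel (Kernel.withDensity (κ' k) (f k)) :=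
    Kernel.IsSFiniteKernel.withDensity _ fun ζ _ => (hfin k ζ).ne
  have h1 k ζ : Kernel.withDensity (κ' k) (f k) ζ = (locFin ζ).restrict (A k) := by
    rw [Kernel.withDensity_apply (f := f k) _ ((hr k).comp measurable_fst)]
    change (((locFin ζ (A k))⁻¹ • (locFin ζ).restrict (A k))).withDensity (fun _ => locFin ζ (A k)) = _
    rw [withDensity_const, smul_smul]
    -- Normalisation fails only on a piece of mass zero, where both sides vanish.
    by_cases h0 : locFin ζ (A k) = 0
    · rw [Measure.restrict_eq_zero.2 h0, smul_zero]
    · rw [ENNReal.mul_inv_cancel h0 (hfin k ζ).ne, one_smul]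
  have h2 : locFinKernel = Kernel.sum fun k => Kernel.withDensity (κ' k) (f k) := by
    ext ζ s hs
    rw [Kernel.sum_apply]
    simp_rw [h1]
    rw [← Measure.restrict_iUnion (disjoint_disjointed _) hA, iUnion_disjointed, Metric.iUnion_ball_nat,
      Measure.restrict_univ]
    rfl
  rw [h2]
  infer_instance

lemma Measurable.lintegral_locFin {α : Type*} [MeasurableSpace α] {f : α → Plane → ℝ≥0∞}
    (hf : Measurable (Function.uncurry f)) {g : α → Measure Plane} (hg : Measurable g) :
    Measurable fun a => ∫⁻ y, f a y ∂(locFin (g a)) :=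
  Measurable.lintegral_kernel_prod_right (κ := locFinKernel.comap g hg) hf

variable {Ω : Type*} [MeasurableSpace Ω] {μ : Measure Ω} [IsProbabilityMeasure μ] {lam : ℝ}
  {X : ℕ → Ω → Plane}

/-- Almost every realisation, with or without one of its points, is locally finite, so the cutoff
does not affect expectations. -/
lemma IsPPP.ae_locFin (h : IsPPP lam X μ) : ∀ᵐ ω ∂μ,
    locFin (pointMeasure fun n => X n ω) = (pointMeasure fun n => X n ω) ∧
    ∀ n, locFin (eraseMeasure (fun m => X m ω) n) = eraseMeasure (fun m => X m ω) n := by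
  have : ∀ᵐ ω ∂μ, ∀ k : ℕ, pointMeasure (fun n => X n ω) (Metric.ball 0 k) < ∞ :=
    ae_all_iff.2 fun k => h.ae_lt_top measurableSet_ball measure_ball_lt_top
  filter_upwards [this] with ω hω
  exact ⟨if_pos hω, fun n => if_pos fun k => (pointMeasure_erase_le (fun n => X n ω) n _).trans_lt (hω k)⟩

/-- Campbell–Mecke formula for exponential functionals. -/
lemma IsPPP.lintegral_tsum_expNeg_erase (h : IsPPP lam X μ) {f : Plane → ℝ≥0∞} (hf : Measurable f)
    {a : Plane → Plane → ℝ≥0∞} (ha : Measurable (Function.uncurry a)) :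
    ∫⁻ ω, ∑' n, f (X n ω) * expNeg (∑' m : {m // m ≠ n}, a (X n ω) (X m ω)) ∂μ =
      ENNReal.ofReal lam * ∫⁻ x, f x *
        expNeg (∫⁻ y, ENNReal.ofReal lam * (1 - expNeg (a x y))) := by
  have hF : Measurable (Function.uncurry fun x (ζ : Measure Plane) =>
      f x * expNeg (∫⁻ y, a x y ∂(locFin ζ))) := by
    refine (hf.comp measurable_fst).mul (measurable_expNeg.comp ?_)
    exact Measurable.lintegral_locFin (α := Plane × Measure Plane) (f := fun p y => a p.1 y)
      (ha.comp ((measurable_fst.comp measurable_fst).prodMk measurable_snd)) measurable_snd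
  have key := h.lintegral_tsum_erase hF
  calc _ = ∫⁻ ω, ∑' n, f (X n ω) * expNeg
        (∫⁻ y, a (X n ω) y ∂(locFin (eraseMeasure (fun m => X m ω) n))) ∂μ := by
        refine lintegral_congr_ae ?_
        filter_upwards [h.ae_locFin] with ω hω
        refine tsum_congr fun n => ?_
        rw [hω.2 n, lintegral_pointMeasure]
    _ = _ := by
        rw [key]
        congr 1
        refine lintegral_congr fun x => ?_
        have hax : Measurable (a x) := ha.comp measurable_prodMk_left
        rw [← h.laplace hax, lintegral_const_mul]
        · congr 1
          refine lintegral_congr_ae ?_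
          filter_upwards [h.ae_locFin] with ω hω
          rw [hω.1, lintegral_pointMeasure]
        · refine measurable_expNeg.comp ?_
          exact (Measure.measurable_lintegral hax).comp (measurable_locFin.comp h.measurable_pointMeasure)

end LocallyFinite

/-! ### Coverage as a threshold for the serving fading -/

section Good

/-- A base station of mean power `m` is preferred to the serving one, of mean power `t`; ties
count if `σ = true`. -/
def Beats (σ : Bool) (t m : ℝ≥0∞) : Prop := if σ then t ≤ m else t < m

open Classical in
/-- Normalized interference of a base station of mean power `m` and fading `h`, infinite if
it is preferred to the serving one. -/
def penalty (σ : Bool) (τ t m : ℝ≥0∞) (h : ℝ) : ℝ≥0∞ :=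
  if Beats σ t m then ⊤ else τ * (ENNReal.ofReal h * m) / t

open Classical in
/-- Normalized noise. The strict variant excludes infinite received power. -/
def noise (σ : Bool) (τ N₀ t : ℝ≥0∞) : ℝ≥0∞ := if σ = true ∧ t = ⊤ then ⊤ else τ * N₀ / t

open Classical in
/-- Sum of the normalized interferences of the base stations other than `b`. -/
def interference (σ : Bool) (τ t : ℝ≥0∞) {L : Type*} (present : L → Prop) (mp : L → ℝ≥0∞)
    (fade : L → ℝ) (b : L) : ℝ≥0∞ :=
  ∑' b', if present b' ∧ b' ≠ b then penalty σ τ t (mp b') (fade b') else 0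

/-- `b` serves the user, with sufficient SINR. The two variants `σ` differ in the treatment of
ties. -/
def Good (σ : Bool) (τ N₀ : ℝ≥0∞) {L : Type*} (present : L → Prop) (mp : L → ℝ≥0∞)
    (fade : L → ℝ) (b : L) : Prop :=
  present b ∧ noise σ τ N₀ (mp b) + interference σ τ (mp b) present mp fade b < ENNReal.ofReal (fade b)

variable {L : Type*} {present : L → Prop} {mp : L → ℝ≥0∞} {fade : L → ℝ} {τ N₀ : ℝ≥0∞} {b : L}

lemma not_beats_of_interference_ne_top {σ : Bool} {t : ℝ≥0∞}
    (h : interference σ τ t present mp fade b ≠ ⊤) {b' : L} (hb' : present b') (hne : b' ≠ b) :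
    ¬ Beats σ t (mp b') := by
  intro hB
  have := ENNReal.ne_top_of_tsum_ne_top h b'
  simp [hb', hne, penalty, hB] at this

/-- Without a preferred competitor every term takes the second branch of `penalty`, and the common
factor `τ / t` comes out of the sum. -/
lemma interference_eq {σ : Bool} {t : ℝ≥0∞} (h : ∀ b', present b' → b' ≠ b → ¬ Beats σ t (mp b')) :
    interference σ τ t present mp fade b =
      τ * (∑' b' : {b' // present b' ∧ b' ≠ b}, ENNReal.ofReal (fade b') * mp b') / t := by
  classical
  have h1 := tsum_subtype {b' | present b' ∧ b' ≠ b} fun b' => ENNReal.ofReal (fade b') * mp b'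
  have h2 : (∑' b' : {b' // present b' ∧ b' ≠ b}, ENNReal.ofReal (fade b') * mp b') =
    ∑' b', Set.indicator {b' | present b' ∧ b' ≠ b} (fun b' => ENNReal.ofReal (fade b') * mp b') b' := h1
  rw [h2, div_eq_mul_inv, ← ENNReal.tsum_mul_left, ← ENNReal.tsum_mul_right]
  refine tsum_congr fun b' => ?_
  by_cases hb : present b' ∧ b' ≠ b
  · simp [hb, penalty, h b' hb.1 hb.2, div_eq_mul_inv]
  · simp [hb]

/-- Solves the SINR inequality for the fading of the serving link, which makes coverage a tail event
of an exponential variable. -/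
lemma lt_div_iff_noise {I h t : ℝ≥0∞} (hτ : τ ≠ 0) (hτ' : τ ≠ ⊤) (ht : t ≠ 0) (ht' : t ≠ ⊤) :
    τ < h * t / (N₀ + I) ↔ τ * N₀ / t + τ * I / t < h := by
  rw [ENNReal.lt_div_iff_mul_lt (.inr hτ') (.inr hτ), ← ENNReal.add_div,
    ← mul_add, ENNReal.div_lt_iff (.inl ht) (.inl ht')]

lemma Good.of_serving (hτ : τ ≠ 0) (hτ' : τ ≠ ⊤) (ht : mp b ≠ 0) (hp : present b)
    (hs : ∀ b', present b' → mp b' ≤ mp b)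
    (hc : τ < ENNReal.ofReal (fade b) * mp b /
      (N₀ + ∑' b' : {b' // present b' ∧ b' ≠ b}, ENNReal.ofReal (fade b') * mp b')) :
    Good false τ N₀ present mp fade b := by
  refine ⟨hp, ?_⟩
  have hB : ∀ b', present b' → b' ≠ b → ¬ Beats false (mp b) (mp b') := fun b' h1 _ => by
    simpa [Beats] using hs b' h1
  rw [interference_eq hB, noise, if_neg (by simp)]
  -- At infinite mean power, noise and interference are divided by `⊤` and vanish. Only positivity
  -- of the fading remains to be checked, and without it the SINR would be zero.
  by_cases ht' : mp b = ⊤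
  · simp only [ht', ENNReal.div_top, add_zero]
    by_contra hh
    simp only [not_lt, nonpos_iff_eq_zero] at hh
    simp [hh] at hc
  · exact (lt_div_iff_noise hτ hτ' ht ht').1 hc

lemma Good.interference_ne_top {σ : Bool} (h : Good σ τ N₀ present mp fade b) :
    interference σ τ (mp b) present mp fade b ≠ ⊤ := by
  intro ht
  have := h.2
  rw [ht, add_top] at this
  exact not_top_lt this

lemma Good.lt_of_strict (h : Good true τ N₀ present mp fade b) {b' : L} (hb' : present b')
    (hne : b' ≠ b) : mp b' < mp b := by
  simpa [Beats] using not_beats_of_interference_ne_top h.interference_ne_top hb' hne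

/-- The strict noise is infinite at infinite power, so the power is finite and the threshold
inequality can be turned back into one for the SINR. -/
lemma Good.lt_sinr (h : Good true τ N₀ present mp fade b) (hτ : τ ≠ 0) (hτ' : τ ≠ ⊤) (ht : mp b ≠ 0) :
    τ < ENNReal.ofReal (fade b) * mp b /
      (N₀ + ∑' b' : {b' // present b' ∧ b' ≠ b}, ENNReal.ofReal (fade b') * mp b') := by
  have h2 := h.2
  rw [interference_eq fun b' => not_beats_of_interference_ne_top h.interference_ne_top] at h2
  have ht' : mp b ≠ ⊤ := by
    intro ht'
    rw [noise, if_pos ⟨rfl, ht'⟩, top_add] at h2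
    exact not_top_lt h2
  rw [noise, if_neg (by simp [ht'])] at h2
  exact (lt_div_iff_noise hτ hτ' ht ht').2 h2

/-- Two candidates would each have strictly larger mean power than the other. The thresholds may
differ, so uniqueness holds across tiers. -/
lemma Good.unique {τ' : ℝ≥0∞} {b' : L} (h : Good true τ N₀ present mp fade b)
    (h' : Good true τ' N₀ present mp fade b') : b' = b := by
  by_contra hne
  exact lt_asymm (h.lt_of_strict h'.1 hne) (h'.lt_of_strict h.1 (Ne.symm hne))

/-- Labels outside the range of `e` carry no present station and hence no interference. Relabelling
lets one computation serve both the original and the modified network. -/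
lemma interference_comp {L' : Type*} {e : L' → L} (he : Function.Injective e)
    (hr : ∀ b, present b → b ∈ Set.range e) (σ : Bool) (t : ℝ≥0∞) (b : L') :
    interference σ τ t (present ∘ e) (mp ∘ e) (fade ∘ e) b = interference σ τ t present mp fade (e b) := by
  classical
  unfold interference
  rw [← he.tsum_eq]
  · simp [he.eq_iff]
  · intro b' hb'
    by_contra hc
    exact hb' (if_neg fun h => hc (hr b' h.1))

lemma good_comp_iff {L' : Type*} {e : L' → L} (he : Function.Injective e)
    (hr : ∀ b, present b → b ∈ Set.range e) (σ : Bool) (b : L') :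
    Good σ τ N₀ (present ∘ e) (mp ∘ e) (fade ∘ e) b ↔ Good σ τ N₀ present mp fade (e b) := by
  unfold Good
  rw [interference_comp he hr]
  rfl

end Good

/-! ### Counts that sandwich the coverage indicator -/

section Count

variable {K₁ K₂ : Type*}

/-- Mean power received from a base station of tier `k` at position `y` relative to the user. -/
def Params.meanPow (p : Params K₁ K₂) (k : K₁ ⊕ K₂) (y : Plane) : ℝ≥0∞ :=
  ENNReal.ofReal (p.P k) * ‖y‖ₑ ^ (-p.α)

lemma Params.meanPow_ne_zero (p : Params K₁ K₂) (k : K₁ ⊕ K₂) (y : Plane) : p.meanPow k y ≠ 0 := by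
  have h1 : ENNReal.ofReal (p.P k) ≠ 0 := by simpa using p.P_pos k
  have h2 : ‖y‖ₑ ^ (-p.α) ≠ 0 := by
    have := p.two_lt_α
    simp only [ne_eq, ENNReal.rpow_eq_zero_iff, not_or, not_and]
    exact ⟨fun _ => by linarith, fun h => (enorm_ne_top h).elim⟩
  exact mul_ne_zero h1 h2

@[fun_prop] lemma Params.measurable_meanPow (p : Params K₁ K₂) (k : K₁ ⊕ K₂) : Measurable (p.meanPow k) := by
  unfold Params.meanPow
  fun_prop

open Classical in
/-- Number of base stations of tier `i` that serve the user with sufficient SINR. -/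
def Params.goodCount (p : Params K₁ K₂) (σ : Bool) {L : Type*} (tier : L → K₁ ⊕ K₂) (present : L → Prop)
    (pos : L → Plane) (fade : L → ℝ) (i : K₁ ⊕ K₂) : ℝ≥0∞ :=
  ∑' b, if tier b = i ∧ Good σ (ENNReal.ofReal (p.τ i)) (ENNReal.ofReal p.N₀) present
    (fun b => p.meanPow (tier b) (pos b)) fade b then 1 else 0

lemma Params.goodCount_comp (p : Params K₁ K₂) (σ : Bool) {L L' : Type*} {tier : L → K₁ ⊕ K₂}
    {present : L → Prop} {pos : L → Plane} {fade : L → ℝ} (i : K₁ ⊕ K₂) {e : L' → L}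
    (he : Function.Injective e) (hr : ∀ b, present b → b ∈ Set.range e) :
    p.goodCount σ (tier ∘ e) (present ∘ e) (pos ∘ e) (fade ∘ e) i = p.goodCount σ tier present pos fade i := by
  classical
  unfold Params.goodCount
  rw [← he.tsum_eq]
  · refine tsum_congr fun b => ?_
    have := good_comp_iff (mp := fun b => p.meanPow (tier b) (pos b)) (fade := fade)
      (τ := ENNReal.ofReal (p.τ i)) (N₀ := ENNReal.ofReal p.N₀) he hr σ b
    rw [← this]
    rfl
  · intro b' hb'
    by_contra hc
    exact hb' (if_neg fun h => hc (hr b' h.2.1))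

/-- `goodCount` of a view. -/
def View.goodCount (p : Params K₁ K₂) (v : View K₁ K₂) (σ : Bool) (i : K₁ ⊕ K₂) : ℝ≥0∞ :=
  p.goodCount σ (BS.tier p) v.present (fun b => v.pos b - v.user) v.fade i

lemma View.one_le_goodCount (p : Params K₁ K₂) (v : View K₁ K₂) (i : K₁ ⊕ K₂) (h : v.Covered p i) :
    1 ≤ v.goodCount p false i := by
  classical
  obtain ⟨b, hb, hs, hc⟩ := h
  have hG : Good false (ENNReal.ofReal (p.τ i)) (ENNReal.ofReal p.N₀) v.present
      (fun b => p.meanPow (b.tier p) (v.pos b - v.user)) v.fade b :=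
    Good.of_serving (by simpa using p.τ_pos i) ENNReal.ofReal_ne_top
      (p.meanPow_ne_zero _ _) hs.1 hs.2 hc
  refine le_trans ?_ (ENNReal.le_tsum b)
  rw [if_pos ⟨hb, hG⟩]

lemma View.covered_of_good (p : Params K₁ K₂) (v : View K₁ K₂) {i : K₁ ⊕ K₂} {b : BS K₁ K₂}
    (hb : b.tier p = i) (h : Good true (ENNReal.ofReal (p.τ i)) (ENNReal.ofReal p.N₀) v.present
      (fun b => p.meanPow (b.tier p) (v.pos b - v.user)) v.fade b) : v.Covered p i := by
  refine ⟨b, hb, ⟨h.1, fun b' hb' => ?_⟩,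
    h.lt_sinr (by simpa using p.τ_pos i) ENNReal.ofReal_ne_top (p.meanPow_ne_zero _ _)⟩
  rcases eq_or_ne b' b with rfl | hne
  · exact le_rfl
  · exact (h.lt_of_strict hb' hne).le

/-- Uniqueness in the strict variant leaves at most one counted station over all tiers together;
this is where the tier events become disjoint. -/
lemma View.sum_goodCount_le (p : Params K₁ K₂) (v : View K₁ K₂) (s : Finset (K₁ ⊕ K₂)) :
    ∑ i ∈ s, v.goodCount p true i ≤ 1 := by
  classical
  let G : BS K₁ K₂ → Prop := fun b => Good true (ENNReal.ofReal (p.τ (b.tier p))) (ENNReal.ofReal p.N₀)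
    v.present (fun b => p.meanPow (b.tier p) (v.pos b - v.user)) v.fade b
  have h1 : ∑ i ∈ s, v.goodCount p true i ≤ ∑' b, if G b then 1 else 0 := by
    unfold View.goodCount Params.goodCount
    rw [← Summable.tsum_finsetSum fun _ _ => ENNReal.summable]
    refine ENNReal.tsum_le_tsum fun b => ?_
    calc _ ≤ ∑ i ∈ s, if b.tier p = i then (if G b then 1 else 0 : ℝ≥0∞) else 0 := by
          refine Finset.sum_le_sum fun i _ => ?_
          by_cases hb : b.tier p = i
          · subst hb
            simp [G]
          · simp [hb]
      _ ≤ _ := by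
          rw [Finset.sum_ite_eq s]
          split_ifs <;> simp
  refine h1.trans ?_
  by_cases hG : ∃ b, G b
  · obtain ⟨b, hb⟩ := hG
    rw [tsum_eq_single b]
    · split_ifs; simp
    · intro b' hb'
      exact if_neg fun h => hb' (Good.unique hb h)
  · push Not at hG
    simp [hG]

lemma View.goodCount_eq_zero (p : Params K₁ K₂) (v : View K₁ K₂) {i : K₁ ⊕ K₂} (h : ¬ v.Covered p i) :
    v.goodCount p true i = 0 := by
  classical
  unfold View.goodCount Params.goodCount
  rw [ENNReal.tsum_eq_zero]
  exact fun b => if_neg fun hb => h (v.covered_of_good p hb.1 hb.2)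

-- Lower half of a sandwich whose upper half is `View.le_goodCount_false`. Once the two counts have
-- equal means, ties need no further care.
open Classical in
lemma View.goodCount_true_le (p : Params K₁ K₂) (v : View K₁ K₂) (i : K₁ ⊕ K₂) :
    v.goodCount p true i ≤ if v.Covered p i then 1 else 0 := by
  split_ifs with h
  · simpa using v.sum_goodCount_le p {i}
  · rw [v.goodCount_eq_zero p h]

open Classical in
lemma View.le_goodCount_false (p : Params K₁ K₂) (v : View K₁ K₂) (i : K₁ ⊕ K₂) :
    (if v.Covered p i then 1 else 0) ≤ v.goodCount p false i := by
  split_ifs with h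
  · exact v.one_le_goodCount p i h
  · exact zero_le

open Classical in
lemma View.sum_goodCount_true_le [Fintype K₁] [Fintype K₂] (p : Params K₁ K₂) (v : View K₁ K₂) :
    ∑ i, v.goodCount p true i ≤ if ∃ i, v.Covered p i then 1 else 0 := by
  split_ifs with h
  · exact v.sum_goodCount_le p _
  · push Not at h
    simp [v.goodCount_eq_zero p (h _)]

open Classical in
lemma View.le_sum_goodCount_false [Fintype K₁] [Fintype K₂] (p : Params K₁ K₂) (v : View K₁ K₂) :
    (if ∃ i, v.Covered p i then 1 else 0) ≤ ∑ i, v.goodCount p false i := by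
  split_ifs with h
  · obtain ⟨i, hi⟩ := h
    exact (v.one_le_goodCount p i hi).trans
      (Finset.single_le_sum (f := fun i => v.goodCount p false i) (fun _ _ => zero_le) (Finset.mem_univ i))
  · exact zero_le

end Count

lemma ENNReal_tsum_sumType {α β : Type*} (f : α ⊕ β → ℝ≥0∞) :
    ∑' b, f b = ∑' a, f (.inl a) + ∑' b, f (.inr b) :=
  (HasSum.sum (ENNReal.summable.hasSum) (ENNReal.summable.hasSum)).tsum_eq

/-! ### Averages over exponential fading -/

section Fading

/-- Laplace transform of the exponential distribution. -/
lemma lintegral_expNeg_mul_expMeasure (c : ℝ≥0∞) :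
    ∫⁻ x, expNeg (c * ENNReal.ofReal x) ∂(expMeasure 1) = (1 + c)⁻¹ := by
  have hmeas := (measurable_exponentialPDFReal 1).ennreal_ofReal
  change ∫⁻ x, expNeg (c * ENNReal.ofReal x) ∂(volume.withDensity fun x => ENNReal.ofReal (exponentialPDFReal 1 x)) = _
  rw [lintegral_withDensity_eq_lintegral_mul _ hmeas (by fun_prop)]
  rcases eq_or_ne c ⊤ with rfl | hc
  · rw [show (1 + ⊤ : ℝ≥0∞)⁻¹ = 0 by simp, lintegral_eq_zero_iff' (by fun_prop)]
    have h0 : ∀ᵐ x : ℝ, x ≠ 0 := by simp [ae_iff]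
    filter_upwards [h0] with x hx
    rcases lt_or_gt_of_ne hx with hx | hx
    · have := exponentialPDF_of_neg (r := 1) hx
      rw [exponentialPDF] at this
      simp [this]
    · have : ⊤ * ENNReal.ofReal x = ⊤ := ENNReal.top_mul (by simpa using hx)
      simp [this]
  obtain ⟨c, rfl⟩ : ∃ d : NNReal, (d : ℝ≥0∞) = c := ⟨c.toNNReal, ENNReal.coe_toNNReal hc⟩
  have hr : (0 : ℝ) < 1 + c := by positivity
  -- Tilting the density by `exp (-c x)` gives the exponential density of rate `1 + c`, up to its
  -- normalising constant.
  have h1 (x : ℝ) : ENNReal.ofReal (exponentialPDFReal 1 x) * expNeg (c * ENNReal.ofReal x) =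
      (1 + c : ℝ≥0∞)⁻¹ * exponentialPDF (1 + c) x := by
    rcases lt_or_ge x 0 with hx | hx
    · have := exponentialPDF_of_neg (r := 1) hx
      rw [exponentialPDF] at this
      simp [this, exponentialPDF_of_neg hx]
    · have := exponentialPDF_of_nonneg (r := 1) hx
      rw [exponentialPDF] at this
      rw [this, exponentialPDF_of_nonneg hx, ← ENNReal.ofReal_coe_nnreal, ← ENNReal.ofReal_one,
        ← ENNReal.ofReal_add zero_le_one (by positivity),
        ← ENNReal.ofReal_inv_of_pos hr, ← ENNReal.ofReal_mul (by positivity),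
        expNeg_ofReal (by positivity), ← ENNReal.ofReal_mul (by positivity),
        ← ENNReal.ofReal_mul (by positivity)]
      congr 1
      rw [one_mul, ← Real.exp_add, ← mul_assoc, inv_mul_cancel₀ hr.ne', one_mul]
      rw [one_mul]
      congr 1
      ring
  simp_rw [Pi.mul_apply, h1]
  rw [lintegral_const_mul _ (by
    unfold exponentialPDF
    exact (measurable_exponentialPDFReal _).ennreal_ofReal), lintegral_exponentialPDF_eq_one hr, mul_one]

open Classical in
/-- Expectation of `expNeg (penalty σ τ t m h)` for exponential fading `h`. -/
def fadeFactor (σ : Bool) (τ t m : ℝ≥0∞) : ℝ≥0∞ := if Beats σ t m then 0 else (1 + τ * m / t)⁻¹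

lemma fadeFactor_le_one (σ : Bool) (τ t m : ℝ≥0∞) : fadeFactor σ τ t m ≤ 1 := by
  unfold fadeFactor
  split_ifs
  · exact zero_le
  · exact ENNReal.inv_le_one.2 le_self_add

lemma lintegral_expNeg_penalty (σ : Bool) (τ t m : ℝ≥0∞) :
    ∫⁻ h, expNeg (penalty σ τ t m h) ∂(expMeasure 1) = fadeFactor σ τ t m := by
  unfold penalty fadeFactor
  split_ifs
  · simp
  · rw [← lintegral_expNeg_mul_expMeasure]
    refine lintegral_congr fun h => ?_
    congr 1
    simp only [div_eq_mul_inv]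
    ring

lemma measurableSet_beats {α : Type*} [MeasurableSpace α] (σ : Bool) {t m : α → ℝ≥0∞}
    (ht : Measurable t) (hm : Measurable m) : MeasurableSet {a | Beats σ (t a) (m a)} := by
  cases σ
  · simpa [Beats] using measurableSet_lt ht hm
  · simpa [Beats] using measurableSet_le ht hm

@[fun_prop]
lemma measurable_penalty {α : Type*} [MeasurableSpace α] (σ : Bool) (τ : ℝ≥0∞) {t m : α → ℝ≥0∞}
    {h : α → ℝ} (ht : Measurable t) (hm : Measurable m) (hh : Measurable h) :
    Measurable fun a => penalty σ τ (t a) (m a) (h a) :=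
  Measurable.ite (measurableSet_beats σ ht hm) measurable_const (by fun_prop)

@[fun_prop]
lemma measurable_fadeFactor {α : Type*} [MeasurableSpace α] (σ : Bool) (τ : ℝ≥0∞) {t m : α → ℝ≥0∞}
    (ht : Measurable t) (hm : Measurable m) :
    Measurable fun a => fadeFactor σ τ (t a) (m a) :=
  Measurable.ite (measurableSet_beats σ ht hm) measurable_const (by fun_prop)

@[fun_prop]
lemma measurable_noise {α : Type*} [MeasurableSpace α] (σ : Bool) (τ N₀ : ℝ≥0∞) {t : α → ℝ≥0∞}
    (ht : Measurable t) : Measurable fun a => noise σ τ N₀ (t a) := by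
  unfold noise
  refine Measurable.ite ?_ measurable_const (by fun_prop)
  exact (MeasurableSet.const _).inter (ht (measurableSet_singleton ⊤))

/-- The fading on the serving link exceeds an independent level. -/
lemma lintegral_lt_fade {Ω : Type*} [MeasurableSpace Ω] {μ : Measure Ω} [IsProbabilityMeasure μ]
    {h : Ω → ℝ} (hh : Measurable h) (hl : HasLaw h (expMeasure 1) μ) {α : Type*} [MeasurableSpace α]
    {Y : Ω → α} (hY : Measurable Y) (hi : IndepFun Y h μ) {e A : α → ℝ≥0∞} (he : Measurable e)
    (hA : Measurable A) :
    ∫⁻ ω, e (Y ω) * Set.indicator {ω | A (Y ω) < ENNReal.ofReal (h ω)} 1 ω ∂μ =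
      ∫⁻ ω, e (Y ω) * expNeg (A (Y ω)) ∂μ := by
  have hS : MeasurableSet {z : α × ℝ | A z.1 < ENNReal.ofReal z.2} :=
    measurableSet_lt (hA.comp measurable_fst) (ENNReal.measurable_ofReal.comp measurable_snd)
  have := lintegral_of_indepFun hY hh hi (F := fun a x => e a *
    Set.indicator {z : α × ℝ | A z.1 < ENNReal.ofReal z.2} 1 (a, x))
    ((he.comp measurable_fst).mul ((measurable_one.indicator hS).comp (by fun_prop)))
  refine Eq.trans this (lintegral_congr fun ω => ?_)
  have hS' : MeasurableSet {x : ℝ | A (Y ω) < ENNReal.ofReal x} :=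
    measurableSet_lt measurable_const ENNReal.measurable_ofReal
  have h1 : ∀ x, Set.indicator {z : α × ℝ | A z.1 < ENNReal.ofReal z.2} (1 : α × ℝ → ℝ≥0∞) (Y ω, x) =
    Set.indicator {x : ℝ | A (Y ω) < ENNReal.ofReal x} 1 x := fun x => rfl
  simp_rw [h1]
  refine (lintegral_const_mul _ ((measurable_one.indicator hS').comp hh)).trans ?_
  simp only [Function.comp_def]
  rw [hl.lintegral_comp (f := Set.indicator {x : ℝ | A (Y ω) < ENNReal.ofReal x} 1)
      (measurable_one.indicator hS').aemeasurable, lintegral_indicator_one hS', expMeasure_lt]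

end Fading

/-! ### Networks with prescribed centres and marks -/

section Net

variable {K₁ K₂ I J : Type*}

/-- Tiers of the base stations of a network whose clusters are labelled by `I` and whose
Poisson points are labelled by `J`. -/
def netTier (kind : I → K₁) (kindP : J → K₂) : (I × ℕ) ⊕ J → K₁ ⊕ K₂ :=
  Sum.elim (fun b => .inl (kind b.1)) (fun j => .inr (kindP j))

/-- The existing base stations, for given cluster sizes. -/
def netPresent (n : I → ℕ) : (I × ℕ) ⊕ J → Prop := Sum.elim (fun b => b.2 < n b.1) (fun _ => True)

/-- Positions of the base stations, for given cluster centres, points and displacements. -/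
def netPos (x : I → Plane) (y : J → Plane) (S : I → ℕ → Plane) : (I × ℕ) ⊕ J → Plane :=
  Sum.elim (fun b => x b.1 + S b.1 b.2) y

variable (p : Params K₁ K₂) (kind : I → K₁) (kindP : J → K₂)

lemma measurableSet_netPresent {α : Type*} [MeasurableSpace α] {n : α → I → ℕ}
    (hn : Measurable n) (b : (I × ℕ) ⊕ J) : MeasurableSet {a | netPresent (n a) b} := by
  rcases b with ⟨c, l⟩ | j
  · exact measurableSet_lt measurable_const ((measurable_pi_apply c).comp hn)
  · exact MeasurableSet.univ

lemma measurable_netPos {α : Type*} [MeasurableSpace α] {x : α → I → Plane}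
    {y : α → J → Plane} {S : α → I → ℕ → Plane} (hx : Measurable x) (hy : Measurable y)
    (hS : Measurable S) (b : (I × ℕ) ⊕ J) : Measurable fun a => netPos (x a) (y a) (S a) b := by
  rcases b with ⟨c, l⟩ | j
  · change Measurable fun a => x a c + S a c l
    fun_prop
  · exact (measurable_pi_apply j).comp hy

variable [Countable I] [Countable J]

lemma measurable_interference {α : Type*} [MeasurableSpace α] (σ : Bool) (τ : ℝ≥0∞) {t : α → ℝ≥0∞}
    {n : α → I → ℕ} {x : α → I → Plane} {y : α → J → Plane} {S : α → I → ℕ → Plane}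
    {H : α → (I × ℕ) ⊕ J → ℝ}
    (ht : Measurable t) (hn : Measurable n) (hx : Measurable x) (hy : Measurable y)
    (hS : Measurable S) (hH : Measurable H) (b : (I × ℕ) ⊕ J) :
    Measurable fun a => interference σ τ (t a) (netPresent (n a))
      (fun b => p.meanPow (netTier kind kindP b) (netPos (x a) (y a) (S a) b)) (H a) b := by
  unfold interference
  refine Measurable.tsum fun b' => ?_
  refine Measurable.ite ((measurableSet_netPresent hn b').inter (MeasurableSet.const _)) ?_ measurable_const
  exact measurable_penalty σ τ ht ((p.measurable_meanPow _).comp (measurable_netPos hx hy hS b'))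
    ((measurable_pi_apply b').comp hH)

lemma measurable_goodCount {α : Type*} [MeasurableSpace α] (σ : Bool)
    {n : α → I → ℕ} {x : α → I → Plane} {y : α → J → Plane} {S : α → I → ℕ → Plane}
    {H : α → (I × ℕ) ⊕ J → ℝ}
    (hn : Measurable n) (hx : Measurable x) (hy : Measurable y)
    (hS : Measurable S) (hH : Measurable H) (i : K₁ ⊕ K₂) :
    Measurable fun a => p.goodCount σ (netTier kind kindP) (netPresent (n a))
      (netPos (x a) (y a) (S a)) (H a) i := by
  unfold Params.goodCount
  refine Measurable.tsum fun b => ?_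
  refine Measurable.ite ((MeasurableSet.const _).inter ?_) measurable_const measurable_const
  have ht : Measurable fun a => p.meanPow (netTier kind kindP b) (netPos (x a) (y a) (S a) b) :=
    (p.measurable_meanPow _).comp (measurable_netPos hx hy hS b)
  have h1 := (measurable_noise σ (ENNReal.ofReal (p.τ i)) (ENNReal.ofReal p.N₀) ht).add
    (measurable_interference p kind kindP σ (ENNReal.ofReal (p.τ i)) ht hn hx hy hS hH b)
  have h2 := measurableSet_lt h1 (ENNReal.measurable_ofReal.comp ((measurable_pi_apply b).comp hH))
  exact (measurableSet_netPresent hn b).inter h2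

end Net

/-! ### Mean factors and Laplace exponents of clusters and points -/

section Potential

variable {K₁ K₂ : Type*} (p : Params K₁ K₂)

lemma isProbabilityMeasure_densityLaw {g : Plane → ℝ} (hg : IsDensity g) :
    IsProbabilityMeasure (densityLaw g) :=
  ⟨by rw [densityLaw, withDensity_apply _ MeasurableSet.univ, Measure.restrict_univ, hg.lintegral_eq_one]⟩

instance (k : K₁) : IsProbabilityMeasure (densityLaw (p.g k)) := isProbabilityMeasure_densityLaw (p.g_density k)

instance : IsProbabilityMeasure (densityLaw p.gU) := isProbabilityMeasure_densityLaw p.gU_density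

/-- Factor of a base station of tier `k` at `y`, when the user is served by tier `i` with mean
power `t`. -/
def Params.factor (σ : Bool) (i : K₁ ⊕ K₂) (t : ℝ≥0∞) (k : K₁ ⊕ K₂) (y : Plane) : ℝ≥0∞ :=
  fadeFactor σ (ENNReal.ofReal (p.τ i)) t (p.meanPow k y)

/-- Mean factor of a point of a cluster with centre `x`. -/
def Params.meanFactor (σ : Bool) (i : K₁ ⊕ K₂) (t : ℝ≥0∞) (k : K₁) (x : Plane) : ℝ≥0∞ :=
  ∫⁻ s, p.factor σ i t (.inl k) (x + s) ∂(densityLaw (p.g k))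

/-- Potential of a cluster with centre `x`, or of a Poisson point at `x`. -/
def Params.potential (σ : Bool) (i : K₁ ⊕ K₂) (t : ℝ≥0∞) : K₁ ⊕ K₂ → Plane → ℝ≥0∞
  | .inl k, x => ENNReal.ofReal (p.mbar k) * (1 - p.meanFactor σ i t k x)
  | .inr k, x => negLog (p.factor σ i t (.inr k) x)

lemma Params.factor_le_one (σ : Bool) (i : K₁ ⊕ K₂) (t : ℝ≥0∞) (k : K₁ ⊕ K₂) (y : Plane) :
    p.factor σ i t k y ≤ 1 := fadeFactor_le_one _ _ _ _

lemma Params.meanFactor_le_one (σ : Bool) (i : K₁ ⊕ K₂) (t : ℝ≥0∞) (k : K₁) (x : Plane) :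
    p.meanFactor σ i t k x ≤ 1 := by
  calc _ ≤ ∫⁻ _, 1 ∂(densityLaw (p.g k)) := lintegral_mono fun s => p.factor_le_one _ _ _ _ _
    _ = 1 := by simp

@[fun_prop]
lemma Params.measurable_factor {α : Type*} [MeasurableSpace α] (σ : Bool) (i : K₁ ⊕ K₂) {t : α → ℝ≥0∞}
    (k : K₁ ⊕ K₂) {y : α → Plane} (ht : Measurable t) (hy : Measurable y) :
    Measurable fun a => p.factor σ i (t a) k (y a) :=
  measurable_fadeFactor σ _ ht ((p.measurable_meanPow k).comp hy)

@[fun_prop]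
lemma Params.measurable_meanFactor {α : Type*} [MeasurableSpace α] (σ : Bool) (i : K₁ ⊕ K₂) {t : α → ℝ≥0∞}
    (k : K₁) {x : α → Plane} (ht : Measurable t) (hx : Measurable x) :
    Measurable fun a => p.meanFactor σ i (t a) k (x a) := by
  unfold Params.meanFactor
  refine Measurable.lintegral_prod_right (f := fun a s => p.factor σ i (t a) (.inl k) (x a + s)) ?_
  exact p.measurable_factor σ i _ (ht.comp measurable_fst) ((hx.comp measurable_fst).add measurable_snd)

@[fun_prop]
lemma Params.measurable_potential {α : Type*} [MeasurableSpace α] (σ : Bool) (i : K₁ ⊕ K₂) {t : α → ℝ≥0∞}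
    (k : K₁ ⊕ K₂) {x : α → Plane} (ht : Measurable t) (hx : Measurable x) :
    Measurable fun a => p.potential σ i (t a) k (x a) := by
  cases k
  · exact (measurable_const.sub (p.measurable_meanFactor σ i _ ht hx)).const_mul _
  · exact measurable_negLog.comp (p.measurable_factor σ i _ ht hx)

end Potential

/-! ### Laplace and Mecke formulas for one Poisson cluster -/

section Marks

variable {Ω K₁ K₂ I J : Type*}

/-- The σ-algebras generated by the cluster sizes, displacements and fading variables. -/
@[reducible] def markSigma (N : I → Ω → ℕ) (s : I → ℕ → Ω → Plane) (h : (I × ℕ) ⊕ J → Ω → ℝ) :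
    I ⊕ (I × ℕ) ⊕ ((I × ℕ) ⊕ J) → MeasurableSpace Ω
  | .inl c => MeasurableSpace.comap (N c) inferInstance
  | .inr (.inl b) => MeasurableSpace.comap (s b.1 b.2) inferInstance
  | .inr (.inr b) => MeasurableSpace.comap (h b) inferInstance

/-- Independent cluster sizes, displacements and fading variables. -/
structure IsMarks [MeasurableSpace Ω] (p : Params K₁ K₂) (kind : I → K₁) (N : I → Ω → ℕ) (s : I → ℕ → Ω → Plane)
    (h : (I × ℕ) ⊕ J → Ω → ℝ) (μ : Measure Ω) : Prop where
  size_measurable : ∀ c, Measurable (N c)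
  size_law : ∀ c, HasLaw (N c) (poissonMeasure (p.mbar (kind c)).toNNReal) μ
  disp_measurable : ∀ c l, Measurable (s c l)
  disp_law : ∀ c l, HasLaw (s c l) (densityLaw (p.g (kind c))) μ
  fade_measurable : ∀ b, Measurable (h b)
  fade_law : ∀ b, HasLaw (h b) (expMeasure 1) μ
  indep : iIndep (markSigma N s h) μ

variable {p : Params K₁ K₂} {kind : I → K₁} {N : I → Ω → ℕ} {s : I → ℕ → Ω → Plane}
  {h : (I × ℕ) ⊕ J → Ω → ℝ}

lemma measurable_size_of_mem {T : Set (I ⊕ (I × ℕ) ⊕ ((I × ℕ) ⊕ J))} {c : I} (hc : .inl c ∈ T) :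
    Measurable[⨆ a ∈ T, markSigma N s h a] (N c) :=
  (comap_measurable (N c)).mono (le_iSup₂_of_le (.inl c) hc le_rfl) le_rfl

lemma measurable_disp_of_mem {T : Set (I ⊕ (I × ℕ) ⊕ ((I × ℕ) ⊕ J))} {c : I} {l : ℕ}
    (hc : .inr (.inl (c, l)) ∈ T) :
    Measurable[⨆ a ∈ T, markSigma N s h a] (s c l) :=
  (comap_measurable (s c l)).mono (le_iSup₂_of_le (.inr (.inl (c, l))) hc le_rfl) le_rfl

lemma measurable_fade_of_mem {T : Set (I ⊕ (I × ℕ) ⊕ ((I × ℕ) ⊕ J))} {b : (I × ℕ) ⊕ J}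
    (hb : .inr (.inr b) ∈ T) :
    Measurable[⨆ a ∈ T, markSigma N s h a] (h b) :=
  (comap_measurable (h b)).mono (le_iSup₂_of_le (.inr (.inr b)) hb le_rfl) le_rfl

variable [mΩ : MeasurableSpace Ω] {μ : Measure Ω}

lemma IsMarks.le (H : IsMarks p kind N s h μ) (a) : markSigma N s h a ≤ mΩ := by
  rcases a with c | b | b
  exacts [(H.size_measurable c).comap_le, (H.disp_measurable _ _).comap_le, (H.fade_measurable b).comap_le]

lemma IsMarks.indepFun (H : IsMarks p kind N s h μ) {α β : Type*} [MeasurableSpace α] [MeasurableSpace β]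
    {T T' : Set (I ⊕ (I × ℕ) ⊕ ((I × ℕ) ⊕ J))} (hT : Disjoint T T') {X : Ω → α} {Y : Ω → β}
    (hX : Measurable[⨆ a ∈ T, markSigma N s h a] X) (hY : Measurable[⨆ a ∈ T', markSigma N s h a] Y) :
    IndepFun X Y μ :=
  indep_of_indep_of_le_left (indep_of_indep_of_le_right (indep_iSup_of_disjoint H.le H.indep hT)
    hY.comap_le) hX.comap_le

variable [IsProbabilityMeasure μ]

/-- Expected factor of a single clustered base station. -/
lemma IsMarks.lintegral_expNeg_penalty_disp (H : IsMarks p kind N s h μ) (σ : Bool) (i : K₁ ⊕ K₂) (t : ℝ≥0∞)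
    (x : Plane) (c : I) (l : ℕ) :
    ∫⁻ ω, expNeg (penalty σ (ENNReal.ofReal (p.τ i)) t (p.meanPow (.inl (kind c)) (x + s c l ω))
      (h (.inl (c, l)) ω)) ∂μ = p.meanFactor σ i t (kind c) x := by
  have hi : IndepFun (s c l) (h (.inl (c, l))) μ :=
    H.indepFun (T := {.inr (.inl (c, l))}) (T' := {.inr (.inr (.inl (c, l)))}) (by simp)
      (measurable_disp_of_mem rfl) (measurable_fade_of_mem rfl)
  rw [lintegral_of_indepFun_hasLaw (H.disp_measurable c l) (H.disp_law c l)
    (H.fade_measurable _) hi (F := fun y h => expNeg (penalty σ (ENNReal.ofReal (p.τ i)) t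
      (p.meanPow (.inl (kind c)) (x + y)) h)) (by
        refine measurable_expNeg.comp (measurable_penalty _ _ measurable_const ?_ measurable_snd)
        exact (p.measurable_meanPow _).comp (by fun_prop))]
  refine lintegral_congr fun y => ?_
  rw [(H.fade_law _).lintegral_comp (f := fun h => expNeg (penalty σ (ENNReal.ofReal (p.τ i)) t
      (p.meanPow (.inl (kind c)) (x + y)) h)) (by
        refine (measurable_expNeg.comp (measurable_penalty _ _ ?_ ?_ measurable_id)).aemeasurable <;> fun_prop),
    lintegral_expNeg_penalty]
  rfl

/-- Penalty of the points of a cluster with centre `x`, except for those in `E`. -/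
def Params.clusterPenalty (p : Params K₁ K₂) (σ : Bool) (i : K₁ ⊕ K₂) (t : ℝ≥0∞) (k : K₁) (x : Plane)
    (E : Set ℕ) (n : ℕ) (S : ℕ → Plane) (H : ℕ → ℝ) : ℝ≥0∞ :=
  open Classical in ∑' l, if l < n ∧ l ∉ E then
    penalty σ (ENNReal.ofReal (p.τ i)) t (p.meanPow (.inl k) (x + S l)) (H l) else 0

lemma Params.measurable_clusterPenalty (p : Params K₁ K₂) {α : Type*} [MeasurableSpace α] (σ : Bool)
    (i : K₁ ⊕ K₂) (t : ℝ≥0∞) (k : K₁) (x : Plane) (E : Set ℕ) {n : α → ℕ} {S : α → ℕ → Plane}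
    {H : α → ℕ → ℝ} (hn : Measurable n) (hS : Measurable S) (hH : Measurable H) :
    Measurable fun a => p.clusterPenalty σ i t k x E (n a) (S a) (H a) := by
  refine Measurable.tsum fun l => Measurable.ite ?_ ?_ measurable_const
  · exact (measurableSet_lt measurable_const hn).inter (MeasurableSet.const _)
  · refine measurable_penalty _ _ measurable_const ((p.measurable_meanPow _).comp ?_)
      ((measurable_pi_apply l).comp hH)
    exact measurable_const.add ((measurable_pi_apply l).comp hS)

-- For a given size the points contribute independently, each with the same mean factor, while the
-- excluded points contribute `1`.
open Classical in
lemma IsMarks.lintegral_expNeg_clusterPenalty_size (H : IsMarks p kind N s h μ) (σ : Bool) (i : K₁ ⊕ K₂)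
    (t : ℝ≥0∞) (x : Plane) (c : I) (E : Set ℕ) (n : ℕ) :
    ∫⁻ ω, expNeg (p.clusterPenalty σ i t (kind c) x E n (fun l => s c l ω) (fun l => h (.inl (c, l)) ω)) ∂μ =
      p.meanFactor σ i t (kind c) x ^ ((Finset.range n).filter (· ∉ E)).card := by
  have h1 := lintegral_expNeg_tsum (ι := ℕ) H.le H.indep (μ := μ)
    (T := fun l => {.inr (.inl (c, l)), .inr (.inr (.inl (c, l)))})
    (f := fun l ω => if l < n ∧ l ∉ E then penalty σ (ENNReal.ofReal (p.τ i)) t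
      (p.meanPow (.inl (kind c)) (x + s c l ω)) (h (.inl (c, l)) ω) else 0)
    -- The product formula takes exponents rather than factors, hence the detour through `negLog`.
    (l := fun l => if l < n ∧ l ∉ E then negLog (p.meanFactor σ i t (kind c) x) else 0)
    (fun a b hab => by simp [hab.symm])
    (fun l => by
      split_ifs
      · refine @measurable_penalty Ω (_) σ _ _ _ _ ?_ ?_ ?_
        · exact measurable_const
        · exact (p.measurable_meanPow _).comp ((measurable_disp_of_mem (by simp)).const_add x)
        · exact measurable_fade_of_mem (by simp)
      · exact measurable_const)
    (fun l => by
      split_ifs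
      · rw [H.lintegral_expNeg_penalty_disp, expNeg_negLog (p.meanFactor_le_one _ _ _ _ _)]
      · simp)
  refine h1.trans ?_
  rw [tsum_eq_sum (s := Finset.range n) (fun l hl => if_neg fun h => hl (Finset.mem_range.2 h.1)),
    expNeg_sum, ← Finset.prod_const, Finset.prod_filter]
  refine Finset.prod_congr rfl fun l hl => ?_
  simp only [Finset.mem_range.1 hl, true_and]
  by_cases hE : l ∈ E
  · simp [hE]
  · simp [hE, expNeg_negLog (p.meanFactor_le_one _ _ _ _ _)]

/-- Conditions on the size of the cluster, which is independent of its displacements and fading.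
Measurability for each single `n` suffices because `ℕ` is countable. -/
lemma IsMarks.lintegral_size (H : IsMarks p kind N s h μ) (c : I) {F : ℕ → (ℕ → Plane) → (ℕ → ℝ) → ℝ≥0∞}
    (hF : ∀ n, Measurable fun z : (ℕ → Plane) × (ℕ → ℝ) => F n z.1 z.2) :
    ∫⁻ ω, F (N c ω) (fun l => s c l ω) (fun l => h (.inl (c, l)) ω) ∂μ =
      ∫⁻ n, ∫⁻ ω, F n (fun l => s c l ω) (fun l => h (.inl (c, l)) ω) ∂μ
        ∂(poissonMeasure (p.mbar (kind c)).toNNReal) := by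
  have hY : Measurable fun ω => ((fun l => s c l ω), fun l => h (.inl (c, l)) ω) :=
    (measurable_pi_lambda _ fun l => H.disp_measurable c l).prodMk
      (measurable_pi_lambda _ fun l => H.fade_measurable _)
  refine lintegral_of_indepFun_hasLaw (H.size_measurable c) (H.size_law c)
    (Y := fun ω => ((fun l => s c l ω), fun l => h (.inl (c, l)) ω)) hY ?_
    (F := fun n z => F n z.1 z.2) (measurable_from_prod_countable_right hF)
  refine H.indepFun (T := {.inl c}) (T' := {.inl c}ᶜ) disjoint_compl_right (measurable_size_of_mem rfl) ?_
  refine Measurable.prodMk ?_ ?_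
  · exact @measurable_pi_lambda _ _ _ (_) _ _ fun l => measurable_disp_of_mem (by simp)
  · exact @measurable_pi_lambda _ _ _ (_) _ _ fun l => measurable_fade_of_mem (by simp)

/-- Laplace functional of a Poisson cluster. -/
lemma IsMarks.lintegral_expNeg_clusterPenalty (H : IsMarks p kind N s h μ) (σ : Bool) (i : K₁ ⊕ K₂)
    (t : ℝ≥0∞) (x : Plane) (c : I) :
    ∫⁻ ω, expNeg (p.clusterPenalty σ i t (kind c) x ∅ (N c ω) (fun l => s c l ω)
      (fun l => h (.inl (c, l)) ω)) ∂μ = expNeg (p.potential σ i t (.inl (kind c)) x) := by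
  rw [H.lintegral_size c (F := fun n S H => expNeg (p.clusterPenalty σ i t (kind c) x ∅ n S H))
    (fun n => measurable_expNeg.comp (p.measurable_clusterPenalty σ i t _ x ∅ measurable_const
      measurable_fst measurable_snd))]
  simp_rw [H.lintegral_expNeg_clusterPenalty_size]
  simp only [Set.mem_empty_iff_false, not_false_eq_true, Finset.filter_true, Finset.card_range]
  rw [lintegral_pow_poissonMeasure _ (p.meanFactor_le_one _ _ _ _ _)]
  rfl

open Classical in
/-- Mecke formula for a Poisson cluster. -/
lemma IsMarks.tsum_lintegral_expNeg_clusterPenalty (H : IsMarks p kind N s h μ) (σ : Bool) (i : K₁ ⊕ K₂)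
    (t : ℝ≥0∞) (x : Plane) (c : I) :
    ∑' l, ∫⁻ ω, expNeg ((if l < N c ω then 0 else ⊤) +
      p.clusterPenalty σ i t (kind c) x {l} (N c ω) (fun l => s c l ω)
      (fun l => h (.inl (c, l)) ω)) ∂μ =
    ENNReal.ofReal (p.mbar (kind c)) * expNeg (p.potential σ i t (.inl (kind c)) x) := by
  -- An absent candidate has exponent `⊤` and drops out; a present one leaves `n - 1` other points.
  -- Summing over `l < n` then gives the size-biased generating function.
  have h1 (l : ℕ) : ∫⁻ ω, expNeg ((if l < N c ω then 0 else ⊤) +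
      p.clusterPenalty σ i t (kind c) x {l} (N c ω) (fun l => s c l ω)
      (fun l => h (.inl (c, l)) ω)) ∂μ =
      ∫⁻ n, (if l < n then 1 else 0) * p.meanFactor σ i t (kind c) x ^ (n - 1)
        ∂(poissonMeasure (p.mbar (kind c)).toNNReal) := by
    rw [H.lintegral_size c (F := fun n S H => expNeg ((if l < n then 0 else ⊤) +
      p.clusterPenalty σ i t (kind c) x {l} n S H))
      (fun n => measurable_expNeg.comp (measurable_const.add
        (p.measurable_clusterPenalty σ i t _ x {l} measurable_const measurable_fst measurable_snd)))]
    refine lintegral_congr fun n => ?_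
    split_ifs with hl
    · simp_rw [zero_add, H.lintegral_expNeg_clusterPenalty_size, one_mul]
      congr 1
      trans ((Finset.range n).erase l).card
      · congr 1
        ext a; simp [and_comm]
      · rw [Finset.card_erase_of_mem (Finset.mem_range.2 hl), Finset.card_range]
    · simp
  simp_rw [h1]
  rw [← lintegral_tsum fun l => Measurable.aemeasurable .of_discrete]
  simp_rw [ENNReal.tsum_mul_right]
  have h2 (n : ℕ) : (∑' l : ℕ, if l < n then (1 : ℝ≥0∞) else 0) = n := by
    rw [tsum_eq_sum (s := Finset.range n) (fun l hl => if_neg fun h => hl (Finset.mem_range.2 h)),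
      Finset.sum_congr rfl fun l hl => if_pos (Finset.mem_range.1 hl)]
    simp
  simp_rw [h2]
  rw [lintegral_mul_pow_poissonMeasure _ (p.meanFactor_le_one _ _ _ _ _)]
  rfl

end Marks

/-- A station does not interfere with itself, so for fixed serving power `t` its own position and
fading may be altered freely. This separates the serving link from the level that it has to exceed.
-/
lemma interference_congr {σ : Bool} {τ t : ℝ≥0∞} {L : Type*} {present : L → Prop} {mp mp' : L → ℝ≥0∞}
    {fade fade' : L → ℝ} {b : L} (hm : ∀ b', b' ≠ b → mp b' = mp' b') (hf : ∀ b', b' ≠ b → fade b' = fade' b') :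
    interference σ τ t present mp fade b = interference σ τ t present mp' fade' b := by
  classical
  refine tsum_congr fun b' => ?_
  by_cases hb : b' = b
  · simp [hb]
  · rw [hm b' hb, hf b' hb]

/-! ### Interference grouped by cluster -/

section Net

variable {K₁ K₂ I J : Type*} (p : Params K₁ K₂)

/-- Interference in the network with given centres and marks. -/
def Params.netInterference (σ : Bool) (i : K₁ ⊕ K₂) (kind : I → K₁) (kindP : J → K₂) (x : I → Plane)
    (y : J → Plane) (t : ℝ≥0∞) (n : I → ℕ) (S : I → ℕ → Plane) (H : (I × ℕ) ⊕ J → ℝ)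
    (b : (I × ℕ) ⊕ J) : ℝ≥0∞ :=
  interference σ (ENNReal.ofReal (p.τ i)) t (netPresent n)
    (fun b => p.meanPow (netTier kind kindP b) (netPos x y S b)) H b

-- Points of one cluster are dependent through its size, so the interference is grouped by cluster;
-- different groups read disjoint sources.
open Classical in
lemma Params.netInterference_eq (σ : Bool) (i : K₁ ⊕ K₂) (kind : I → K₁) (kindP : J → K₂) (x : I → Plane)
    (y : J → Plane) (t : ℝ≥0∞) (n : I → ℕ) (S : I → ℕ → Plane) (H : (I × ℕ) ⊕ J → ℝ)
    (b : (I × ℕ) ⊕ J) :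
    p.netInterference σ i kind kindP x y t n S H b =
      ∑' c, p.clusterPenalty σ i t (kind c) (x c) {l | .inl (c, l) = b} (n c) (S c) (fun l => H (.inl (c, l))) +
      ∑' j, if .inr j = b then 0 else
        penalty σ (ENNReal.ofReal (p.τ i)) t (p.meanPow (.inr (kindP j)) (y j)) (H (.inr j)) := by
  unfold Params.netInterference interference
  rw [ENNReal_tsum_sumType, ENNReal.tsum_prod']
  congr 1
  · refine tsum_congr fun c => tsum_congr fun l => ?_
    by_cases hl : .inl (c, l) = b <;> simp [hl, netPresent, netTier, netPos]
  · refine tsum_congr fun j => ?_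
    by_cases hj : .inr j = b <;> simp [hj, netPresent, netTier, netPos]

variable [Countable I] [Countable J]

lemma Params.measurable_netInterference {α : Type*} [MeasurableSpace α] (σ : Bool) (i : K₁ ⊕ K₂)
    (kind : I → K₁) (kindP : J → K₂) (x : I → Plane) (y : J → Plane) {t : α → ℝ≥0∞}
    {n : α → I → ℕ} {S : α → I → ℕ → Plane} {H : α → (I × ℕ) ⊕ J → ℝ} (ht : Measurable t)
    (hn : Measurable n) (hS : Measurable S) (hH : Measurable H) (b : (I × ℕ) ⊕ J) :
    Measurable fun a => p.netInterference σ i kind kindP x y (t a) (n a) (S a) (H a) b :=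
  measurable_interference p kind kindP σ _ ht hn measurable_const measurable_const hS hH b

end Net

/-! ### Laplace transform of the interference for given centres -/

section Marks

variable {Ω K₁ K₂ I J : Type*} [mΩ : MeasurableSpace Ω] {μ : Measure Ω}
  {p : Params K₁ K₂} {kind : I → K₁} {N : I → Ω → ℕ} {s : I → ℕ → Ω → Plane}
  {h : (I × ℕ) ⊕ J → Ω → ℝ}

/-- Sources of randomness of a cluster, or of a Poisson point. -/
def unitSources : I ⊕ J → Set (I ⊕ (I × ℕ) ⊕ ((I × ℕ) ⊕ J))
  | .inl c => {a | a = .inl c ∨ (∃ l, a = .inr (.inl (c, l))) ∨ ∃ l, a = .inr (.inr (.inl (c, l)))}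
  | .inr j => {.inr (.inr (.inr j))}

lemma pairwise_disjoint_unitSources :
    Pairwise fun a b : I ⊕ J => Disjoint (unitSources a) (unitSources b) := by
  rintro (c | j) (c' | j') hne <;> refine Set.disjoint_left.2 ?_ <;> simp only [unitSources]
  · rintro _ (rfl | ⟨l, rfl⟩ | ⟨l, rfl⟩) <;> simp_all
  · rintro _ (rfl | ⟨l, rfl⟩ | ⟨l, rfl⟩) <;> simp
  · rintro _ rfl; simp
  · rintro _ rfl; simp_all

omit mΩ in
lemma measurable_unit {α : Type*} [MeasurableSpace α] (c : I) {F : ℕ → (ℕ → Plane) → (ℕ → ℝ) → α}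
    (hF : Measurable fun z : ℕ × (ℕ → Plane) × (ℕ → ℝ) => F z.1 z.2.1 z.2.2) :
    Measurable[⨆ a ∈ unitSources (.inl c : I ⊕ J), markSigma N s h a]
      fun ω => F (N c ω) (fun l => s c l ω) (fun l => h (.inl (c, l)) ω) := by
  refine hF.comp (Measurable.prodMk ?_ (Measurable.prodMk ?_ ?_))
  · exact measurable_size_of_mem (.inl rfl)
  · exact @measurable_pi_lambda _ _ _ (_) _ _ fun l => measurable_disp_of_mem (.inr (.inl ⟨l, rfl⟩))
  · exact @measurable_pi_lambda _ _ _ (_) _ _ fun l => measurable_fade_of_mem (.inr (.inr ⟨l, rfl⟩))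

lemma IsMarks.lintegral_expNeg_penalty_point (H : IsMarks p kind N s h μ) (σ : Bool) (i : K₁ ⊕ K₂)
    (t : ℝ≥0∞) (k : K₂) (y : Plane) (j : J) :
    ∫⁻ ω, expNeg (penalty σ (ENNReal.ofReal (p.τ i)) t (p.meanPow (.inr k) y) (h (.inr j) ω)) ∂μ =
      expNeg (p.potential σ i t (.inr k) y) := by
  rw [(H.fade_law _).lintegral_comp (f := fun h => expNeg (penalty σ (ENNReal.ofReal (p.τ i)) t
      (p.meanPow (.inr k) y) h)) (by
        refine (measurable_expNeg.comp (measurable_penalty _ _ ?_ ?_ measurable_id)).aemeasurable <;> fun_prop),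
    lintegral_expNeg_penalty]
  exact (expNeg_negLog (p.factor_le_one _ _ _ _ _)).symm

variable [IsProbabilityMeasure μ] [Countable I] [Countable J] (kindP : J → K₂) (x : I → Plane) (y : J → Plane)

-- Clusters and Poisson points are independent units, so their exponents add, and the serving point
-- contributes nothing.
open Classical in
lemma IsMarks.lintegral_expNeg_interference_point (H : IsMarks p kind N s h μ) (σ : Bool) (i : K₁ ⊕ K₂)
    (t : ℝ≥0∞) (j₀ : J) :
    ∫⁻ ω, expNeg (p.netInterference σ i kind kindP x y t (fun c => N c ω) (fun c l => s c l ω)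
      (fun b => h b ω) (.inr j₀)) ∂μ =
    expNeg (∑' c, p.potential σ i t (.inl (kind c)) (x c) +
      ∑' j, if j = j₀ then 0 else p.potential σ i t (.inr (kindP j)) (y j)) := by
  have key := lintegral_expNeg_tsum (ι := I ⊕ J) H.le H.indep (μ := μ) pairwise_disjoint_unitSources
    (f := Sum.elim (fun c ω => p.clusterPenalty σ i t (kind c) (x c) ∅ (N c ω) (fun l => s c l ω)
      (fun l => h (.inl (c, l)) ω))
      (fun j ω => if j = j₀ then 0 else
        penalty σ (ENNReal.ofReal (p.τ i)) t (p.meanPow (.inr (kindP j)) (y j)) (h (.inr j) ω)))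
    (l := Sum.elim (fun c => p.potential σ i t (.inl (kind c)) (x c))
      (fun j => if j = j₀ then 0 else p.potential σ i t (.inr (kindP j)) (y j)))
    (by
      rintro (c | j)
      · exact measurable_unit c (F := fun n S H => p.clusterPenalty σ i t (kind c) (x c) ∅ n S H)
          (p.measurable_clusterPenalty σ i t _ _ _ measurable_fst (by fun_prop) (by fun_prop))
      · dsimp only [Sum.elim_inr]
        split_ifs
        · exact measurable_const
        · refine @measurable_penalty Ω (_) σ _ _ _ _ ?_ ?_ ?_
          · exact measurable_const
          · exact measurable_const
          · exact measurable_fade_of_mem rfl)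
    (by
      rintro (c | j)
      · exact H.lintegral_expNeg_clusterPenalty σ i t (x c) c
      · dsimp only [Sum.elim_inr]
        split_ifs
        · simp
        · exact H.lintegral_expNeg_penalty_point σ i t _ _ j)
  simp_rw [ENNReal_tsum_sumType] at key
  refine Eq.trans (lintegral_congr fun ω => ?_) key
  simp [p.netInterference_eq]

-- Summing over the candidate `l` size-biases the serving cluster, and removing the candidate leaves
-- a full Poisson cluster again. Its potential therefore stays in the total, and the only trace of
-- the candidate is the factor `mbar`.
open Classical in
lemma IsMarks.tsum_lintegral_expNeg_interference_cluster (H : IsMarks p kind N s h μ) (σ : Bool) (i : K₁ ⊕ K₂)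
    (t : ℝ≥0∞) (c₀ : I) :
    ∑' l, ∫⁻ ω, expNeg ((if l < N c₀ ω then 0 else ⊤) + p.netInterference σ i kind kindP x y t
      (fun c => N c ω) (fun c l => s c l ω) (fun b => h b ω) (.inl (c₀, l))) ∂μ =
    ENNReal.ofReal (p.mbar (kind c₀)) * expNeg (∑' c, p.potential σ i t (.inl (kind c)) (x c) +
      ∑' j, p.potential σ i t (.inr (kindP j)) (y j)) := by
  let e : ℕ → ℝ≥0∞ := fun l => ∫⁻ ω, expNeg ((if l < N c₀ ω then 0 else ⊤) +
      p.clusterPenalty σ i t (kind c₀) (x c₀) {l} (N c₀ ω) (fun l => s c₀ l ω)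
      (fun l => h (.inl (c₀, l)) ω)) ∂μ
  have he l : e l ≤ 1 := by
    calc e l ≤ ∫⁻ _, 1 ∂μ := lintegral_mono fun ω => expNeg_le_one _
      _ = 1 := by simp
  let R := expNeg ((∑' c, if c = c₀ then 0 else p.potential σ i t (.inl (kind c)) (x c)) +
      ∑' j, p.potential σ i t (.inr (kindP j)) (y j))
  have h1 (l : ℕ) : ∫⁻ ω, expNeg ((if l < N c₀ ω then 0 else ⊤) + p.netInterference σ i kind kindP x y t
      (fun c => N c ω) (fun c l => s c l ω) (fun b => h b ω) (.inl (c₀, l))) ∂μ = e l * R := by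
    -- The serving cluster is a unit like the others, except that it carries the presence condition
    -- and omits `l`. Writing both with the clause `c = c₀` keeps the family uniform in `c`.
    have key := lintegral_expNeg_tsum (ι := I ⊕ J) H.le H.indep (μ := μ) pairwise_disjoint_unitSources
      (f := Sum.elim (fun c ω => (if c = c₀ ∧ ¬ l < N c ω then ⊤ else 0) +
        p.clusterPenalty σ i t (kind c) (x c) {l' | c = c₀ ∧ l' = l} (N c ω) (fun l => s c l ω)
        (fun l => h (.inl (c, l)) ω))
        (fun j ω => penalty σ (ENNReal.ofReal (p.τ i)) t (p.meanPow (.inr (kindP j)) (y j)) (h (.inr j) ω)))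
      (l := Sum.elim (fun c => if c = c₀ then negLog (e l) else p.potential σ i t (.inl (kind c)) (x c))
        (fun j => p.potential σ i t (.inr (kindP j)) (y j)))
      (by
        rintro (c | j)
        · refine measurable_unit c (F := fun n S H => (if c = c₀ ∧ ¬ l < n then ⊤ else 0) +
            p.clusterPenalty σ i t (kind c) (x c) {l' | c = c₀ ∧ l' = l} n S H) (Measurable.add ?_ ?_)
          · refine Measurable.ite ?_ measurable_const measurable_const
            exact measurable_fst (MeasurableSet.of_discrete (s := {n | c = c₀ ∧ ¬ l < n}))
          · exact p.measurable_clusterPenalty σ i t _ _ _ measurable_fst (by fun_prop) (by fun_prop)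
        · refine @measurable_penalty Ω (_) σ _ _ _ _ ?_ ?_ ?_
          · exact measurable_const
          · exact measurable_const
          · exact measurable_fade_of_mem rfl)
      (by
        rintro (c | j)
        · dsimp only [Sum.elim_inl]
          by_cases hc : c = c₀
          · subst hc
            rw [if_pos rfl, expNeg_negLog (he l)]
            refine lintegral_congr fun ω => ?_
            by_cases hl : l < N c ω <;> simp [hl]
          · simp only [hc, false_and, if_false, zero_add, Set.ofPred_false]
            exact H.lintegral_expNeg_clusterPenalty σ i t (x c) c
        · exact H.lintegral_expNeg_penalty_point σ i t _ _ j)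
    simp_rw [ENNReal_tsum_sumType] at key
    have h2 : expNeg ((∑' c, if c = c₀ then negLog (e l) else p.potential σ i t (.inl (kind c)) (x c)) +
        ∑' j, p.potential σ i t (.inr (kindP j)) (y j)) = e l * R := by
      rw [ENNReal.tsum_eq_add_tsum_ite c₀, if_pos rfl, add_assoc, expNeg_add, expNeg_negLog (he l)]
      congr 3
      exact tsum_congr fun c => by by_cases hc : c = c₀ <;> simp [hc]
    refine Eq.trans (lintegral_congr fun ω => ?_) (key.trans h2)
    congr 1
    rw [p.netInterference_eq, ← add_assoc]
    congr 1
    · simp only [Sum.elim_inl]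
      rw [ENNReal.tsum_add]
      congr 1
      · rw [tsum_eq_single c₀ (fun c hc => by simp [hc])]
        by_cases hl : l < N c₀ ω <;> simp [hl]
      · simp only [Sum.inl.injEq, Prod.mk.injEq]
  simp_rw [h1]
  rw [ENNReal.tsum_mul_right, H.tsum_lintegral_expNeg_clusterPenalty, mul_assoc, ← expNeg_add, ← add_assoc]
  congr 3
  exact (ENNReal.tsum_eq_add_tsum_ite (f := fun c => p.potential σ i t (.inl (kind c)) (x c)) c₀).symm

end Marks

/-! ### Integrating out the fading of the serving link -/

section Marks

variable {Ω K₁ K₂ I J : Type*} [mΩ : MeasurableSpace Ω] {μ : Measure Ω}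
  {p : Params K₁ K₂} {kind : I → K₁} {N : I → Ω → ℕ} {s : I → ℕ → Ω → Plane}
  {h : (I × ℕ) ⊕ J → Ω → ℝ} [IsProbabilityMeasure μ] [Countable I] [Countable J] (kindP : J → K₂) (x : I → Plane) (y : J → Plane)

-- Overwriting the fading of `b` by `0` removes this source while keeping the type of the marks, so
-- that independence from `h b` reduces to disjointness of sources.
omit [Countable I] [Countable J] [IsProbabilityMeasure μ] mΩ in
open Classical in
lemma measurable_marks_of_ne (b : (I × ℕ) ⊕ J) :
    Measurable[⨆ a ∈ ({.inr (.inr b)}ᶜ : Set (I ⊕ (I × ℕ) ⊕ ((I × ℕ) ⊕ J))), markSigma N s h a]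
      fun ω => (fun c => N c ω, fun c l => s c l ω, fun b' => if b' = b then 0 else h b' ω) := by
  refine Measurable.prodMk ?_ (Measurable.prodMk ?_ ?_)
  · exact @measurable_pi_lambda _ _ _ (_) _ _ fun c => measurable_size_of_mem (by simp)
  · exact @measurable_pi_lambda _ _ _ (_) _ _ fun c =>
      @measurable_pi_lambda _ _ _ (_) _ _ fun l => measurable_disp_of_mem (by simp)
  · refine @measurable_pi_lambda _ _ _ (_) _ _ fun b' => ?_
    by_cases hb : b' = b
    · simp only [hb, if_true]; exact measurable_const
    · simp only [hb, if_false]; exact measurable_fade_of_mem (by simpa using hb)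

omit [Countable I] [Countable J] [IsProbabilityMeasure μ] in
open Classical in
lemma IsMarks.measurable_marks_of_ne (H : IsMarks p kind N s h μ) (b : (I × ℕ) ⊕ J) :
    Measurable fun ω => (fun c => N c ω, fun c l => s c l ω, fun b' => if b' = b then 0 else h b' ω) :=
  (HetNet.measurable_marks_of_ne b).mono (iSup₂_le fun a _ => H.le a) le_rfl

omit [Countable I] [Countable J] [IsProbabilityMeasure μ] in
open Classical in
lemma IsMarks.indepFun_marks_of_ne (H : IsMarks p kind N s h μ) (b : (I × ℕ) ⊕ J) :
    IndepFun (fun ω => (fun c => N c ω, fun c l => s c l ω, fun b' => if b' = b then 0 else h b' ω)) (h b) μ := by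
  have hb : Measurable[⨆ a ∈ ({.inr (.inr b)} : Set (I ⊕ (I × ℕ) ⊕ ((I × ℕ) ⊕ J))), markSigma N s h a] (h b) :=
    measurable_fade_of_mem (Set.mem_singleton _)
  have hX := HetNet.measurable_marks_of_ne (N := N) (s := s) (h := h) b
  have hd : Disjoint ({.inr (.inr b)}ᶜ : Set (I ⊕ (I × ℕ) ⊕ ((I × ℕ) ⊕ J))) {.inr (.inr b)} := disjoint_compl_left
  have h3 := indep_iSup_of_disjoint H.le H.indep hd
  have h4 := indep_of_indep_of_le_right h3 hb.comap_le
  exact indep_of_indep_of_le_left h4 hX.comap_le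

-- The serving power `t` is a parameter here. The level does not read the fading of `b`, so the
-- exponential tail applies; absence of `b` is encoded by the exponent `⊤`.
open Classical in
lemma IsMarks.lintegral_fixed_power (H : IsMarks p kind N s h μ) (σ : Bool) (i : K₁ ⊕ K₂)
    (t : ℝ≥0∞) (b : (I × ℕ) ⊕ J) :
    ∫⁻ ω, (if netPresent (fun c => N c ω) b ∧ noise σ (ENNReal.ofReal (p.τ i)) (ENNReal.ofReal p.N₀) t +
      p.netInterference σ i kind kindP x y t (fun c => N c ω) (fun c l => s c l ω)
      (fun b => h b ω) b < ENNReal.ofReal (h b ω) then 1 else 0) ∂μ =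
    expNeg (noise σ (ENNReal.ofReal (p.τ i)) (ENNReal.ofReal p.N₀) t) *
      ∫⁻ ω, expNeg ((if netPresent (fun c => N c ω) b then 0 else ⊤) +
        p.netInterference σ i kind kindP x y t (fun c => N c ω) (fun c l => s c l ω)
        (fun b => h b ω) b) ∂μ := by
  let Y : Ω → (I → ℕ) × (I → ℕ → Plane) × ((I × ℕ) ⊕ J → ℝ) :=
    fun ω => (fun c => N c ω, fun c l => s c l ω, fun b' => if b' = b then 0 else h b' ω)
  have hY : Measurable Y := H.measurable_marks_of_ne b
  have hi : IndepFun Y (h b) μ := H.indepFun_marks_of_ne b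
  let e : (I → ℕ) × (I → ℕ → Plane) × ((I × ℕ) ⊕ J → ℝ) → ℝ≥0∞ :=
    fun z => if netPresent z.1 b then 1 else 0
  let A : (I → ℕ) × (I → ℕ → Plane) × ((I × ℕ) ⊕ J → ℝ) → ℝ≥0∞ :=
    fun z => noise σ (ENNReal.ofReal (p.τ i)) (ENNReal.ofReal p.N₀) t +
      p.netInterference σ i kind kindP x y t z.1 z.2.1 z.2.2 b
  have he : Measurable e := Measurable.ite (measurableSet_netPresent measurable_fst b)
    measurable_const measurable_const
  have hI : Measurable fun z : (I → ℕ) × (I → ℕ → Plane) × ((I × ℕ) ⊕ J → ℝ) =>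
      p.netInterference σ i kind kindP x y t z.1 z.2.1 z.2.2 b :=
    p.measurable_netInterference σ i kind kindP x y measurable_const measurable_fst
      (measurable_fst.comp measurable_snd) (measurable_snd.comp measurable_snd) b
  have hA : Measurable A := measurable_const.add hI
  have hAeq ω : A (Y ω) = noise σ (ENNReal.ofReal (p.τ i)) (ENNReal.ofReal p.N₀) t +
      p.netInterference σ i kind kindP x y t (fun c => N c ω) (fun c l => s c l ω) (fun b => h b ω) b := by
    refine congrArg (noise σ (ENNReal.ofReal (p.τ i)) (ENNReal.ofReal p.N₀) t + ·) (interference_congr (fun _ _ => rfl) fun b' hb' => ?_)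
    simp [Y, hb']
  have key := lintegral_lt_fade (H.fade_measurable b) (H.fade_law b) hY hi he hA
  simp only [hAeq] at key
  rw [← lintegral_const_mul]
  · refine Eq.trans (lintegral_congr fun ω => ?_) (key.trans (lintegral_congr fun ω => ?_))
    · by_cases h1 : netPresent (fun c => N c ω) b <;> simp [e, Y, h1, Set.indicator_apply]
    · by_cases h1 : netPresent (fun c => N c ω) b <;> simp [e, Y, h1, expNeg_add]
  · refine measurable_expNeg.comp (Measurable.add ?_ ?_)
    · refine Measurable.ite (measurableSet_netPresent (measurable_pi_lambda _ H.size_measurable) b)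
        measurable_const measurable_const
    · exact p.measurable_netInterference σ i kind kindP x y measurable_const
        (measurable_pi_lambda _ H.size_measurable)
        (measurable_pi_lambda _ fun c => measurable_pi_lambda _ fun l => H.disp_measurable c l)
        (measurable_pi_lambda _ H.fade_measurable) b

end Marks

/-! ### Mean number of good stations for given centres -/

section Marks

variable {Ω K₁ K₂ I J : Type*} [mΩ : MeasurableSpace Ω] {μ : Measure Ω}
  {p : Params K₁ K₂} {kind : I → K₁} {N : I → Ω → ℕ} {s : I → ℕ → Ω → Plane}
  {h : (I × ℕ) ⊕ J → Ω → ℝ}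

/-- Normalized noise, for service by tier `i`. -/
def Params.noise (p : Params K₁ K₂) (σ : Bool) (i : K₁ ⊕ K₂) (t : ℝ≥0∞) : ℝ≥0∞ :=
  HetNet.noise σ (ENNReal.ofReal (p.τ i)) (ENNReal.ofReal p.N₀) t

@[fun_prop]
lemma Params.measurable_noise (p : Params K₁ K₂) {α : Type*} [MeasurableSpace α] (σ : Bool) (i : K₁ ⊕ K₂)
    {t : α → ℝ≥0∞} (ht : Measurable t) : Measurable fun a => p.noise σ i (t a) :=
  HetNet.measurable_noise σ _ _ ht

/-- `Good` for the network with given centres and marks. -/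
def Params.NetGood (p : Params K₁ K₂) (σ : Bool) (i : K₁ ⊕ K₂) (kind : I → K₁) (kindP : J → K₂)
    (x : I → Plane) (y : J → Plane) (n : I → ℕ) (S : I → ℕ → Plane) (H : (I × ℕ) ⊕ J → ℝ)
    (b : (I × ℕ) ⊕ J) : Prop :=
  Good σ (ENNReal.ofReal (p.τ i)) (ENNReal.ofReal p.N₀) (netPresent n)
    (fun b => p.meanPow (netTier kind kindP b) (netPos x y S b)) H b

variable [Countable I] [Countable J]

lemma Params.measurableSet_netGood (p : Params K₁ K₂) {α : Type*} [MeasurableSpace α] (σ : Bool) (i : K₁ ⊕ K₂)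
    (kind : I → K₁) (kindP : J → K₂) {x : α → I → Plane} {y : α → J → Plane}
    {n : α → I → ℕ} {S : α → I → ℕ → Plane} {H : α → (I × ℕ) ⊕ J → ℝ} (hx : Measurable x)
    (hy : Measurable y) (hn : Measurable n) (hS : Measurable S) (hH : Measurable H) (b : (I × ℕ) ⊕ J) :
    MeasurableSet {a | p.NetGood σ i kind kindP (x a) (y a) (n a) (S a) (H a) b} := by
  have ht : Measurable fun a => p.meanPow (netTier kind kindP b) (netPos (x a) (y a) (S a) b) :=
    (p.measurable_meanPow _).comp (measurable_netPos hx hy hS b)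
  have h1 := (p.measurable_noise σ i ht).add (measurable_interference p kind kindP σ (ENNReal.ofReal (p.τ i)) ht hn hx hy hS hH b)
  refine (measurableSet_netPresent hn b).inter (measurableSet_lt h1 ?_)
  · exact ENNReal.measurable_ofReal.comp ((measurable_pi_apply b).comp hH)

variable [IsProbabilityMeasure μ] (kindP : J → K₂) (x : I → Plane) (y : J → Plane)

/-- Sum of the potentials of all clusters and Poisson points. -/
def Params.totalPotential (p : Params K₁ K₂) (σ : Bool) (i : K₁ ⊕ K₂) (kind : I → K₁) (kindP : J → K₂)
    (x : I → Plane) (y : J → Plane) (t : ℝ≥0∞) : ℝ≥0∞ :=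
  ∑' c, p.potential σ i t (.inl (kind c)) (x c) + ∑' j, p.potential σ i t (.inr (kindP j)) (y j)

-- A Poisson point is always present and has no displacement, so its power is already fixed and no
-- presence condition remains.
open Classical in
lemma IsMarks.lintegral_good_point (H : IsMarks p kind N s h μ) (σ : Bool) (i : K₁ ⊕ K₂) (j₀ : J) :
    ∫⁻ ω, (if p.NetGood σ i kind kindP x y (fun c => N c ω) (fun c l => s c l ω) (fun b => h b ω)
      (.inr j₀) then 1 else 0) ∂μ =
    expNeg (p.noise σ i (p.meanPow (.inr (kindP j₀)) (y j₀)) +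
      (∑' c, p.potential σ i (p.meanPow (.inr (kindP j₀)) (y j₀)) (.inl (kind c)) (x c) +
        ∑' j, if j = j₀ then 0 else p.potential σ i (p.meanPow (.inr (kindP j₀)) (y j₀)) (.inr (kindP j)) (y j))) := by
  have h1 := H.lintegral_fixed_power kindP x y σ i (p.meanPow (.inr (kindP j₀)) (y j₀)) (.inr j₀)
  rw [expNeg_add, ← H.lintegral_expNeg_interference_point kindP x y σ i]
  refine Eq.trans ?_ (h1.trans ?_)
  · exact lintegral_congr fun ω => if_congr Iff.rfl rfl rfl
  · refine congrArg (expNeg (p.noise σ i (p.meanPow (.inr (kindP j₀)) (y j₀))) * ·) (lintegral_congr fun ω => ?_)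
    rw [if_pos (by exact trivial), zero_add]

omit [Countable I] [Countable J] [IsProbabilityMeasure μ] mΩ in
open Classical in
lemma measurable_marks_of_ne_disp (c₀ : I) (l₀ : ℕ) :
    Measurable[⨆ a ∈ ({.inr (.inl (c₀, l₀))}ᶜ : Set (I ⊕ (I × ℕ) ⊕ ((I × ℕ) ⊕ J))), markSigma N s h a]
      fun ω => (fun c => N c ω, fun c l => if (c, l) = (c₀, l₀) then 0 else s c l ω, fun b => h b ω) := by
  refine Measurable.prodMk ?_ (Measurable.prodMk ?_ ?_)
  · exact @measurable_pi_lambda _ _ _ (_) _ _ fun c => measurable_size_of_mem (by simp)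
  · refine @measurable_pi_lambda _ _ _ (_) _ _ fun c =>
      @measurable_pi_lambda _ _ _ (_) _ _ fun l => ?_
    by_cases hb : (c, l) = (c₀, l₀)
    · simp only [hb, if_true]; exact measurable_const
    · simp only [hb, if_false]
      refine measurable_disp_of_mem ?_
      rw [Set.mem_compl_singleton_iff]
      simpa using hb
  · exact @measurable_pi_lambda _ _ _ (_) _ _ fun b' => measurable_fade_of_mem (by simp)

omit [Countable I] [Countable J] [IsProbabilityMeasure μ] in
open Classical in
lemma IsMarks.indepFun_marks_of_ne_disp (H : IsMarks p kind N s h μ) (c₀ : I) (l₀ : ℕ) :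
    IndepFun (s c₀ l₀)
      (fun ω => (fun c => N c ω, fun c l => if (c, l) = (c₀, l₀) then 0 else s c l ω, fun b => h b ω)) μ := by
  have hb : Measurable[⨆ a ∈ ({.inr (.inl (c₀, l₀))} : Set (I ⊕ (I × ℕ) ⊕ ((I × ℕ) ⊕ J))), markSigma N s h a] (s c₀ l₀) :=
    measurable_disp_of_mem (Set.mem_singleton _)
  have hX := measurable_marks_of_ne_disp (N := N) (s := s) (h := h) c₀ l₀
  have hd : Disjoint ({.inr (.inl (c₀, l₀))} : Set (I ⊕ (I × ℕ) ⊕ ((I × ℕ) ⊕ J))) {.inr (.inl (c₀, l₀))}ᶜ :=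
    disjoint_compl_right
  have h3 := indep_iSup_of_disjoint H.le H.indep hd
  have h4 := indep_of_indep_of_le_right h3 hX.comap_le
  exact indep_of_indep_of_le_left h4 hb.comap_le

omit [Countable I] [Countable J] [IsProbabilityMeasure μ] in
open Classical in
lemma IsMarks.measurable_marks_of_ne_disp (H : IsMarks p kind N s h μ) (c₀ : I) (l₀ : ℕ) :
    Measurable fun ω => (fun c => N c ω, fun c l => if (c, l) = (c₀, l₀) then 0 else s c l ω, fun b => h b ω) :=
  (HetNet.measurable_marks_of_ne_disp c₀ l₀).mono (iSup₂_le fun a _ => H.le a) le_rfl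

-- The displacement `v` of the candidate determines the serving power and enters nowhere else, so
-- conditioning on it reduces to the case of a fixed power.
open Classical in
lemma IsMarks.lintegral_good_cluster (H : IsMarks p kind N s h μ) (σ : Bool) (i : K₁ ⊕ K₂) (c₀ : I) (l : ℕ) :
    ∫⁻ ω, (if p.NetGood σ i kind kindP x y (fun c => N c ω) (fun c l => s c l ω) (fun b => h b ω)
      (.inl (c₀, l)) then 1 else 0) ∂μ =
    ∫⁻ v, expNeg (p.noise σ i (p.meanPow (.inl (kind c₀)) (x c₀ + v))) *
      ∫⁻ ω, expNeg ((if l < N c₀ ω then 0 else ⊤) +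
        p.netInterference σ i kind kindP x y (p.meanPow (.inl (kind c₀)) (x c₀ + v)) (fun c => N c ω)
          (fun c l => s c l ω) (fun b => h b ω) (.inl (c₀, l))) ∂μ ∂(densityLaw (p.g (kind c₀))) := by
  let F : Plane → (I → ℕ) × (I → ℕ → Plane) × ((I × ℕ) ⊕ J → ℝ) → ℝ≥0∞ := fun v z =>
    if netPresent z.1 (.inl (c₀, l) : (I × ℕ) ⊕ J) ∧ p.noise σ i (p.meanPow (.inl (kind c₀)) (x c₀ + v)) +
      p.netInterference σ i kind kindP x y (p.meanPow (.inl (kind c₀)) (x c₀ + v)) z.1 z.2.1 z.2.2 (.inl (c₀, l)) <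
        ENNReal.ofReal (z.2.2 (.inl (c₀, l))) then 1 else 0
  have hF : Measurable (Function.uncurry F) := by
    refine Measurable.ite ?_ measurable_const measurable_const
    have ht : Measurable fun a : Plane × (I → ℕ) × (I → ℕ → Plane) × ((I × ℕ) ⊕ J → ℝ) =>
        p.meanPow (.inl (kind c₀)) (x c₀ + a.1) := (p.measurable_meanPow _).comp (by fun_prop)
    have h1 := (p.measurable_noise σ i ht).add (p.measurable_netInterference σ i kind kindP x y ht
        (measurable_fst.comp measurable_snd) (measurable_fst.comp (measurable_snd.comp measurable_snd))
        (measurable_snd.comp (measurable_snd.comp measurable_snd)) (.inl (c₀, l)))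
    have h2 := measurableSet_lt h1 (ENNReal.measurable_ofReal.comp ((measurable_pi_apply (.inl (c₀, l))).comp
      (measurable_snd.comp (measurable_snd.comp (measurable_snd (α := Plane))))))
    exact (measurableSet_netPresent (measurable_fst.comp measurable_snd) (.inl (c₀, l) : (I × ℕ) ⊕ J)).inter h2
  -- The interference omits the candidate, so resetting its displacement to `0` has no effect.
  have hcongr (t : ℝ≥0∞) (ω : Ω) : p.netInterference σ i kind kindP x y t (fun c => N c ω)
      (fun c l' => if (c, l') = (c₀, l) then 0 else s c l' ω) (fun b => h b ω) (.inl (c₀, l)) =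
      p.netInterference σ i kind kindP x y t (fun c => N c ω)
        (fun c l => s c l ω) (fun b => h b ω) (.inl (c₀, l)) := by
    refine interference_congr (fun b' hb' => ?_) fun _ _ => rfl
    rcases b' with ⟨c, l'⟩ | j
    · have : ¬ (c, l') = (c₀, l) := fun hc => hb' (by rw [hc])
      simp only [netPos, Sum.elim_inl, this, if_false]
    · rfl
  have key := lintegral_of_indepFun_hasLaw (H.disp_measurable c₀ l) (H.disp_law c₀ l)
    (H.measurable_marks_of_ne_disp c₀ l) (H.indepFun_marks_of_ne_disp c₀ l) hF
  simp only [F, hcongr] at key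
  refine Eq.trans ?_ (key.trans (lintegral_congr fun v => ?_))
  · exact lintegral_congr fun ω => if_congr Iff.rfl rfl rfl
  · refine Eq.trans ?_ ((H.lintegral_fixed_power kindP x y σ i (p.meanPow (.inl (kind c₀)) (x c₀ + v))
      (.inl (c₀, l))).trans ?_)
    · exact lintegral_congr fun ω => if_congr Iff.rfl rfl rfl
    · refine congrArg (expNeg (p.noise σ i (p.meanPow (.inl (kind c₀)) (x c₀ + v))) * ·)
        (lintegral_congr fun ω => congrArg expNeg (congrArg (· + _) ?_))
      exact if_congr Iff.rfl rfl rfl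

-- The noise does not depend on `l`, so after exchanging sum and integral the Mecke formula of the
-- serving cluster applies for each `v`.
open Classical in
lemma IsMarks.tsum_lintegral_good_cluster (H : IsMarks p kind N s h μ) (σ : Bool) (i : K₁ ⊕ K₂) (c₀ : I) :
    ∑' l, ∫⁻ ω, (if p.NetGood σ i kind kindP x y (fun c => N c ω) (fun c l => s c l ω) (fun b => h b ω)
      (.inl (c₀, l)) then 1 else 0) ∂μ =
    ENNReal.ofReal (p.mbar (kind c₀)) * ∫⁻ v, expNeg (p.noise σ i (p.meanPow (.inl (kind c₀)) (x c₀ + v)) +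
      p.totalPotential σ i kind kindP x y (p.meanPow (.inl (kind c₀)) (x c₀ + v))) ∂(densityLaw (p.g (kind c₀))) := by
  have ht : Measurable fun v : Plane => p.meanPow (.inl (kind c₀)) (x c₀ + v) :=
    (p.measurable_meanPow _).comp (by fun_prop)
  have hN : Measurable fun ω c => N c ω := measurable_pi_lambda _ H.size_measurable
  have hS : Measurable fun ω c l => s c l ω :=
    measurable_pi_lambda _ fun c => measurable_pi_lambda _ fun l => H.disp_measurable c l
  have hH : Measurable fun ω b => h b ω := measurable_pi_lambda _ H.fade_measurable
  simp_rw [H.lintegral_good_cluster]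
  rw [← lintegral_tsum]
  · simp_rw [ENNReal.tsum_mul_left, H.tsum_lintegral_expNeg_interference_cluster, mul_left_comm, ← expNeg_add]
    refine lintegral_const_mul _ (measurable_expNeg.comp ((p.measurable_noise σ i ht).add ?_))
    refine Measurable.add (Measurable.tsum fun c => ?_) (Measurable.tsum fun j => ?_) <;>
      exact p.measurable_potential σ i _ ht measurable_const
  · intro l
    refine ((measurable_expNeg.comp (p.measurable_noise σ i ht)).mul ?_).aemeasurable
    refine Measurable.lintegral_prod_right (f := fun v ω => expNeg ((if l < N c₀ ω then 0 else ⊤) +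
        p.netInterference σ i kind kindP x y (p.meanPow (.inl (kind c₀)) (x c₀ + v)) (fun c => N c ω)
          (fun c l => s c l ω) (fun b => h b ω) (.inl (c₀, l)))) ?_
    refine measurable_expNeg.comp (Measurable.add ?_ ?_)
    · refine Measurable.ite ?_ measurable_const measurable_const
      exact measurableSet_lt measurable_const ((H.size_measurable c₀).comp measurable_snd)
    · exact p.measurable_netInterference σ i kind kindP x y (ht.comp measurable_fst)
        (hN.comp measurable_snd) (hS.comp measurable_snd) (hH.comp measurable_snd) _

open Classical in
/-- Expected `goodCount` for fixed centres and points. -/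
lemma IsMarks.lintegral_goodCount (H : IsMarks p kind N s h μ) (σ : Bool) (i : K₁ ⊕ K₂) :
    ∫⁻ ω, p.goodCount σ (netTier kind kindP) (netPresent fun c => N c ω)
      (netPos x y fun c l => s c l ω) (fun b => h b ω) i ∂μ =
    ∑' c, (if .inl (kind c) = i then ENNReal.ofReal (p.mbar (kind c)) *
      ∫⁻ v, expNeg (p.noise σ i (p.meanPow (.inl (kind c)) (x c + v)) +
        p.totalPotential σ i kind kindP x y (p.meanPow (.inl (kind c)) (x c + v))) ∂(densityLaw (p.g (kind c))) else 0) +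
    ∑' j₀, (if .inr (kindP j₀) = i then
      expNeg (p.noise σ i (p.meanPow (.inr (kindP j₀)) (y j₀)) +
      (∑' c, p.potential σ i (p.meanPow (.inr (kindP j₀)) (y j₀)) (.inl (kind c)) (x c) +
        ∑' j, if j = j₀ then 0 else p.potential σ i (p.meanPow (.inr (kindP j₀)) (y j₀)) (.inr (kindP j)) (y j)))
      else 0) := by
  have hN : Measurable fun ω c => N c ω := measurable_pi_lambda _ H.size_measurable
  have hS : Measurable fun ω c l => s c l ω :=
    measurable_pi_lambda _ fun c => measurable_pi_lambda _ fun l => H.disp_measurable c l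
  have hH : Measurable fun ω b => h b ω := measurable_pi_lambda _ H.fade_measurable
  have h1 : ∫⁻ ω, p.goodCount σ (netTier kind kindP) (netPresent fun c => N c ω)
      (netPos x y fun c l => s c l ω) (fun b => h b ω) i ∂μ = ∑' b, ∫⁻ ω, (if netTier kind kindP b = i ∧
        p.NetGood σ i kind kindP x y (fun c => N c ω) (fun c l => s c l ω) (fun b => h b ω) b then 1 else 0) ∂μ := by
    refine lintegral_tsum fun b => (Measurable.ite ?_ measurable_const measurable_const).aemeasurable
    exact (MeasurableSet.const _).inter
      (p.measurableSet_netGood σ i kind kindP measurable_const measurable_const hN hS hH b)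
  rw [h1, ENNReal_tsum_sumType, ENNReal.tsum_prod']
  congr 1
  · refine tsum_congr fun c => ?_
    by_cases hc : .inl (kind c) = i
    · simp only [netTier, Sum.elim_inl, hc, true_and, if_true]
      have := H.tsum_lintegral_good_cluster kindP x y σ i c
      rw [hc] at this
      exact this
    · simp [netTier, hc]
  · refine tsum_congr fun j => ?_
    by_cases hj : .inr (kindP j) = i
    · simp only [netTier, Sum.elim_inr, hj, true_and, if_true]
      have := H.lintegral_good_point kindP x y σ i j
      rw [hj] at this
      exact this
    · simp [netTier, hj]

end Marks

/-! ### Several independent Poisson processes -/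

section Family

lemma measurable_of_uncurry {α β γ δ : Type*} [MeasurableSpace α] [MeasurableSpace β] [MeasurableSpace γ]
    [MeasurableSpace δ] {f : α → β → γ} (hf : Measurable (Function.uncurry f)) {u : δ → α} {v : δ → β}
    (hu : Measurable u) (hv : Measurable v) : Measurable fun d => f (u d) (v d) := hf.comp (hu.prodMk hv)

variable {Ω A : Type*} [mΩ : MeasurableSpace Ω] {μ : Measure Ω} [IsProbabilityMeasure μ] [Countable A]
  {lam : A → ℝ} {Z : A → ℕ → Ω → Plane}

/-- Laplace functional of independent Poisson point processes. -/
lemma lintegral_expNeg_tsum_ppp (hZ : ∀ a, IsPPP (lam a) (Z a) μ) (hI : iIndepFun (fun a ω n => Z a n ω) μ)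
    {f : A → Plane → ℝ≥0∞} (hf : ∀ a, Measurable (f a)) :
    ∫⁻ ω, expNeg (∑' a, ∑' n, f a (Z a n ω)) ∂μ =
      expNeg (∑' a, ∫⁻ y, ENNReal.ofReal (lam a) * (1 - expNeg (f a y))) := by
  refine lintegral_expNeg_tsum (m := fun a => MeasurableSpace.comap (fun ω n => Z a n ω) inferInstance)
    (fun a => (measurable_pi_lambda _ (hZ a).measurable).comap_le) hI (T := fun a => {a})
    (fun a b hab => by simpa using hab) (fun a => ?_) (fun a => (hZ a).laplace (hf a))
  have h1 : Measurable[⨆ b ∈ ({a} : Set A), MeasurableSpace.comap (fun ω n => Z b n ω) inferInstance]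
      fun ω n => Z a n ω :=
    (comap_measurable _).mono (le_iSup₂_of_le a (Set.mem_singleton a) le_rfl) le_rfl
  have h2 : Measurable fun x : ℕ → Plane => ∑' n, f a (x n) :=
    Measurable.tsum fun n => (hf a).comp (measurable_pi_apply n)
  exact h2.comp h1

omit [Countable A] [IsProbabilityMeasure μ] in
lemma indepFun_ppp_ne [DecidableEq A] (hZ : ∀ a, IsPPP (lam a) (Z a) μ) (hI : iIndepFun (fun a ω n => Z a n ω) μ) (a₀ : A) :
    IndepFun (fun ω n => Z a₀ n ω) (fun ω a n => if a = a₀ then 0 else Z a n ω) μ := by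
  let m : A → MeasurableSpace Ω := fun a => MeasurableSpace.comap (fun ω n => Z a n ω) inferInstance
  have hle a : m a ≤ mΩ := (measurable_pi_lambda _ (hZ a).measurable).comap_le
  have h3 := indep_iSup_of_disjoint hle hI (S := {a₀}) (T := {a₀}ᶜ) disjoint_compl_right
  have h1 (T : Set A) (a : A) (ha : a ∈ T) : Measurable[⨆ b ∈ T, m b] fun ω n => Z a n ω :=
    (comap_measurable _).mono (le_iSup₂_of_le a ha le_rfl) le_rfl
  have hY : Measurable[⨆ b ∈ ({a₀}ᶜ : Set A), m b] fun ω a n => if a = a₀ then 0 else Z a n ω := by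
    refine @measurable_pi_lambda _ _ _ (_) _ _ fun a => ?_
    by_cases ha : a = a₀
    · simp only [ha, if_true]
      exact measurable_const
    · simp only [ha, if_false]
      exact h1 _ a ha
  exact indep_of_indep_of_le_left (indep_of_indep_of_le_right h3 hY.comap_le)
    (h1 {a₀} a₀ (Set.mem_singleton _)).comap_le

/-- Campbell–Mecke formula for one of several independent Poisson point processes. -/
lemma lintegral_tsum_ppp_erase [DecidableEq A] (hZ : ∀ a, IsPPP (lam a) (Z a) μ) (hI : iIndepFun (fun a ω n => Z a n ω) μ)
    (a₀ : A) {g : Plane → ℝ≥0∞} (hg : Measurable g) {f : A → Plane → Plane → ℝ≥0∞}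
    (hf : ∀ a, Measurable (Function.uncurry (f a))) :
    ∫⁻ ω, ∑' n, g (Z a₀ n ω) * expNeg (∑' m : {m // m ≠ n}, f a₀ (Z a₀ n ω) (Z a₀ m ω) +
        ∑' a, if a = a₀ then 0 else ∑' m, f a (Z a₀ n ω) (Z a m ω)) ∂μ =
      ENNReal.ofReal (lam a₀) * ∫⁻ x, g x *
        expNeg (∑' a, ∫⁻ y, ENNReal.ofReal (lam a) * (1 - expNeg (f a x y))) := by
  -- The second argument holds the other processes. Its entry at `a₀` is never read and is later
  -- overwritten by `0`, which makes it independent of the first argument.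
  let F : (ℕ → Plane) → (A → ℕ → Plane) → ℝ≥0∞ := fun x z =>
    ∑' n, g (x n) * expNeg (∑' m : {m // m ≠ n}, f a₀ (x n) (x m) +
        ∑' a, if a = a₀ then 0 else ∑' m, f a (x n) (z a m))
  -- The exponent left by the processes other than `a₀` when the reference point is `x`.
  let L : Plane → ℝ≥0∞ := fun x => ∑' a, if a = a₀ then 0 else
    ∫⁻ y, ENNReal.ofReal (lam a) * (1 - expNeg (f a x y))
  have hmeas (a : A) : Measurable fun x => ∫⁻ y, ENNReal.ofReal (lam a) * (1 - expNeg (f a x y)) := by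
    refine Measurable.lintegral_prod_right (f := fun x y => ENNReal.ofReal (lam a) * (1 - expNeg (f a x y))) ?_
    exact (measurable_const.sub (measurable_expNeg.comp (hf a))).const_mul _
  have hL : Measurable L := Measurable.tsum fun a => by
    by_cases ha : a = a₀
    · simp only [ha, if_true]; exact measurable_const
    · simp only [ha, if_false]; exact hmeas a
  have hF1 (n : ℕ) : Measurable fun x : ℕ → Plane => ∑' m : {m // m ≠ n}, f a₀ (x n) (x m) :=
    Measurable.tsum fun m => measurable_of_uncurry (hf a₀) (measurable_pi_apply n) (measurable_pi_apply m.1)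
  have hF2 (n : ℕ) : Measurable fun p : (ℕ → Plane) × (A → ℕ → Plane) =>
      ∑' a, if a = a₀ then 0 else ∑' m, f a (p.1 n) (p.2 a m) := by
    refine Measurable.tsum fun a => ?_
    by_cases ha : a = a₀
    · simp only [ha, if_true]; exact measurable_const
    · simp only [ha, if_false]
      refine Measurable.tsum fun m => measurable_of_uncurry (hf a) ((measurable_pi_apply n).comp measurable_fst) ?_
      exact (measurable_pi_apply m).comp ((measurable_pi_apply a).comp measurable_snd)
  have hF : Measurable (Function.uncurry F) := Measurable.tsum fun n =>
    (hg.comp ((measurable_pi_apply n).comp measurable_fst)).mul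
      (measurable_expNeg.comp (((hF1 n).comp measurable_fst).add (hF2 n)))
  have hX : Measurable fun ω n => Z a₀ n ω := measurable_pi_lambda _ (hZ a₀).measurable
  have hY : Measurable fun ω a n => if a = a₀ then 0 else Z a n ω := by
    refine measurable_pi_lambda _ fun a => measurable_pi_lambda _ fun n => ?_
    by_cases ha : a = a₀
    · simp only [ha, if_true]; exact measurable_const
    · simp only [ha, if_false]; exact (hZ a).measurable n
  have hinner (x : Plane) : ∫⁻ ω, expNeg (∑' a, if a = a₀ then 0 else ∑' m, f a x (Z a m ω)) ∂μ = expNeg (L x) := by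
    have h1 := lintegral_expNeg_tsum_ppp hZ hI (f := fun a y => if a = a₀ then 0 else f a x y) (fun a => by
      by_cases ha : a = a₀
      · simp only [ha, if_true]; exact measurable_const
      · simp only [ha, if_false]; exact (hf a).comp measurable_prodMk_left)
    refine Eq.trans (lintegral_congr fun ω => ?_) (h1.trans ?_)
    · congr 1
      refine tsum_congr fun a => ?_
      by_cases ha : a = a₀ <;> simp [ha]
    · congr 1
      refine tsum_congr fun a => ?_
      by_cases ha : a = a₀ <;> simp [ha]
  have key := lintegral_of_indepFun hX hY (indepFun_ppp_ne hZ hI a₀) hF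
  -- With the points of process `a₀` frozen, each candidate sees only the Laplace functional of the
  -- other processes. What remains is an exponential functional of a single process.
  have h2 : ∀ x : ℕ → Plane, ∫⁻ ω, F x (fun a n => if a = a₀ then 0 else Z a n ω) ∂μ =
      ∑' n, (g (x n) * expNeg (L (x n))) * expNeg (∑' m : {m // m ≠ n}, f a₀ (x n) (x m)) := by
    intro x
    refine (lintegral_tsum fun n => ?_).trans (tsum_congr fun n => ?_)
    · exact (measurable_const.mul (measurable_expNeg.comp (measurable_const.add
        ((hF2 n).comp (measurable_const.prodMk hY))))).aemeasurable
    · simp_rw [expNeg_add]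
      refine (lintegral_const_mul _ ((measurable_expNeg.comp
        ((hF2 n).comp (measurable_const.prodMk hY))).const_mul _)).trans ?_
      refine (congrArg _ (lintegral_const_mul _ (measurable_expNeg.comp
        ((hF2 n).comp (measurable_const.prodMk hY))))).trans ?_
      have h3 : ∫⁻ ω, expNeg (∑' a, if a = a₀ then 0 else ∑' m, f a (x n) (if a = a₀ then 0 else Z a m ω)) ∂μ =
          expNeg (L (x n)) := by
        rw [← hinner]
        refine lintegral_congr fun ω => congrArg expNeg (tsum_congr fun a => ?_)
        by_cases ha : a = a₀ <;> simp [ha]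
      refine (congrArg _ (congrArg _ h3)).trans ?_
      ring
  have h4 : ∫⁻ ω, ∑' n, (g (Z a₀ n ω) * expNeg (L (Z a₀ n ω))) *
      expNeg (∑' m : {m // m ≠ n}, f a₀ (Z a₀ n ω) (Z a₀ m ω)) ∂μ = _ :=
    (hZ a₀).lintegral_tsum_expNeg_erase (hg.mul (measurable_expNeg.comp hL)) (hf a₀)
  refine Eq.trans (lintegral_congr fun ω => ?_) (key.trans ((lintegral_congr fun ω => h2 _).trans (h4.trans ?_)))
  · refine tsum_congr fun n => ?_
    congr 3
    refine tsum_congr fun a => ?_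
    by_cases ha : a = a₀ <;> simp [ha]
  · refine congrArg _ (lintegral_congr fun x => ?_)
    simp only [Pi.mul_apply, Function.comp_apply]
    rw [mul_assoc, ← expNeg_add, ENNReal.tsum_eq_add_tsum_ite a₀, add_comm]
    simp only [L]
    congr!

end Family

/-! ### Laplace exponents of the tiers -/

section TierMean

variable {K₁ K₂ : Type*} (p : Params K₁ K₂)

/-- Intensity of the cluster centres or points of a tier. -/
def Params.intensity : K₁ ⊕ K₂ → ℝ := Sum.elim p.lamP p.lam

/-- Exponent of the Laplace functional of the interference of tier `k`. -/
def Params.void (σ : Bool) (i : K₁ ⊕ K₂) (t : ℝ≥0∞) (k : K₁ ⊕ K₂) : ℝ≥0∞ :=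
  ∫⁻ x, ENNReal.ofReal (p.intensity k) * (1 - expNeg (p.potential σ i t k x))

/-- The tiers other than `q`. -/
abbrev Params.Other : Type _ := {k : K₁ // k ≠ p.q} ⊕ K₂

/-- The tier of an element of `Other`. -/
def Params.otherTier : p.Other → K₁ ⊕ K₂ := Sum.map Subtype.val id

/-- Mean factor of the noise and interference for serving mean power `t` when the cluster
centres of tier `q` are given by `ζ`. -/
def Params.weight (σ : Bool) (i : K₁ ⊕ K₂) (ζ : Measure Plane) (t : ℝ≥0∞) : ℝ≥0∞ :=
  expNeg (p.noise σ i t + (∫⁻ x, p.potential σ i t (.inl p.q) x ∂ζ + ∑' a, p.void σ i t (p.otherTier a)))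

open Classical in
/-- Mean number of base stations of tier `i` that serve the user at the origin with sufficient
SINR when the cluster centres of tier `q` are given by `ζ`. -/
def Params.tierMean (σ : Bool) (i : K₁ ⊕ K₂) (ζ : Measure Plane) : ℝ≥0∞ :=
  match i with
  | .inl k => if k = p.q then
      ∫⁻ x, ENNReal.ofReal (p.mbar k) * ∫⁻ v, p.weight σ (.inl k) ζ (p.meanPow (.inl k) (x + v))
        ∂(densityLaw (p.g k)) ∂ζ
    else ENNReal.ofReal (p.mbar k) * ∫⁻ v, (ENNReal.ofReal (p.lamP k) * ∫⁻ x,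
      expNeg (p.potential σ (.inl k) (p.meanPow (.inl k) (x + v)) (.inl k) x) *
        p.weight σ (.inl k) ζ (p.meanPow (.inl k) (x + v))) ∂(densityLaw (p.g k))
  | .inr k => ENNReal.ofReal (p.lam k) * ∫⁻ x, p.weight σ (.inr k) ζ (p.meanPow (.inr k) x)

/-- Tiers of the clusters when tier `q` has clusters labelled by `I`. -/
def Params.netKind (I : Type*) : I ⊕ ({k : K₁ // k ≠ p.q} × ℕ) → K₁ := Sum.elim (fun _ => p.q) fun c => c.1

variable {p} in
/-- Cluster centres when tier `q` has centres `x` and the other tiers are given by `z`. -/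
def Params.centres {I : Type*} (x : I → Plane) (z : p.Other → ℕ → Plane) :
    I ⊕ ({k : K₁ // k ≠ p.q} × ℕ) → Plane := Sum.elim x fun c => z (.inl c.1) c.2

variable {p} in
/-- Points of the Poisson tiers. -/
def Params.points (z : p.Other → ℕ → Plane) (j : K₂ × ℕ) : Plane := z (.inr j.1) j.2

lemma Params.totalPotential_eq {I : Type*} (σ : Bool) (i : K₁ ⊕ K₂) (x : I → Plane) (z : p.Other → ℕ → Plane)
    (t : ℝ≥0∞) : p.totalPotential σ i (p.netKind I) Prod.fst (p.centres x z) (p.points z) t =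
      ∫⁻ x, p.potential σ i t (.inl p.q) x ∂(pointMeasure x) +
        ∑' a, ∑' n, p.potential σ i t (p.otherTier a) (z a n) := by
  unfold Params.totalPotential
  rw [ENNReal_tsum_sumType, ENNReal_tsum_sumType (fun a : p.Other => _), lintegral_pointMeasure, add_assoc,
    ENNReal.tsum_prod', ENNReal.tsum_prod']
  rfl

/-- Separates the serving point, the rest of its own process and the other processes, which is the
shape of the Mecke formula for several processes. -/
lemma ENNReal_tsum_split {A : Type*} [DecidableEq A] (F : A → ℕ → ℝ≥0∞) (a₀ : A) (n : ℕ) :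
    ∑' a, ∑' m, F a m = F a₀ n + (∑' m : {m // m ≠ n}, F a₀ m + ∑' a, if a = a₀ then 0 else ∑' m, F a m) := by
  have h1 : ∑' m, F a₀ m = F a₀ n + ∑' m : {m // m ≠ n}, F a₀ m := by
    rw [ENNReal.tsum_eq_add_tsum_ite n]
    congr 1
    have := tsum_subtype {m | m ≠ n} (F a₀)
    refine Eq.trans (tsum_congr fun m => ?_) this.symm
    by_cases hm : m = n <;> simp [hm]
  rw [ENNReal.tsum_eq_add_tsum_ite a₀, h1, add_assoc]
  congr!

variable {Ω I : Type*} [mΩ : MeasurableSpace Ω] {μ : Measure Ω} [IsProbabilityMeasure μ]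
  [Countable I] {Z : p.Other → ℕ → Ω → Plane} (x : I → Plane)

@[fun_prop]
lemma Params.measurable_tsum_potential {α : Type*} [MeasurableSpace α] (σ : Bool) (i : K₁ ⊕ K₂) {t : α → ℝ≥0∞}
    (ht : Measurable t) : Measurable fun b => ∫⁻ x, p.potential σ i (t b) (.inl p.q) x ∂(pointMeasure x) := by
  simp_rw [lintegral_pointMeasure]
  exact Measurable.tsum fun c => p.measurable_potential σ i _ ht measurable_const

variable [Countable K₁] [Countable K₂]

omit [Countable I] in
lemma Params.measurable_tsum_tsum_potential {α : Type*} [MeasurableSpace α] (σ : Bool) (i : K₁ ⊕ K₂) {t : α → ℝ≥0∞}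
    (ht : Measurable t) {z : α → p.Other → ℕ → Plane} (hz : Measurable z) :
    Measurable fun b => ∑' a, ∑' n, p.potential σ i (t b) (p.otherTier a) (z b a n) :=
  Measurable.tsum fun a => Measurable.tsum fun n => p.measurable_potential σ i _ ht
    ((measurable_pi_apply n).comp ((measurable_pi_apply a).comp hz))

-- Averaging over the other tiers replaces each random sum of potentials by its Laplace exponent
-- `void`, while the centres of tier `q` stay fixed.
omit [Countable I] in
lemma Params.lintegral_expNeg_totalPotential (hZ : ∀ a, IsPPP (p.intensity (p.otherTier a)) (Z a) μ)
    (hI : iIndepFun (fun a ω n => Z a n ω) μ) (σ : Bool) (i : K₁ ⊕ K₂) (t : ℝ≥0∞) :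
    ∫⁻ ω, expNeg (p.noise σ i t + p.totalPotential σ i (p.netKind I) Prod.fst (p.centres x fun a n => Z a n ω)
      (p.points fun a n => Z a n ω) t) ∂μ = p.weight σ i (pointMeasure x) t := by
  have hm (a : p.Other) : Measurable fun y => p.potential σ i t (p.otherTier a) y :=
    p.measurable_potential σ i _ measurable_const measurable_id
  have hm' : Measurable fun ω => ∑' a, ∑' n, p.potential σ i t (p.otherTier a) (Z a n ω) :=
    Measurable.tsum fun a => Measurable.tsum fun n => (hm a).comp ((hZ a).measurable n)
  simp_rw [p.totalPotential_eq, ← add_assoc]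
  have h1 := lintegral_expNeg_tsum_ppp hZ hI hm
  rw [Params.weight, ← add_assoc, expNeg_add _ (∑' a, _), ← show _ = expNeg (∑' a, p.void σ i t (p.otherTier a)) from h1]
  simp_rw [expNeg_add _ (∑' a, _)]
  exact lintegral_const_mul _ (measurable_expNeg.comp hm')

lemma Params.measurable_expNeg_totalPotential {α : Type*} [MeasurableSpace α] (σ : Bool) (i : K₁ ⊕ K₂) {t : α → ℝ≥0∞}
    (ht : Measurable t) {z : α → p.Other → ℕ → Plane} (hz : Measurable z) :
    Measurable fun b => expNeg (p.noise σ i (t b) + p.totalPotential σ i (p.netKind I) Prod.fst (p.centres x (z b))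
      (p.points (z b)) (t b)) := by
  simp_rw [p.totalPotential_eq]
  exact measurable_expNeg.comp ((p.measurable_noise σ i ht).add
    ((p.measurable_tsum_potential x σ i ht).add (p.measurable_tsum_tsum_potential σ i ht hz)))

/-- The points of tier `a₀` as serving candidates, averaged over the tiers other than `q`. -/
lemma Params.lintegral_tsum_erase [DecidableEq p.Other] (hZ : ∀ a, IsPPP (p.intensity (p.otherTier a)) (Z a) μ)
    (hI : iIndepFun (fun a ω n => Z a n ω) μ) (σ : Bool) (i : K₁ ⊕ K₂) {T : Plane → ℝ≥0∞} (hT : Measurable T)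
    (a₀ : p.Other) {g : Plane → ℝ≥0∞} (hg : Measurable g) :
    ∫⁻ ω, ∑' n, g (Z a₀ n ω) * expNeg (p.noise σ i (T (Z a₀ n ω)) +
        (∫⁻ x, p.potential σ i (T (Z a₀ n ω)) (.inl p.q) x ∂(pointMeasure x) +
        (∑' m : {m // m ≠ n}, p.potential σ i (T (Z a₀ n ω)) (p.otherTier a₀) (Z a₀ m ω) +
        ∑' a, if a = a₀ then 0 else ∑' m, p.potential σ i (T (Z a₀ n ω)) (p.otherTier a) (Z a m ω)))) ∂μ =
      ENNReal.ofReal (p.intensity (p.otherTier a₀)) * ∫⁻ y, g y * p.weight σ i (pointMeasure x) (T y) := by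
  have h1 := lintegral_tsum_ppp_erase hZ hI a₀ (g := fun y => g y * expNeg (p.noise σ i (T y) +
      ∫⁻ x, p.potential σ i (T y) (.inl p.q) x ∂(pointMeasure x)))
    (hg.mul (measurable_expNeg.comp ((p.measurable_noise σ i hT).add (p.measurable_tsum_potential x σ i hT))))
    (f := fun a x y => p.potential σ i (T x) (p.otherTier a) y)
    (fun a => p.measurable_potential σ i _ (hT.comp measurable_fst) measurable_snd)
  simp_rw [mul_assoc, ← expNeg_add, add_assoc] at h1
  exact h1

end TierMean

/-! ### Averaging over the tiers other than `q` -/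

section TierMean

variable {Ω K₁ K₂ I : Type*} {p : Params K₁ K₂} [mΩ : MeasurableSpace Ω] {μ : Measure Ω} [IsProbabilityMeasure μ]
  [Countable K₁] [Countable K₂] [Countable I] {Z : p.Other → ℕ → Ω → Plane} (x : I → Plane)

/-- Mean number of clustered base stations at the `c`-th cluster that serve the user. -/
def Params.clusterMean (p : Params K₁ K₂) (σ : Bool) (i : K₁ ⊕ K₂) {I : Type*} (x : I → Plane)
    (z : p.Other → ℕ → Plane) (k : K₁) (y : Plane) : ℝ≥0∞ :=
  ENNReal.ofReal (p.mbar k) * ∫⁻ v, expNeg (p.noise σ i (p.meanPow (.inl k) (y + v)) +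
    p.totalPotential σ i (p.netKind I) Prod.fst (p.centres x z) (p.points z) (p.meanPow (.inl k) (y + v)))
      ∂(densityLaw (p.g k))

lemma Params.lintegral_clusterMean_fixed (hZ : ∀ a, IsPPP (p.intensity (p.otherTier a)) (Z a) μ)
    (hI : iIndepFun (fun a ω n => Z a n ω) μ) (σ : Bool) (i : K₁ ⊕ K₂) (k : K₁) (y : Plane) :
    ∫⁻ ω, p.clusterMean σ i x (fun a n => Z a n ω) k y ∂μ =
      ENNReal.ofReal (p.mbar k) * ∫⁻ v, p.weight σ i (pointMeasure x) (p.meanPow (.inl k) (y + v))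
        ∂(densityLaw (p.g k)) := by
  have hz : Measurable fun ω a n => Z a n ω :=
    measurable_pi_lambda _ fun a => measurable_pi_lambda _ fun n => (hZ a).measurable n
  have hm : Measurable fun b : Ω × Plane => expNeg (p.noise σ i (p.meanPow (.inl k) (y + b.2)) +
      p.totalPotential σ i (p.netKind I) Prod.fst (p.centres x fun a n => Z a n b.1)
        (p.points fun a n => Z a n b.1) (p.meanPow (.inl k) (y + b.2))) :=
    p.measurable_expNeg_totalPotential x σ i ((p.measurable_meanPow _).comp (measurable_snd.const_add y))
      (hz.comp measurable_fst)
  unfold Params.clusterMean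
  rw [lintegral_const_mul _ (Measurable.lintegral_prod_right hm), lintegral_lintegral_swap hm.aemeasurable]
  simp_rw [p.lintegral_expNeg_totalPotential x hZ hI]

/-- The serving cluster is itself a summand of the total potential. Mecke's formula takes its centre
out, so its potential becomes a separate factor, and `weight` accounts for the remaining centres of
tier `k` as if none had been removed. -/
lemma Params.lintegral_tsum_clusterMean (hZ : ∀ a, IsPPP (p.intensity (p.otherTier a)) (Z a) μ)
    (hI : iIndepFun (fun a ω n => Z a n ω) μ) (σ : Bool) (i : K₁ ⊕ K₂) (k : {k : K₁ // k ≠ p.q}) :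
    ∫⁻ ω, ∑' n, p.clusterMean σ i x (fun a n => Z a n ω) k (Z (.inl k) n ω) ∂μ =
      ENNReal.ofReal (p.mbar k) * ∫⁻ v, (ENNReal.ofReal (p.lamP k) * ∫⁻ y,
      expNeg (p.potential σ i (p.meanPow (.inl k) (y + v)) (.inl k) y) *
        p.weight σ i (pointMeasure x) (p.meanPow (.inl k) (y + v))) ∂(densityLaw (p.g k)) := by
  classical
  have hz : Measurable fun ω a n => Z a n ω :=
    measurable_pi_lambda _ fun a => measurable_pi_lambda _ fun n => (hZ a).measurable n
  have hm n : Measurable fun b : Ω × Plane => expNeg (p.noise σ i (p.meanPow (.inl k) (Z (.inl k) n b.1 + b.2)) +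
      p.totalPotential σ i (p.netKind I) Prod.fst (p.centres x fun a n => Z a n b.1)
        (p.points fun a n => Z a n b.1) (p.meanPow (.inl k) (Z (.inl k) n b.1 + b.2))) :=
    p.measurable_expNeg_totalPotential x σ i ((p.measurable_meanPow _).comp
      ((((hZ _).measurable n).comp measurable_fst).add measurable_snd)) (hz.comp measurable_fst)
  have hs : Measurable fun b : Ω × Plane => ∑' n, expNeg (p.noise σ i (p.meanPow (.inl k) (Z (.inl k) n b.1 + b.2)) +
      p.totalPotential σ i (p.netKind I) Prod.fst (p.centres x fun a n => Z a n b.1)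
        (p.points fun a n => Z a n b.1) (p.meanPow (.inl k) (Z (.inl k) n b.1 + b.2))) := Measurable.tsum hm
  have h1 ω : ∑' n, p.clusterMean σ i x (fun a n => Z a n ω) k (Z (.inl k) n ω) =
      ENNReal.ofReal (p.mbar k) * ∫⁻ v, ∑' n, expNeg (p.noise σ i (p.meanPow (.inl k) (Z (.inl k) n ω + v)) +
      p.totalPotential σ i (p.netKind I) Prod.fst (p.centres x fun a n => Z a n ω)
        (p.points fun a n => Z a n ω) (p.meanPow (.inl k) (Z (.inl k) n ω + v))) ∂(densityLaw (p.g k)) := by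
    unfold Params.clusterMean
    rw [ENNReal.tsum_mul_left]
    exact congrArg _ (lintegral_tsum fun n => ((hm n).comp measurable_prodMk_left).aemeasurable).symm
  simp_rw [h1]
  rw [lintegral_const_mul _ (Measurable.lintegral_prod_right hs), lintegral_lintegral_swap hs.aemeasurable]
  congr 1
  refine lintegral_congr fun v => ?_
  have hT : Measurable fun y : Plane => p.meanPow (.inl k) (y + v) :=
    (p.measurable_meanPow _).comp (measurable_id.add_const v)
  rw [← show _ = ENNReal.ofReal (p.lamP k) * _ from p.lintegral_tsum_erase x hZ hI σ i hT (.inl k)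
    (g := fun y => expNeg (p.potential σ i (p.meanPow (.inl k) (y + v)) (.inl k) y))
    (measurable_expNeg.comp (p.measurable_potential σ i _ hT measurable_id))]
  refine lintegral_congr fun ω => tsum_congr fun n => ?_
  rw [p.totalPotential_eq, ENNReal_tsum_split _ (.inl k) n, ← expNeg_add]
  congr 1
  have h2 : p.otherTier (.inl k) = .inl k := rfl
  rw [h2]
  ring

open Classical in
/-- Mean number of base stations that serve the user, for fixed centres and points. -/
def Params.fixedMean (p : Params K₁ K₂) (σ : Bool) (i : K₁ ⊕ K₂) {I : Type*} (x : I → Plane)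
    (z : p.Other → ℕ → Plane) : ℝ≥0∞ :=
  ∑' c, (if .inl (p.netKind I c) = i then p.clusterMean σ i x z (p.netKind I c) (p.centres x z c) else 0) +
    ∑' j₀ : K₂ × ℕ, (if .inr j₀.1 = i then
      expNeg (p.noise σ i (p.meanPow (.inr j₀.1) (p.points z j₀)) +
      (∑' c, p.potential σ i (p.meanPow (.inr j₀.1) (p.points z j₀)) (.inl (p.netKind I c)) (p.centres x z c) +
        ∑' j, if j = j₀ then 0 else p.potential σ i (p.meanPow (.inr j₀.1) (p.points z j₀)) (.inr j.1) (p.points z j)))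
      else 0)

lemma Params.lintegral_fixedMean_poisson (hZ : ∀ a, IsPPP (p.intensity (p.otherTier a)) (Z a) μ)
    (hI : iIndepFun (fun a ω n => Z a n ω) μ) (σ : Bool) (k : K₂) :
    ∫⁻ ω, p.fixedMean σ (.inr k) x (fun a n => Z a n ω) ∂μ = p.tierMean σ (.inr k) (pointMeasure x) := by
  classical
  have hT : Measurable (p.meanPow (.inr k)) := p.measurable_meanPow _
  have h1 := p.lintegral_tsum_erase x hZ hI σ (.inr k) hT (.inr k) (g := fun _ => 1) measurable_const
  simp_rw [one_mul] at h1
  refine Eq.trans (lintegral_congr fun ω => ?_) h1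
  unfold Params.fixedMean
  simp only [reduceCtorEq, if_false, tsum_zero, zero_add, Sum.inr.injEq]
  rw [ENNReal.tsum_prod', tsum_eq_single k (fun k' hk' => by simp [hk'])]
  refine tsum_congr fun n => ?_
  simp only [if_true]
  have hp (j : K₂ × ℕ) : p.points (fun a n => Z a n ω) j = Z (.inr j.1) j.2 ω := rfl
  simp_rw [hp]
  set t := p.meanPow (.inr k) (Z (.inr k) n ω)
  congr 2
  rw [lintegral_pointMeasure, ENNReal_tsum_sumType, add_assoc]
  congr 1
  -- Setting the term of the serving point to zero lets the double sum split in the Mecke form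
  -- without subtracting possibly infinite values.
  let F : p.Other → ℕ → ℝ≥0∞ := fun a m => if a = .inr k ∧ m = n then 0 else
    p.potential σ (.inr k) t (p.otherTier a) (Z a m ω)
  have h2 := ENNReal_tsum_split F (.inr k) n
  have h3 : F (.inr k) n = 0 := by simp [F]
  rw [h3, zero_add] at h2
  trans ∑' a, ∑' m, F a m
  · rw [ENNReal_tsum_sumType, ENNReal.tsum_prod', ENNReal.tsum_prod']
    congr 1
    refine tsum_congr fun k' => tsum_congr fun m => ?_
    by_cases hk' : k' = k ∧ m = n
    · rw [if_pos (Prod.ext hk'.1 hk'.2)]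
      simp [F, hk']
    · rw [if_neg fun h => hk' (Prod.mk.inj h)]
      simp only [F, Sum.inr.injEq, hk', if_false]
      rfl
  · rw [h2]
    congr 1
    · refine tsum_congr fun m => ?_
      simp [F, m.2]
    · refine tsum_congr fun a => ?_
      by_cases ha : a = .inr k <;> simp [F, ha]

/-- For tier `q` the centres are given and only the other tiers are averaged; for any other tier the
serving centre or point is random as well and the Mecke formula is needed. -/
lemma Params.lintegral_fixedMean (hZ : ∀ a, IsPPP (p.intensity (p.otherTier a)) (Z a) μ)
    (hI : iIndepFun (fun a ω n => Z a n ω) μ) (σ : Bool) (i : K₁ ⊕ K₂) :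
    ∫⁻ ω, p.fixedMean σ i x (fun a n => Z a n ω) ∂μ = p.tierMean σ i (pointMeasure x) := by
  classical
  rcases i with k | k
  · by_cases hk : k = p.q
    · subst hk
      unfold Params.tierMean
      simp only [if_true]
      rw [lintegral_pointMeasure]
      simp_rw [← p.lintegral_clusterMean_fixed x hZ hI]
      rw [← lintegral_tsum]
      · refine lintegral_congr fun ω => ?_
        unfold Params.fixedMean
        rw [ENNReal_tsum_sumType]
        have h1 (c : {k // k ≠ p.q} × ℕ) : ¬ (Sum.inl (c.1 : K₁) : K₁ ⊕ K₂) = .inl p.q := fun h =>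
          c.1.2 (Sum.inl.inj h)
        simp [Params.netKind, Params.centres, h1]
      · intro c
        refine (Measurable.const_mul ?_ _).aemeasurable
        refine Measurable.lintegral_prod_right (p.measurable_expNeg_totalPotential x σ _
          (t := fun b : Ω × Plane => p.meanPow (.inl p.q) (x c + b.2)) ?_ ?_)
        · exact (p.measurable_meanPow _).comp (measurable_snd.const_add _)
        · exact measurable_pi_lambda _ fun a => measurable_pi_lambda _ fun n =>
            ((hZ a).measurable n).comp measurable_fst
    · unfold Params.tierMean
      simp only [hk, if_false]
      rw [← p.lintegral_tsum_clusterMean x hZ hI σ (.inl k) ⟨k, hk⟩]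
      refine lintegral_congr fun ω => ?_
      unfold Params.fixedMean
      rw [ENNReal_tsum_sumType, ENNReal.tsum_prod', tsum_eq_single (⟨k, hk⟩ : {k // k ≠ p.q}) fun k' hk' => ?_]
      · simp [Params.netKind, Params.centres, Ne.symm hk]
      · have : (k' : K₁) ≠ k := fun h => hk' (Subtype.ext h)
        simp [Params.netKind, this]
  · exact p.lintegral_fixedMean_poisson x hZ hI σ k

/-- Expected `goodCount` when only the cluster centres of tier `q` are fixed. -/
lemma IsMarks.lintegral_goodCount_eq_tierMean {N : I ⊕ ({k : K₁ // k ≠ p.q} × ℕ) → Ω → ℕ}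
    {s : I ⊕ ({k : K₁ // k ≠ p.q} × ℕ) → ℕ → Ω → Plane}
    {h : ((I ⊕ ({k : K₁ // k ≠ p.q} × ℕ)) × ℕ) ⊕ (K₂ × ℕ) → Ω → ℝ}
    (H : IsMarks p (p.netKind I) N s h μ) (hZ : ∀ a, IsPPP (p.intensity (p.otherTier a)) (Z a) μ)
    (hI : iIndepFun (fun a ω n => Z a n ω) μ)
    (hZH : IndepFun (fun ω a n => Z a n ω) (fun ω => (fun c => N c ω, fun c l => s c l ω, fun b => h b ω)) μ)
    (σ : Bool) (i : K₁ ⊕ K₂) :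
    ∫⁻ ω, p.goodCount σ (netTier (p.netKind I) Prod.fst) (netPresent fun c => N c ω)
      (netPos (p.centres x fun a n => Z a n ω) (p.points fun a n => Z a n ω) fun c l => s c l ω)
      (fun b => h b ω) i ∂μ = p.tierMean σ i (pointMeasure x) := by
  classical
  have hN : Measurable fun ω c => N c ω := measurable_pi_lambda _ H.size_measurable
  have hS : Measurable fun ω c l => s c l ω :=
    measurable_pi_lambda _ fun c => measurable_pi_lambda _ fun l => H.disp_measurable c l
  have hH : Measurable fun ω b => h b ω := measurable_pi_lambda _ H.fade_measurable
  have hz : Measurable fun ω a n => Z a n ω :=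
    measurable_pi_lambda _ fun a => measurable_pi_lambda _ fun n => (hZ a).measurable n
  have key := lintegral_of_indepFun hz (hN.prodMk (hS.prodMk hH)) hZH
    (F := fun z m => p.goodCount σ (netTier (p.netKind I) Prod.fst) (netPresent m.1)
      (netPos (p.centres x z) (p.points z) m.2.1) m.2.2 i) (by
      refine measurable_goodCount p _ _ σ (measurable_fst.comp measurable_snd) ?_ ?_
        (measurable_fst.comp (measurable_snd.comp measurable_snd))
        (measurable_snd.comp (measurable_snd.comp measurable_snd)) i
      · refine measurable_pi_lambda _ fun c => ?_
        rcases c with c | c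
        · exact measurable_const
        · exact (measurable_pi_apply c.2).comp ((measurable_pi_apply (Sum.inl c.1 : p.Other)).comp measurable_fst)
      · exact measurable_pi_lambda _ fun j =>
          (measurable_pi_apply j.2).comp ((measurable_pi_apply (Sum.inr j.1 : p.Other)).comp measurable_fst))
  rw [← p.lintegral_fixedMean x hZ hI]
  refine key.trans (lintegral_congr fun ω => ?_)
  refine (H.lintegral_goodCount Prod.fst _ _ σ i).trans ?_
  unfold Params.fixedMean
  congr!

end TierMean

/-! ### Averaging over the parents of tier `q` -/

section TypicalMean

variable {Ω K₁ K₂ : Type*} {p : Params K₁ K₂} [mΩ : MeasurableSpace Ω] {μ : Measure Ω} [IsProbabilityMeasure μ]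
  {X : ℕ → Ω → Plane}

/-- Mean factor of the noise and interference when the representative cluster has centre `z` and
the serving mean power is `t`. -/
def Params.base (p : Params K₁ K₂) (σ : Bool) (i : K₁ ⊕ K₂) (z : Plane) (t : ℝ≥0∞) : ℝ≥0∞ :=
  expNeg (p.noise σ i t + (p.potential σ i t (.inl p.q) z + ∑' k, p.void σ i t k))

open Classical in
/-- Mean number of base stations of tier `i` that serve the typical user with sufficient SINR,
when the representative cluster has centre `z`. -/
def Params.typicalMean (p : Params K₁ K₂) (σ : Bool) (i : K₁ ⊕ K₂) (z : Plane) : ℝ≥0∞ :=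
  match i with
  | .inl k => (if k = p.q then ENNReal.ofReal (p.mbar k) *
        ∫⁻ v, p.base σ (.inl k) z (p.meanPow (.inl k) (z + v)) ∂(densityLaw (p.g k)) else 0) +
      ENNReal.ofReal (p.mbar k) * ∫⁻ v, (ENNReal.ofReal (p.lamP k) * ∫⁻ y,
      expNeg (p.potential σ (.inl k) (p.meanPow (.inl k) (y + v)) (.inl k) y) *
        p.base σ (.inl k) z (p.meanPow (.inl k) (y + v))) ∂(densityLaw (p.g k))
  | .inr k => ENNReal.ofReal (p.lam k) * ∫⁻ x, p.base σ (.inr k) z (p.meanPow (.inr k) x)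

lemma Params.tsum_tier_eq (p : Params K₁ K₂) (f : K₁ ⊕ K₂ → ℝ≥0∞) :
    ∑' k, f k = f (.inl p.q) + ∑' a, f (p.otherTier a) := by
  classical
  rw [ENNReal_tsum_sumType, ENNReal_tsum_sumType (fun a : p.Other => _), ENNReal.tsum_eq_add_tsum_ite p.q, add_assoc]
  congr 2
  refine Eq.trans (tsum_congr fun k => ?_) (tsum_subtype {k | k ≠ p.q} fun k => f (.inl k)).symm
  by_cases hk : k = p.q <;> simp [hk]

@[fun_prop]
lemma Params.measurable_void (p : Params K₁ K₂) {α : Type*} [MeasurableSpace α] (σ : Bool) (i : K₁ ⊕ K₂)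
    {t : α → ℝ≥0∞} (ht : Measurable t) (k : K₁ ⊕ K₂) : Measurable fun a => p.void σ i (t a) k := by
  refine Measurable.lintegral_prod_right (f := fun a x => ENNReal.ofReal (p.intensity k) *
    (1 - expNeg (p.potential σ i (t a) k x))) ?_
  exact (measurable_const.sub (measurable_expNeg.comp
    (p.measurable_potential σ i k (ht.comp measurable_fst) measurable_snd))).const_mul _

lemma Params.measurable_potential_right (p : Params K₁ K₂) (σ : Bool) (i : K₁ ⊕ K₂) (t : ℝ≥0∞) (k : K₁ ⊕ K₂) :
    Measurable (p.potential σ i t k) := p.measurable_potential σ i k measurable_const measurable_id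

/-- Only the last factor depends on `ζ`, so averaging over a random `ζ` is a Laplace functional. -/
lemma Params.weight_dirac_add (p : Params K₁ K₂) (σ : Bool) (i : K₁ ⊕ K₂) (z : Plane) (ζ : Measure Plane) (t : ℝ≥0∞) :
    p.weight σ i (Measure.dirac z + ζ) t = expNeg (p.noise σ i t + (p.potential σ i t (.inl p.q) z +
      ∑' a, p.void σ i t (p.otherTier a))) * expNeg (∫⁻ x, p.potential σ i t (.inl p.q) x ∂ζ) := by
  rw [← expNeg_add, Params.weight, lintegral_add_measure, lintegral_dirac]
  congr 1
  ring

lemma Params.base_eq (p : Params K₁ K₂) (σ : Bool) (i : K₁ ⊕ K₂) (z : Plane) (t : ℝ≥0∞) :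
    p.base σ i z t = expNeg (p.noise σ i t + (p.potential σ i t (.inl p.q) z +
      ∑' a, p.void σ i t (p.otherTier a))) * expNeg (p.void σ i t (.inl p.q)) := by
  rw [← expNeg_add, Params.base, p.tsum_tier_eq]
  congr 1
  ring

/-- The Laplace functional of the parents of tier `q` supplies the one void exponent that `weight`
lacks. -/
lemma Params.lintegral_weight (hX : IsPPP (p.lamP p.q) X μ) (σ : Bool) (i : K₁ ⊕ K₂) (z : Plane) (t : ℝ≥0∞) :
    ∫⁻ ω, p.weight σ i (Measure.dirac z + pointMeasure fun n => X n ω) t ∂μ = p.base σ i z t := by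
  simp_rw [p.weight_dirac_add, p.base_eq, lintegral_pointMeasure]
  have hm : Measurable fun ω => ∑' n, p.potential σ i t (.inl p.q) (X n ω) :=
    Measurable.tsum fun n => p.measurable_potential σ i _ measurable_const (hX.measurable n)
  refine (lintegral_const_mul _ (measurable_expNeg.comp hm)).trans ?_
  exact congrArg _ (hX.laplace (p.measurable_potential_right σ i t _))

lemma measurable_plane_sub (c : Plane) : Measurable fun y : Plane => y - c := measurable_id.sub_const c

variable [Countable K₁] [Countable K₂]

/-- Joint measurability of `weight` for measures obtained by translation. -/
lemma Params.measurable_weight (p : Params K₁ K₂) {α : Type*} [MeasurableSpace α] (σ : Bool) (i : K₁ ⊕ K₂)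
    (z : Plane) {c : α → Plane} (hc : Measurable c) {g : α → Measure Plane} (hg : Measurable g)
    {t : α → ℝ≥0∞} (ht : Measurable t) :
    Measurable fun a => p.weight σ i (Measure.dirac z + (locFin (g a)).map fun y => y - c a) (t a) := by
  simp_rw [p.weight_dirac_add]
  refine Measurable.mul ?_ ?_
  · exact measurable_expNeg.comp ((p.measurable_noise σ i ht).add ((p.measurable_potential σ i _ ht measurable_const).add
      (Measurable.tsum fun a => p.measurable_void σ i ht _)))
  · refine measurable_expNeg.comp ?_
    simp_rw [lintegral_map (p.measurable_potential_right σ i _ _) (measurable_plane_sub _)]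
    refine Measurable.lintegral_locFin (f := fun a y => p.potential σ i (t a) (.inl p.q) (y - c a)) ?_ hg
    exact p.measurable_potential σ i (.inl p.q) (t := fun b : α × Plane => t b.1) (x := fun b => b.2 - c b.1)
      (ht.comp measurable_fst) (measurable_snd.sub (hc.comp measurable_fst))

lemma Params.measurable_lintegral_weight (p : Params K₁ K₂) {α : Type*} [MeasurableSpace α] (σ : Bool) (i : K₁ ⊕ K₂)
    (z : Plane) {c : α → Plane} (hc : Measurable c) {g : α → Measure Plane} (hg : Measurable g)
    {x : α → Plane} (hx : Measurable x) :
    Measurable fun a => ENNReal.ofReal (p.mbar p.q) * ∫⁻ v, p.weight σ i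
      (Measure.dirac z + (locFin (g a)).map fun y => y - c a) (p.meanPow (.inl p.q) (x a + v))
        ∂(densityLaw (p.g p.q)) := by
  refine (Measurable.lintegral_prod_right ?_).const_mul _
  exact p.measurable_weight σ _ z (hc.comp measurable_fst) (hg.comp measurable_fst)
    ((p.measurable_meanPow _).comp ((hx.comp measurable_fst).add measurable_snd))

/-- Mecke's formula needs joint measurability in the reference point and the measure. For tier `q`
this includes an integral against the measure itself, which is the reason for `locFin`. -/
lemma Params.measurable_tierMean (p : Params K₁ K₂) {α : Type*} [MeasurableSpace α] (σ : Bool) (i : K₁ ⊕ K₂)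
    (z : Plane) {c : α → Plane} (hc : Measurable c) {g : α → Measure Plane} (hg : Measurable g) :
    Measurable fun a => p.tierMean σ i (Measure.dirac z + (locFin (g a)).map fun y => y - c a) := by
  classical
  rcases i with k | k
  · unfold Params.tierMean
    by_cases hk : k = p.q
    · simp only [hk, if_true]
      simp_rw [lintegral_add_measure, lintegral_dirac]
      refine Measurable.add (p.measurable_lintegral_weight σ _ z hc hg measurable_const) ?_
      have h2 (a : α) := lintegral_map (μ := locFin (g a)) (p.measurable_lintegral_weight σ (.inl p.q) z
        (measurable_const (a := c a)) (measurable_const (a := g a)) measurable_id) (measurable_plane_sub (c a))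
      simp only [id] at h2
      simp_rw [h2]
      refine Measurable.lintegral_locFin (f := fun a y => ENNReal.ofReal (p.mbar p.q) * ∫⁻ v, p.weight σ (.inl p.q)
        (Measure.dirac z + (locFin (g a)).map fun y => y - c a) (p.meanPow (.inl p.q) (y - c a + v))
          ∂(densityLaw (p.g p.q))) ?_ hg
      exact p.measurable_lintegral_weight σ _ z (hc.comp measurable_fst) (hg.comp measurable_fst)
        (measurable_snd.sub (hc.comp measurable_fst))
    · simp only [hk, if_false]
      refine Measurable.const_mul (Measurable.lintegral_prod_right (Measurable.const_mul
        (Measurable.lintegral_prod_right ?_) _)) _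
      have ht : Measurable fun b : (α × Plane) × Plane => p.meanPow (.inl k) (b.2 + b.1.2) :=
        (p.measurable_meanPow _).comp (by fun_prop)
      refine (measurable_expNeg.comp (p.measurable_potential σ _ _ ht measurable_snd)).mul ?_
      exact p.measurable_weight σ _ z (hc.comp (measurable_fst.comp measurable_fst))
        (hg.comp (measurable_fst.comp measurable_fst)) ht
  · refine Measurable.const_mul (Measurable.lintegral_prod_right ?_) _
    exact p.measurable_weight σ _ z (hc.comp measurable_fst) (hg.comp measurable_fst)
      ((p.measurable_meanPow _).comp measurable_snd)

omit [IsProbabilityMeasure μ] in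
lemma Params.measurable_weight_pointMeasure (hX : IsPPP (p.lamP p.q) X μ) (σ : Bool) (i : K₁ ⊕ K₂) (z : Plane)
    {α : Type*} [MeasurableSpace α] {w : α → Ω} (hw : Measurable w) {t : α → ℝ≥0∞} (ht : Measurable t) :
    Measurable fun a => p.weight σ i (Measure.dirac z + pointMeasure fun n => X n (w a)) (t a) := by
  simp_rw [p.weight_dirac_add, lintegral_pointMeasure]
  refine Measurable.mul ?_ ?_
  · exact measurable_expNeg.comp ((p.measurable_noise σ i ht).add ((p.measurable_potential σ i _ ht measurable_const).add
      (Measurable.tsum fun a => p.measurable_void σ i ht _)))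
  · exact measurable_expNeg.comp (Measurable.tsum fun n => p.measurable_potential σ i _ ht ((hX.measurable n).comp hw))

/-- The points of a tier `q` cluster process as serving candidates. -/
lemma Params.lintegral_tsum_weight (hX : IsPPP (p.lamP p.q) X μ) (σ : Bool) (i : K₁ ⊕ K₂) (z : Plane) :
    ∫⁻ ω, ∑' n, ENNReal.ofReal (p.mbar p.q) * ∫⁻ v, p.weight σ i
      (Measure.dirac z + pointMeasure fun n => X n ω) (p.meanPow (.inl p.q) (X n ω + v)) ∂(densityLaw (p.g p.q)) ∂μ =
    ENNReal.ofReal (p.mbar p.q) * ∫⁻ v, (ENNReal.ofReal (p.lamP p.q) * ∫⁻ y,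
      expNeg (p.potential σ i (p.meanPow (.inl p.q) (y + v)) (.inl p.q) y) *
        p.base σ i z (p.meanPow (.inl p.q) (y + v))) ∂(densityLaw (p.g p.q)) := by
  have hm n : Measurable fun b : Ω × Plane => p.weight σ i
      (Measure.dirac z + pointMeasure fun n => X n b.1) (p.meanPow (.inl p.q) (X n b.1 + b.2)) :=
    p.measurable_weight_pointMeasure hX σ i z measurable_fst
      ((p.measurable_meanPow _).comp (((hX.measurable n).comp measurable_fst).add measurable_snd))
  have hs : Measurable fun b : Ω × Plane => ∑' n, p.weight σ i
      (Measure.dirac z + pointMeasure fun n => X n b.1) (p.meanPow (.inl p.q) (X n b.1 + b.2)) := Measurable.tsum hm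
  have h1 ω : ∑' n, ENNReal.ofReal (p.mbar p.q) * ∫⁻ v, p.weight σ i
      (Measure.dirac z + pointMeasure fun n => X n ω) (p.meanPow (.inl p.q) (X n ω + v)) ∂(densityLaw (p.g p.q)) =
      ENNReal.ofReal (p.mbar p.q) * ∫⁻ v, ∑' n, p.weight σ i
      (Measure.dirac z + pointMeasure fun n => X n ω) (p.meanPow (.inl p.q) (X n ω + v)) ∂(densityLaw (p.g p.q)) := by
    rw [ENNReal.tsum_mul_left]
    exact congrArg _ (lintegral_tsum fun n => ((hm n).comp measurable_prodMk_left).aemeasurable).symm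
  simp_rw [h1]
  rw [lintegral_const_mul _ (Measurable.lintegral_prod_right hs), lintegral_lintegral_swap hs.aemeasurable]
  congr 1
  refine lintegral_congr fun v => ?_
  have hT : Measurable fun y : Plane => p.meanPow (.inl p.q) (y + v) :=
    (p.measurable_meanPow _).comp (measurable_id.add_const v)
  set T : Plane → ℝ≥0∞ := fun y => p.meanPow (.inl p.q) (y + v) with hTd
  -- Collects what depends on the reference centre alone: the potential of its own cluster, the
  -- noise, the representative cluster and the tiers other than `q`.
  let g : Plane → ℝ≥0∞ := fun y => expNeg (p.potential σ i (T y) (.inl p.q) y) *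
    expNeg (p.noise σ i (T y) + (p.potential σ i (T y) (.inl p.q) z + ∑' a, p.void σ i (T y) (p.otherTier a)))
  have hg : Measurable g := (measurable_expNeg.comp (p.measurable_potential σ i _ hT measurable_id)).mul
    (measurable_expNeg.comp ((p.measurable_noise σ i hT).add ((p.measurable_potential σ i _ hT measurable_const).add
      (Measurable.tsum fun a => p.measurable_void σ i hT _))))
  have key := hX.lintegral_tsum_expNeg_erase hg (a := fun x y => p.potential σ i (T x) (.inl p.q) y)
    (p.measurable_potential σ i (.inl p.q) (t := fun b : Plane × Plane => T b.1) (hT.comp measurable_fst) measurable_snd)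
  refine Eq.trans (lintegral_congr fun ω => tsum_congr fun n => ?_) (key.trans ?_)
  -- The serving centre is split off the point measure: its potential joins `g`, and only the other
  -- centres remain in the sum.
  · rw [p.weight_dirac_add, pointMeasure_eq_add_erase _ n, lintegral_add_measure, lintegral_dirac,
      lintegral_pointMeasure, expNeg_add (p.potential σ i _ _ _)]
    simp only [g, hTd]
    ring
  · refine congrArg _ (lintegral_congr fun y => ?_)
    rw [p.base_eq]
    simp only [g, mul_assoc]
    rfl

omit [Countable K₁] [Countable K₂] in
lemma lintegral_lintegral_lintegral_swap {ν : Measure Plane} [SFinite ν] {G : Ω → Plane → Plane → ℝ≥0∞}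
    (hG : Measurable fun b : (Ω × Plane) × Plane => G b.1.1 b.1.2 b.2) (c d : ℝ≥0∞) :
    ∫⁻ ω, c * ∫⁻ v, (d * ∫⁻ y, G ω v y) ∂ν ∂μ = c * ∫⁻ v, (d * ∫⁻ y, ∫⁻ ω, G ω v y ∂μ) ∂ν := by
  have h1 : Measurable fun b : Ω × Plane => d * ∫⁻ y, G b.1 b.2 y :=
    (Measurable.lintegral_prod_right (f := fun (b : Ω × Plane) y => G b.1 b.2 y) hG).const_mul d
  have h2 (v : Plane) : Measurable fun b : Ω × Plane => G b.1 v b.2 :=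
    hG.comp ((measurable_fst.prodMk measurable_const).prodMk measurable_snd)
  refine (lintegral_const_mul _ (Measurable.lintegral_prod_right h1)).trans (congrArg _ ?_)
  refine (lintegral_lintegral_swap h1.aemeasurable).trans (lintegral_congr fun v => ?_)
  refine (lintegral_const_mul _ (Measurable.lintegral_prod_right (h2 v))).trans (congrArg _ ?_)
  exact lintegral_lintegral_swap (h2 v).aemeasurable

lemma Params.lintegral_tierMean_cluster (hX : IsPPP (p.lamP p.q) X μ) (σ : Bool) (i : K₁ ⊕ K₂) (z : Plane) (k : K₁) :
    ∫⁻ ω, ENNReal.ofReal (p.mbar k) * ∫⁻ v, (ENNReal.ofReal (p.lamP k) * ∫⁻ y,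
      expNeg (p.potential σ i (p.meanPow (.inl k) (y + v)) (.inl k) y) *
        p.weight σ i (Measure.dirac z + pointMeasure fun n => X n ω) (p.meanPow (.inl k) (y + v)))
        ∂(densityLaw (p.g k)) ∂μ =
    ENNReal.ofReal (p.mbar k) * ∫⁻ v, (ENNReal.ofReal (p.lamP k) * ∫⁻ y,
      expNeg (p.potential σ i (p.meanPow (.inl k) (y + v)) (.inl k) y) *
        p.base σ i z (p.meanPow (.inl k) (y + v))) ∂(densityLaw (p.g k)) := by
  have ht : Measurable fun b : (Ω × Plane) × Plane => p.meanPow (.inl k) (b.2 + b.1.2) :=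
    (p.measurable_meanPow _).comp (by fun_prop)
  have hm := (measurable_expNeg.comp (p.measurable_potential σ i (.inl k) ht measurable_snd)).mul
    (p.measurable_weight_pointMeasure hX σ i z (measurable_fst.comp measurable_fst) ht)
  refine (lintegral_lintegral_lintegral_swap hm _ _).trans (congrArg _ (lintegral_congr fun v =>
    congrArg _ (lintegral_congr fun y => ?_)))
  rw [← p.lintegral_weight hX]
  exact lintegral_const_mul _ (p.measurable_weight_pointMeasure hX σ _ z measurable_id measurable_const)

lemma Params.lintegral_tierMean (hX : IsPPP (p.lamP p.q) X μ) (σ : Bool) (i : K₁ ⊕ K₂) (z : Plane) :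
    ∫⁻ ω, p.tierMean σ i (Measure.dirac z + pointMeasure fun n => X n ω) ∂μ = p.typicalMean σ i z := by
  classical
  have hw {α : Type _} [MeasurableSpace α] {w : α → Ω} (hw : Measurable w) {t : α → ℝ≥0∞} (ht : Measurable t) :=
    p.measurable_weight_pointMeasure hX σ i z hw ht
  rcases i with k | k
  · by_cases hk : k = p.q
    · subst hk
      unfold Params.tierMean Params.typicalMean
      simp only [if_true]
      have hm : Measurable fun b : Ω × Plane => p.weight σ (.inl p.q)
          (Measure.dirac z + pointMeasure fun n => X n b.1) (p.meanPow (.inl p.q) (z + b.2)) :=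
        hw measurable_fst ((p.measurable_meanPow _).comp (measurable_snd.const_add z))
      simp_rw [lintegral_add_measure, lintegral_dirac, lintegral_pointMeasure]
      rw [lintegral_add_left ((Measurable.lintegral_prod_right hm).const_mul _), p.lintegral_tsum_weight hX,
        lintegral_const_mul _ (Measurable.lintegral_prod_right hm), lintegral_lintegral_swap hm.aemeasurable]
      simp_rw [p.lintegral_weight hX]
    · unfold Params.tierMean Params.typicalMean
      simp only [hk, if_false, zero_add]
      exact p.lintegral_tierMean_cluster hX σ _ z k
  · have hm : Measurable fun b : Ω × Plane => p.weight σ (.inr k)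
        (Measure.dirac z + pointMeasure fun n => X n b.1) (p.meanPow (.inr k) b.2) :=
      hw measurable_fst ((p.measurable_meanPow _).comp measurable_snd)
    refine (lintegral_const_mul _ (Measurable.lintegral_prod_right hm)).trans (congrArg _ ?_)
    refine (lintegral_lintegral_swap hm.aemeasurable).trans (lintegral_congr fun x => ?_)
    exact p.lintegral_weight hX σ _ z _

lemma pointMeasure_map {ι : Type*} (x : ι → Plane) {f : Plane → Plane} (hf : Measurable f) :
    (pointMeasure x).map f = pointMeasure fun i => f (x i) := by
  ext A hA
  rw [Measure.map_apply hf hA, pointMeasure_apply _ (hf hA), pointMeasure_apply _ hA]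
  rfl

/-- Mecke formula for the users with a given displacement: each sees the centre of its own
cluster and an independent copy of the other clusters. -/
lemma Params.lintegral_tsum_tierMean (hX : IsPPP (p.lamP p.q) X μ) (σ : Bool) (i : K₁ ⊕ K₂) (u : Plane)
    {B : Set Plane} (hB : MeasurableSet B) :
    ∫⁻ ω, ∑' n, B.indicator 1 (X n ω + u) * p.tierMean σ i (pointMeasure fun m => X m ω - (X n ω + u)) ∂μ =
      ENNReal.ofReal (p.lamP p.q) * (volume B * p.typicalMean σ i (-u)) := by
  have hF : Measurable (Function.uncurry fun (x : Plane) (ζ : Measure Plane) => B.indicator (1 : Plane → ℝ≥0∞) (x + u) *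
      p.tierMean σ i (Measure.dirac (-u) + (locFin ζ).map fun y => y - (x + u))) := by
    refine Measurable.mul ((measurable_one.indicator hB).comp (measurable_fst.add_const u)) ?_
    exact p.measurable_tierMean σ i (-u) (measurable_fst.add_const u) measurable_snd
  refine Eq.trans (lintegral_congr_ae ?_) ((hX.lintegral_tsum_erase hF).trans (congrArg _ ?_))
  · filter_upwards [hX.ae_locFin] with ω hω
    refine tsum_congr fun n => ?_
    -- Seen from the user at `X n + u`, the centre of its own cluster lies at `-u`.
    rw [hω.2 n, pointMeasure_map _ (measurable_plane_sub _), pointMeasure_eq_add_erase _ n]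
    congr 3
    simp
  -- Seen from `x + u`, the process has the same law as before, so the average does not depend on
  -- `x`; integrating the indicator leaves the area of `B`.
  · have h1 (x : Plane) : ∫⁻ ω, B.indicator (1 : Plane → ℝ≥0∞) (x + u) * p.tierMean σ i (Measure.dirac (-u) +
        (locFin (pointMeasure fun n => X n ω)).map fun y => y - (x + u)) ∂μ =
        B.indicator (1 : Plane → ℝ≥0∞) (x + u) * p.typicalMean σ i (-u) := by
      rw [lintegral_const_mul _ (p.measurable_tierMean σ i (-u) measurable_const hX.measurable_pointMeasure),
        ← p.lintegral_tierMean (hX.sub_const (x + u))]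
      congr 1
      refine lintegral_congr_ae ?_
      filter_upwards [hX.ae_locFin] with ω hω
      rw [hω.1, pointMeasure_map _ (measurable_plane_sub _)]
    simp_rw [h1]
    have hi : Measurable fun x : Plane => B.indicator (1 : Plane → ℝ≥0∞) (x + u) :=
      (measurable_one.indicator hB).comp (measurable_id.add_const u)
    rw [lintegral_mul_const _ hi, lintegral_add_right_eq_self (fun x => B.indicator (1 : Plane → ℝ≥0∞) x) u,
      lintegral_indicator_one hB]

end TypicalMean

/-! ### Common labels for the original and the modified network -/

section Labels

variable {K₁ K₂ Ω I : Type*} (p : Params K₁ K₂) (D : Data K₁ K₂ Ω)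

/-- Base station labels, when the clusters of tier `q` are labelled by `I`; the label `none`
stands for the representative cluster. -/
def Params.label (ι : I → Option ℕ) : ((I ⊕ ({k : K₁ // k ≠ p.q} × ℕ)) × ℕ) ⊕ (K₂ × ℕ) → BS K₁ K₂
  | .inl (.inl c, l) => (ι c).elim (.representative l) fun n => .clustered p.q n l
  | .inl (.inr (k, n), l) => .clustered k n l
  | .inr (k, n) => .poisson k n

lemma Params.label_injective {ι : I → Option ℕ} (hι : ι.Injective) : (p.label ι).Injective := by
  rintro (⟨c | ⟨⟨k, hk⟩, n⟩, l⟩ | ⟨k, n⟩) (⟨c' | ⟨⟨k', hk'⟩, n'⟩, l'⟩ | ⟨k', n'⟩) h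
  · rcases hc : ι c with _ | n <;> rcases hc' : ι c' with _ | n' <;>
      simp only [Params.label, hc, hc', Option.elim_none, Option.elim_some, reduceCtorEq,
        BS.representative.injEq, BS.clustered.injEq, true_and] at h
    · rw [h, hι (hc.trans hc'.symm)]
    · rw [h.2, hι (hc.trans (h.1 ▸ hc'.symm))]
  · rcases hc : ι c with _ | n <;> simp [Params.label, hc] at h
    exact (hk' h.1.symm).elim
  · rcases hc : ι c with _ | n <;> simp [Params.label, hc] at h
  · rcases hc : ι c' with _ | n <;> simp [Params.label, hc] at h
    exact (hk h.1).elim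
  · simp [Params.label] at h
    simp [h]
  · simp [Params.label] at h
  · rcases hc : ι c' with _ | n <;> simp [Params.label, hc] at h
  · simp [Params.label] at h
  · simp [Params.label] at h
    simp [h]

lemma Params.clustered_mem_range_label {ι : I → Option ℕ} (hι : ∀ n, ∃ c, ι c = some n) (k : K₁) (n l : ℕ) :
    .clustered k n l ∈ Set.range (p.label ι) := by
  by_cases hk : k = p.q
  · obtain ⟨c, hc⟩ := hι n
    exact ⟨.inl (.inl c, l), by simp [Params.label, hc, hk]⟩
  · exact ⟨.inl (.inr (⟨k, hk⟩, n), l), rfl⟩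

lemma Params.poisson_mem_range_label (ι : I → Option ℕ) (k : K₂) (n : ℕ) :
    .poisson k n ∈ Set.range (p.label ι) := ⟨.inr (k, n), rfl⟩

/-- Sizes of the clusters. -/
def Data.netSize (ι : I → Option ℕ) : I ⊕ ({k : K₁ // k ≠ p.q} × ℕ) → Ω → ℕ :=
  Sum.elim (fun c => (ι c).elim D.repSize fun n => D.size p.q n) fun c => D.size c.1 c.2

/-- Displacements of the points of the clusters. -/
def Data.netDisp (ι : I → Option ℕ) : I ⊕ ({k : K₁ // k ≠ p.q} × ℕ) → ℕ → Ω → Plane :=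
  Sum.elim (fun c => (ι c).elim D.repDisp fun n => D.disp p.q n) fun c => D.disp c.1 c.2

/-- Fading of the links to a user, where `none` is the typical user at the origin. -/
def Data.netFade (ι : I → Option ℕ) (u : Option (ℕ × ℕ)) (b : ((I ⊕ ({k : K₁ // k ≠ p.q} × ℕ)) × ℕ) ⊕ (K₂ × ℕ)) :
    Ω → ℝ := u.elim (D.fade (p.label ι b)) fun u => D.linkFade u (p.label ι b)

/-- The sources of randomness of the marks of the network that a user sees. -/
def Params.markSource (ι : I → Option ℕ) (u : Option (ℕ × ℕ)) :
    (I ⊕ ({k : K₁ // k ≠ p.q} × ℕ)) ⊕ ((I ⊕ ({k : K₁ // k ≠ p.q} × ℕ)) × ℕ) ⊕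
      (((I ⊕ ({k : K₁ // k ≠ p.q} × ℕ)) × ℕ) ⊕ (K₂ × ℕ)) → Source K₁ K₂
  | .inl (.inl c) => (ι c).elim .repSize fun n => .size p.q n
  | .inl (.inr (k, n)) => .size k n
  | .inr (.inl (.inl c, l)) => (ι c).elim (.repDisp l) fun n => .disp p.q n l
  | .inr (.inl (.inr (k, n), l)) => .disp k n l
  | .inr (.inr b) => u.elim (.fade (p.label ι b)) fun u => .linkFade u (p.label ι b)

lemma Params.markSource_size_injective {ι : I → Option ℕ} (hι : ι.Injective) (u : Option (ℕ × ℕ)) {c c'}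
    (h : p.markSource ι u (.inl c) = p.markSource ι u (.inl c')) : c = c' := by
  rcases c with c | ⟨⟨k, hk⟩, n⟩ <;> rcases c' with c' | ⟨⟨k', hk'⟩, n'⟩
  · rcases hc : ι c with _ | n <;> rcases hc' : ι c' with _ | n' <;>
      simp only [Params.markSource, hc, hc', Option.elim_none, Option.elim_some, reduceCtorEq,
        Source.size.injEq, true_and] at h
    · rw [hι (hc.trans hc'.symm)]
    · rw [hι (hc.trans (h ▸ hc'.symm))]
  · rcases hc : ι c with _ | n <;> simp [Params.markSource, hc] at h
    exact (hk' h.1.symm).elim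
  · rcases hc : ι c' with _ | n <;> simp [Params.markSource, hc] at h
    exact (hk h.1).elim
  · simp [Params.markSource] at h
    simp [h]

lemma Params.markSource_disp_injective {ι : I → Option ℕ} (hι : ι.Injective) (u : Option (ℕ × ℕ)) {b b'}
    (h : p.markSource ι u (.inr (.inl b)) = p.markSource ι u (.inr (.inl b'))) : b = b' := by
  rcases b with ⟨c | ⟨⟨k, hk⟩, n⟩, l⟩ <;> rcases b' with ⟨c' | ⟨⟨k', hk'⟩, n'⟩, l'⟩
  · rcases hc : ι c with _ | n <;> rcases hc' : ι c' with _ | n' <;>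
      simp only [Params.markSource, hc, hc', Option.elim_none, Option.elim_some, reduceCtorEq,
        Source.repDisp.injEq, Source.disp.injEq, true_and] at h
    · rw [h, hι (hc.trans hc'.symm)]
    · rw [h.2, hι (hc.trans (h.1 ▸ hc'.symm))]
  · rcases hc : ι c with _ | n <;> simp [Params.markSource, hc] at h
    exact (hk' h.1.symm).elim
  · rcases hc : ι c' with _ | n <;> simp [Params.markSource, hc] at h
    exact (hk h.1).elim
  · simp [Params.markSource] at h
    simp [h]

/-- Type of a source of randomness: centres and points, cluster sizes, displacements, fading, or
users. -/
def Source.group : Source K₁ K₂ → ℕ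
  | .parents _ | .points _ | .z₀ => 0
  | .size _ _ | .repSize => 1
  | .disp _ _ _ | .repDisp _ => 2
  | .linkFade _ _ | .fade _ => 3
  | .userSize _ | .userDisp _ _ => 4

lemma Params.group_markSource_size (ι : I → Option ℕ) (u : Option (ℕ × ℕ)) (c) :
    (p.markSource ι u (.inl c)).group = 1 := by
  rcases c with c | c
  · rcases hc : ι c with _ | n <;> simp [Params.markSource, hc, Source.group]
  · rfl

lemma Params.group_markSource_disp (ι : I → Option ℕ) (u : Option (ℕ × ℕ)) (b) :
    (p.markSource ι u (.inr (.inl b))).group = 2 := by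
  rcases b with ⟨c | c, l⟩
  · rcases hc : ι c with _ | n <;> simp [Params.markSource, hc, Source.group]
  · rfl

lemma Params.group_markSource_fade (ι : I → Option ℕ) (u : Option (ℕ × ℕ)) (b) :
    (p.markSource ι u (.inr (.inr b))).group = 3 := by
  rcases u with _ | u <;> rfl

lemma Params.group_markSource (ι : I → Option ℕ) (u : Option (ℕ × ℕ)) (a) :
    (p.markSource ι u a).group ∈ ({1, 2, 3} : Set ℕ) := by
  rcases a with c | b | b
  · simp [p.group_markSource_size]
  · simp [p.group_markSource_disp]
  · simp [p.group_markSource_fade]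

/-- Distinct marks must use distinct sources in order to inherit independence. `Source.group`
separates sizes, displacements and fading, so only marks of one kind have to be compared. -/
lemma Params.markSource_injective {ι : I → Option ℕ} (hι : ι.Injective) (u : Option (ℕ × ℕ)) :
    (p.markSource ι u).Injective := by
  rintro (c | b | b) (c' | b' | b') h
  · rw [p.markSource_size_injective hι u h]
  · simpa [p.group_markSource_size, p.group_markSource_disp] using congrArg Source.group h
  · simpa [p.group_markSource_size, p.group_markSource_fade] using congrArg Source.group h
  · simpa [p.group_markSource_size, p.group_markSource_disp] using congrArg Source.group h
  · rw [p.markSource_disp_injective hι u h]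
  · simpa [p.group_markSource_disp, p.group_markSource_fade] using congrArg Source.group h
  · simpa [p.group_markSource_size, p.group_markSource_fade] using congrArg Source.group h
  · simpa [p.group_markSource_disp, p.group_markSource_fade] using congrArg Source.group h
  · rcases u with _ | u <;> simp only [Params.markSource, Option.elim_none, Option.elim_some,
      Source.fade.injEq, Source.linkFade.injEq, true_and] at h <;> rw [p.label_injective hι h]

/-- Presents the marks as a reindexing of the sources of the model, so that their joint independence
is a restriction of that of `D.sigma`. -/
lemma Data.markSigma_eq (ι : I → Option ℕ) (u : Option (ℕ × ℕ)) :
    markSigma (D.netSize p ι) (D.netDisp p ι) (D.netFade p ι u) = D.sigma ∘ p.markSource ι u := by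
  funext a
  rcases a with (c | c) | ⟨⟨c | c, l⟩⟩ | b
  · rcases hc : ι c with _ | n <;> simp [markSigma, Data.netSize, Params.markSource, hc, Data.sigma]
  · rfl
  · rcases hc : ι c with _ | n <;> simp [markSigma, Data.netDisp, Params.markSource, hc, Data.sigma]
  · rfl
  · rcases u with _ | u <;> rfl

end Labels

/-! ### Marks, centres and points of the model -/

section Model

variable {K₁ K₂ Ω I : Type*} {p : Params K₁ K₂} {D : Data K₁ K₂ Ω}

/-- Cluster centres and points of the tiers other than `q`. -/
def Data.other (p : Params K₁ K₂) (D : Data K₁ K₂ Ω) : p.Other → ℕ → Ω → Plane :=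
  Sum.elim (fun k => D.parent k) D.point

/-- Sources of randomness of the cluster centres and points of the tiers other than `q`. -/
def Params.otherSource (p : Params K₁ K₂) : p.Other → Source K₁ K₂ := Sum.elim (fun k => .parents k) .points

lemma Params.otherSource_injective (p : Params K₁ K₂) : p.otherSource.Injective := by
  rintro (⟨k, hk⟩ | k) (⟨k', hk'⟩ | k') h <;> simp_all [Params.otherSource]

lemma Data.measurable_other_of_mem {T : Set (Source K₁ K₂)} (hT : Set.range p.otherSource ⊆ T) :
    Measurable[⨆ a ∈ T, D.sigma a] fun ω a n => D.other p a n ω := by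
  refine @measurable_pi_lambda _ _ _ (_) _ _ fun a => ?_
  have h1 : Measurable[D.sigma (p.otherSource a)] fun ω n => D.other p a n ω := by
    rcases a with k | k <;> exact comap_measurable _
  exact h1.mono (le_iSup₂_of_le _ (hT ⟨a, rfl⟩) le_rfl) le_rfl

lemma Data.measurable_marks_of_mem {ι : I → Option ℕ} {u : Option (ℕ × ℕ)} {T : Set (Source K₁ K₂)}
    (hT : Set.range (p.markSource ι u) ⊆ T) :
    Measurable[⨆ a ∈ T, D.sigma a] fun ω => (fun c => D.netSize p ι c ω, fun c l => D.netDisp p ι c l ω,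
      fun b => D.netFade p ι u b ω) := by
  have hle : (⨆ a ∈ Set.univ, markSigma (D.netSize p ι) (D.netDisp p ι) (D.netFade p ι u) a) ≤ ⨆ a ∈ T, D.sigma a := by
    refine iSup₂_le fun a _ => ?_
    rw [D.markSigma_eq]
    exact le_iSup₂_of_le (p.markSource ι u a) (hT ⟨a, rfl⟩) le_rfl
  refine Measurable.mono ?_ hle le_rfl
  refine Measurable.prodMk ?_ (Measurable.prodMk ?_ ?_)
  · exact @measurable_pi_lambda _ _ _ (_) _ _ fun c => measurable_size_of_mem (Set.mem_univ _)
  · exact @measurable_pi_lambda _ _ _ (_) _ _ fun c =>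
      @measurable_pi_lambda _ _ _ (_) _ _ fun l => measurable_disp_of_mem (Set.mem_univ _)
  · exact @measurable_pi_lambda _ _ _ (_) _ _ fun b => measurable_fade_of_mem (Set.mem_univ _)

variable [mΩ : MeasurableSpace Ω] {μ : Measure Ω}

lemma IsModel.sigma_le (hD : IsModel p D μ) (a : Source K₁ K₂) : D.sigma a ≤ mΩ := by
  cases a
  · exact (measurable_pi_lambda _ (hD.parent_ppp _).measurable).comap_le
  · exact (hD.size_measurable _ _).comap_le
  · exact (hD.disp_measurable _ _ _).comap_le
  · exact (measurable_pi_lambda _ (hD.point_ppp _).measurable).comap_le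
  · exact (hD.userSize_measurable _).comap_le
  · exact (hD.userDisp_measurable _ _).comap_le
  · exact (hD.linkFade_measurable _ _).comap_le
  · exact hD.z₀_measurable.comap_le
  · exact hD.repSize_measurable.comap_le
  · exact (hD.repDisp_measurable _).comap_le
  · exact (hD.fade_measurable _).comap_le

lemma IsModel.iSup_le (hD : IsModel p D μ) (T : Set (Source K₁ K₂)) : ⨆ a ∈ T, D.sigma a ≤ mΩ :=
  iSup₂_le fun a _ => hD.sigma_le a

lemma IsModel.indepFun (hD : IsModel p D μ) {α β : Type*} [MeasurableSpace α] [MeasurableSpace β]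
    {T T' : Set (Source K₁ K₂)} (hT : Disjoint T T') {X : Ω → α} {Y : Ω → β}
    (hX : Measurable[⨆ a ∈ T, D.sigma a] X) (hY : Measurable[⨆ a ∈ T', D.sigma a] Y) : IndepFun X Y μ :=
  indep_of_indep_of_le_left (indep_of_indep_of_le_right (indep_iSup_of_disjoint hD.sigma_le hD.indep hT)
    hY.comap_le) hX.comap_le

lemma IsModel.other_ppp (hD : IsModel p D μ) (a : p.Other) :
    IsPPP (p.intensity (p.otherTier a)) (D.other p a) μ := by
  rcases a with k | k
  · exact hD.parent_ppp k
  · exact hD.point_ppp k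

lemma IsModel.iIndepFun_other (hD : IsModel p D μ) : iIndepFun (fun a ω n => D.other p a n ω) μ := by
  have h1 := hD.indep.precomp p.otherSource_injective
  have h2 : D.sigma ∘ p.otherSource = fun a => MeasurableSpace.comap (fun ω n => D.other p a n ω) inferInstance := by
    funext a
    rcases a with k | k <;> rfl
  rw [h2] at h1
  exact h1

/-- With `ι = some` these are the marks of the original network, with `ι = id` on `Option ℕ` those
of the network with the representative cluster. The laws agree because that cluster is distributed
like the other clusters of tier `q`. -/
lemma IsModel.isMarks (hD : IsModel p D μ) {ι : I → Option ℕ} (hι : ι.Injective) (u : Option (ℕ × ℕ)) :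
    IsMarks p (p.netKind I) (D.netSize p ι) (D.netDisp p ι) (D.netFade p ι u) μ where
  size_measurable c := by
    rcases c with c | c
    · rcases hc : ι c with _ | n <;> simp only [Data.netSize, Sum.elim_inl, hc, Option.elim_none, Option.elim_some]
      exacts [hD.repSize_measurable, hD.size_measurable _ _]
    · exact hD.size_measurable _ _
  size_law c := by
    rcases c with c | c
    · rcases hc : ι c with _ | n <;> simp only [Data.netSize, Sum.elim_inl, hc, Option.elim_none, Option.elim_some]
      exacts [hD.repSize_law, hD.size_law _ _]
    · exact hD.size_law _ _
  disp_measurable c l := by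
    rcases c with c | c
    · rcases hc : ι c with _ | n <;> simp only [Data.netDisp, Sum.elim_inl, hc, Option.elim_none, Option.elim_some]
      exacts [hD.repDisp_measurable _, hD.disp_measurable _ _ _]
    · exact hD.disp_measurable _ _ _
  disp_law c l := by
    rcases c with c | c
    · rcases hc : ι c with _ | n <;> simp only [Data.netDisp, Sum.elim_inl, hc, Option.elim_none, Option.elim_some]
      exacts [hD.repDisp_law _, hD.disp_law _ _ _]
    · exact hD.disp_law _ _ _
  fade_measurable b := by
    rcases u with _ | u
    exacts [hD.fade_measurable _, hD.linkFade_measurable _ _]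
  fade_law b := by
    rcases u with _ | u
    exacts [hD.fade_law _, hD.linkFade_law _ _]
  indep := by
    rw [D.markSigma_eq]
    exact hD.indep.precomp (p.markSource_injective hι u)

end Model

/-! ### Good counts of the two kinds of views -/

section Count

variable {K₁ K₂ Ω I : Type*} {p : Params K₁ K₂} {D : Data K₁ K₂ Ω}

/-- Cluster sizes, displacements and fading variables. -/
abbrev Params.Marks (p : Params K₁ K₂) (I : Type*) : Type _ :=
  (I ⊕ ({k : K₁ // k ≠ p.q} × ℕ) → ℕ) × (I ⊕ ({k : K₁ // k ≠ p.q} × ℕ) → ℕ → Plane) ×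
    (((I ⊕ ({k : K₁ // k ≠ p.q} × ℕ)) × ℕ) ⊕ (K₂ × ℕ) → ℝ)

/-- The marks of the network that a user sees. -/
def Data.marks (p : Params K₁ K₂) (D : Data K₁ K₂ Ω) (ι : I → Option ℕ) (u : Option (ℕ × ℕ)) (ω : Ω) : p.Marks I :=
  (fun c => D.netSize p ι c ω, fun c l => D.netDisp p ι c l ω, fun b => D.netFade p ι u b ω)

/-- `goodCount` as a function of the centres, points and marks. -/
def Params.netCount (p : Params K₁ K₂) (σ : Bool) (i : K₁ ⊕ K₂) (x : I → Plane) (z : p.Other → ℕ → Plane)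
    (m : p.Marks I) : ℝ≥0∞ :=
  p.goodCount σ (netTier (p.netKind I) Prod.fst) (netPresent m.1) (netPos (p.centres x z) (p.points z) m.2.1) m.2.2 i

/-- All labels are reached: `none` is the representative cluster with centre `z₀`, an additional
centre of tier `q`. -/
lemma Data.goodCount_typicalView (D : Data K₁ K₂ Ω) (σ : Bool) (i : K₁ ⊕ K₂) (ω : Ω) :
    (D.typicalView ω).goodCount p σ i = p.netCount σ i
      (fun c : Option ℕ => c.elim (D.z₀ ω) fun n => D.parent p.q n ω) (fun a n => D.other p a n ω)
      (D.marks p id none ω) := by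
  unfold View.goodCount
  rw [← p.goodCount_comp σ i (p.label_injective Function.injective_id)]
  · unfold Params.netCount
    congr 1
    · funext b
      rcases b with ⟨c | c, l⟩ | j
      · rcases c with _ | n <;> rfl
      · rfl
      · rfl
    · funext b
      rcases b with ⟨c | c, l⟩ | j
      · rcases c with _ | n <;> rfl
      · rfl
      · rfl
    · funext b
      rcases b with ⟨c | c, l⟩ | j
      · rcases c with _ | n <;> exact sub_zero _
      · exact sub_zero _
      · exact sub_zero _
  · intro b _
    rcases b with ⟨k, n, l⟩ | l | ⟨k, n⟩
    · exact p.clustered_mem_range_label (fun n => ⟨some n, rfl⟩) k n l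
    · exact ⟨.inl (.inl none, l), rfl⟩
    · exact p.poisson_mem_range_label _ k n

/-- Moving the user to the origin shifts centres and points alike and leaves displacements
unchanged. The labels of the representative cluster are not reached, but they are absent from this
view. -/
lemma Data.goodCount_userView (D : Data K₁ K₂ Ω) (σ : Bool) (i : K₁ ⊕ K₂) (u : ℕ × ℕ) (ω : Ω) :
    (D.userView p u ω).goodCount p σ i = p.netCount σ i
      (fun n => D.parent p.q n ω - D.userPos p u ω) (fun a n => D.other p a n ω - D.userPos p u ω)
      (D.marks p some (some u) ω) := by
  unfold View.goodCount
  rw [← p.goodCount_comp σ i (p.label_injective (Option.some_injective ℕ))]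
  · unfold Params.netCount
    congr 1
    · funext b
      rcases b with ⟨c | c, l⟩ | j <;> rfl
    · funext b
      rcases b with ⟨c | c, l⟩ | j <;> rfl
    · funext b
      rcases b with ⟨c | c, l⟩ | j
      · exact add_sub_right_comm _ _ _
      · exact add_sub_right_comm _ _ _
      · rfl
  · intro b hb
    rcases b with ⟨k, n, l⟩ | l | ⟨k, n⟩
    · exact p.clustered_mem_range_label (fun n => ⟨n, rfl⟩) k n l
    · exact hb.elim
    · exact p.poisson_mem_range_label _ k n

variable [Countable K₁] [Countable K₂] [Countable I]

lemma Params.measurable_netCount (p : Params K₁ K₂) {α : Type*} [MeasurableSpace α] (σ : Bool) (i : K₁ ⊕ K₂)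
    {x : α → I → Plane} {z : α → p.Other → ℕ → Plane} {m : α → p.Marks I} (hx : Measurable x) (hz : Measurable z)
    (hm : Measurable m) : Measurable fun a => p.netCount σ i (x a) (z a) (m a) := by
  refine measurable_goodCount p _ _ σ (measurable_fst.comp hm) ?_ ?_
    (measurable_fst.comp (measurable_snd.comp hm)) (measurable_snd.comp (measurable_snd.comp hm)) i
  · refine measurable_pi_lambda _ fun c => ?_
    rcases c with c | c
    · exact (measurable_pi_apply c).comp hx
    · exact (measurable_pi_apply c.2).comp ((measurable_pi_apply (Sum.inl c.1 : p.Other)).comp hz)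
  · exact measurable_pi_lambda _ fun j =>
      (measurable_pi_apply j.2).comp ((measurable_pi_apply (Sum.inr j.1 : p.Other)).comp hz)

variable [mΩ : MeasurableSpace Ω] {μ : Measure Ω} [IsProbabilityMeasure μ]

omit [Countable K₁] [Countable K₂] [Countable I] [IsProbabilityMeasure μ] in
lemma IsModel.measurable_marks (hD : IsModel p D μ) (ι : I → Option ℕ) (u : Option (ℕ × ℕ)) :
    Measurable (D.marks p ι u) :=
  (Data.measurable_marks_of_mem (T := Set.univ) (Set.subset_univ _)).mono (hD.iSup_le _) le_rfl

omit [Countable K₁] [Countable K₂] [IsProbabilityMeasure μ] in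
lemma IsModel.measurable_other (hD : IsModel p D μ) : Measurable fun ω a n => D.other p a n ω :=
  (Data.measurable_other_of_mem (T := Set.univ) (Set.subset_univ _)).mono (hD.iSup_le _) le_rfl

omit [Countable K₁] [Countable K₂] [IsProbabilityMeasure μ] in
lemma IsModel.measurable_parent (hD : IsModel p D μ) (k : K₁) : Measurable fun ω n => D.parent k n ω :=
  measurable_pi_lambda _ (hD.parent_ppp k).measurable

omit [Countable K₁] [Countable K₂] [IsProbabilityMeasure μ] [Countable I] mΩ in
lemma Params.range_markSource_subset (p : Params K₁ K₂) (ι : I → Option ℕ) (u : Option (ℕ × ℕ)) {T : Set (Source K₁ K₂)}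
    (hT : ∀ a, a.group = 1 ∨ a.group = 2 ∨ a.group = 3 → a ∈ T) : Set.range (p.markSource ι u) ⊆ T := by
  rintro _ ⟨a, rfl⟩
  exact hT _ (by simpa using p.group_markSource ι u a)

omit [Countable K₁] [Countable K₂] [IsProbabilityMeasure μ] mΩ in
lemma Params.range_otherSource_subset (p : Params K₁ K₂) {T : Set (Source K₁ K₂)}
    (hT : ∀ a, a.group = 0 → a ≠ .parents p.q → a ≠ .z₀ → a ∈ T) : Set.range p.otherSource ⊆ T := by
  rintro _ ⟨⟨k, hk⟩ | k, rfl⟩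
  · exact hT _ rfl (fun h => hk (Source.parents.inj h)) (by simp [Params.otherSource])
  · exact hT _ rfl (by simp [Params.otherSource]) (by simp [Params.otherSource])

/-- A deterministic shift `o` preserves the laws and the independence of the tiers other than `q`,
so the mean is the same from every fixed location. -/
lemma IsModel.lintegral_netCount (hD : IsModel p D μ) {ι : I → Option ℕ} (hι : ι.Injective) (u : Option (ℕ × ℕ))
    (σ : Bool) (i : K₁ ⊕ K₂) (x : I → Plane) (o : Plane) :
    ∫⁻ ω, p.netCount σ i x (fun a n => D.other p a n ω - o) (D.marks p ι u ω) ∂μ =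
      p.tierMean σ i (pointMeasure x) := by
  have hs : Measurable fun z : p.Other → ℕ → Plane => fun a n => z a n - o :=
    measurable_pi_lambda _ fun a => measurable_pi_lambda _ fun n =>
      (measurable_plane_sub o).comp ((measurable_pi_apply n).comp (measurable_pi_apply a))
  have hs' : Measurable fun z : ℕ → Plane => fun n => z n - o :=
    measurable_pi_lambda _ fun n => (measurable_plane_sub o).comp (measurable_pi_apply n)
  refine (hD.isMarks hι u).lintegral_goodCount_eq_tierMean x (Z := fun a n ω => D.other p a n ω - o)
    (fun a => (hD.other_ppp a).sub_const o) (hD.iIndepFun_other.comp (fun _ => fun z n => z n - o) fun _ => hs') ?_ σ i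
  have h1 : IndepFun (fun ω a n => D.other p a n ω) (D.marks p ι u) μ :=
    hD.indepFun (T := {a | a.group = 0}) (T' := {a | a.group = 0}ᶜ) disjoint_compl_right
      (Data.measurable_other_of_mem (p.range_otherSource_subset fun a h _ _ => h))
      (Data.measurable_marks_of_mem (p.range_markSource_subset ι u fun a h => by
        rcases h with h | h | h <;> simp [h]))
  exact h1.comp hs measurable_id

end Count

/-! ### Mean count of the typical user -/

section Means

variable {K₁ K₂ Ω : Type*} {p : Params K₁ K₂} {D : Data K₁ K₂ Ω} [Countable K₁] [Countable K₂]
  [mΩ : MeasurableSpace Ω] {μ : Measure Ω} [IsProbabilityMeasure μ]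

omit [Countable K₁] [Countable K₂] [IsProbabilityMeasure μ] mΩ in
lemma Data.measurable_parent_of_mem {T : Set (Source K₁ K₂)} {k : K₁} (hT : .parents k ∈ T) :
    Measurable[⨆ a ∈ T, D.sigma a] fun ω n => D.parent k n ω :=
  (comap_measurable (fun ω n => D.parent k n ω)).mono (le_iSup₂_of_le (f := fun a _ => D.sigma a) (.parents k) hT le_rfl) le_rfl

omit [Countable K₁] [Countable K₂] [IsProbabilityMeasure μ] in
lemma IsModel.indepFun_parent (hD : IsModel p D μ) {I : Type*} (ι : I → Option ℕ) (u : Option (ℕ × ℕ)) :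
    IndepFun (fun ω n => D.parent p.q n ω)
      (fun ω => ((fun a n => D.other p a n ω : p.Other → ℕ → Plane), D.marks p ι u ω)) μ := by
  have hm := Data.measurable_marks_of_mem (D := D) (T := {.parents p.q}ᶜ) (p.range_markSource_subset ι u fun a h => by
    rintro rfl; simp [Source.group] at h)
  have ho := Data.measurable_other_of_mem (D := D) (T := {.parents p.q}ᶜ)
    (p.range_otherSource_subset fun a _ h _ => h)
  have hx := Data.measurable_parent_of_mem (D := D) (k := p.q) (Set.mem_singleton _)
  have hd : Disjoint ({.parents p.q} : Set (Source K₁ K₂)) {.parents p.q}ᶜ := disjoint_compl_right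
  exact hD.indepFun hd hx (ho.prodMk hm)

omit [Countable K₁] [Countable K₂] [IsProbabilityMeasure μ] in
lemma IsModel.indepFun_z₀ (hD : IsModel p D μ) :
    IndepFun D.z₀ (fun ω => ((fun n => D.parent p.q n ω),
      (fun a n => D.other p a n ω : p.Other → ℕ → Plane), D.marks p (id : Option ℕ → Option ℕ) none ω)) μ := by
  have hm := Data.measurable_marks_of_mem (D := D) (T := {.z₀}ᶜ)
    (p.range_markSource_subset (id : Option ℕ → Option ℕ) none fun a h => by rintro rfl; simp [Source.group] at h)
  have ho := Data.measurable_other_of_mem (D := D) (T := {.z₀}ᶜ) (p.range_otherSource_subset fun a _ _ h => h)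
  have hx := Data.measurable_parent_of_mem (D := D) (k := p.q) (T := {.z₀}ᶜ) (by simp)
  have hz : Measurable[⨆ a ∈ ({.z₀} : Set (Source K₁ K₂)), D.sigma a] D.z₀ :=
    (comap_measurable D.z₀).mono (le_iSup₂_of_le (f := fun a _ => D.sigma a) .z₀ (Set.mem_singleton _) le_rfl) le_rfl
  have hd : Disjoint ({.z₀} : Set (Source K₁ K₂)) {.z₀}ᶜ := disjoint_compl_right
  exact hD.indepFun hd hz (hx.prodMk (ho.prodMk hm))

/-- The typical user. -/
lemma IsModel.lintegral_goodCount_typicalView (hD : IsModel p D μ) (σ : Bool) (i : K₁ ⊕ K₂) :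
    ∫⁻ ω, (D.typicalView ω).goodCount p σ i ∂μ = ∫⁻ u, p.typicalMean σ i (-u) ∂(densityLaw p.gU) := by
  simp_rw [D.goodCount_typicalView]
  let C : Plane → (ℕ → Plane) → Option ℕ → Plane := fun z x c => c.elim z x
  have hC {α : Type _} [MeasurableSpace α] {z : α → Plane} {x : α → ℕ → Plane} (hz : Measurable z) (hx : Measurable x) :
      Measurable fun a => C (z a) (x a) := by
    refine measurable_pi_lambda _ fun c => ?_
    rcases c with _ | n
    · exact hz
    · exact (measurable_pi_apply n).comp hx
  let Y : Ω → (ℕ → Plane) × (p.Other → ℕ → Plane) × p.Marks (Option ℕ) := fun ω =>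
    (fun n => D.parent p.q n ω, fun a n => D.other p a n ω, D.marks p id none ω)
  have hY : Measurable Y :=
    (hD.measurable_parent p.q).prodMk (hD.measurable_other.prodMk (hD.measurable_marks _ _))
  have hzY : IndepFun (fun ω => -D.z₀ ω) Y μ := hD.indepFun_z₀.comp measurable_neg measurable_id
  -- First `-z₀` is fixed at `u`, which puts the representative centre at `-u`; then the parents of
  -- tier `q` are fixed.
  have key := lintegral_of_indepFun_hasLaw hD.z₀_measurable.neg hD.z₀_law hY hzY
    (F := fun u y => p.netCount σ i (C (-u) y.1) y.2.1 y.2.2)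
    (p.measurable_netCount σ i (hC measurable_fst.neg (measurable_fst.comp measurable_snd))
      (measurable_fst.comp (measurable_snd.comp measurable_snd)) (measurable_snd.comp (measurable_snd.comp measurable_snd)))
  refine Eq.trans (lintegral_congr fun ω => ?_) (key.trans (lintegral_congr fun u => ?_))
  · simp only [Y, C, Pi.neg_apply, neg_neg]
  · have hPW := hD.indepFun_parent (id : Option ℕ → Option ℕ) none
    have key2 := lintegral_of_indepFun (hD.measurable_parent p.q)
      (hD.measurable_other.prodMk (hD.measurable_marks id none)) hPW
      (F := fun x w => p.netCount σ i (C (-u) x) w.1 w.2)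
      (p.measurable_netCount σ i (hC measurable_const measurable_fst) (measurable_fst.comp measurable_snd)
        (measurable_snd.comp measurable_snd))
    refine key2.trans ?_
    rw [← p.lintegral_tierMean (hD.parent_ppp p.q)]
    refine lintegral_congr fun ω => ?_
    have h1 := hD.lintegral_netCount (ι := (id : Option ℕ → Option ℕ)) Function.injective_id none σ i
      (C (-u) fun n => D.parent p.q n ω) 0
    simp only [sub_zero] at h1
    refine h1.trans (congrArg _ ?_)
    -- The point measure of a family indexed by `Option ℕ` is the atom of `none` plus the points of
    -- the process.
    ext A hA
    rw [pointMeasure_apply _ hA, Measure.add_apply, pointMeasure_apply _ hA, Measure.dirac_apply' _ hA,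
      ← (Equiv.optionEquivSumPUnit.{0} ℕ).symm.tsum_eq, ENNReal_tsum_sumType, add_comm]
    congr 1
    simp [C]

end Means

/-! ### Averages over the users of the original network -/

section Users

variable {K₁ K₂ Ω : Type*} {p : Params K₁ K₂} {D : Data K₁ K₂ Ω}
  [mΩ : MeasurableSpace Ω] {μ : Measure Ω}

/-- The parts of the network that do not belong to tier `q`, and the marks, as seen by a user. -/
def Data.rest (p : Params K₁ K₂) (D : Data K₁ K₂ Ω) (u : ℕ × ℕ) (ω : Ω) : (p.Other → ℕ → Plane) × p.Marks ℕ :=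
  (fun a n => D.other p a n ω, D.marks p some (some u) ω)

/-- The size of a user cluster is a source of its own, read neither by the base stations and fading
nor by the displacements of users. -/
lemma IsModel.indepFun_userSize (hD : IsModel p D μ) (n l : ℕ) (u : ℕ × ℕ) :
    IndepFun (D.userSize n) (fun ω => (D.userDisp n l ω, (fun m => D.parent p.q m ω), D.rest p u ω)) μ := by
  have hm := Data.measurable_marks_of_mem (D := D) (T := {.userSize n}ᶜ)
    (p.range_markSource_subset (some : ℕ → Option ℕ) (some u) fun a h => by rintro rfl; simp [Source.group] at h)
  have ho := Data.measurable_other_of_mem (D := D) (T := {.userSize n}ᶜ)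
    (p.range_otherSource_subset fun a h0 _ h => by rintro rfl; simp [Source.group] at h0)
  have hx := Data.measurable_parent_of_mem (D := D) (k := p.q) (T := {.userSize n}ᶜ) (by simp)
  have hs : Measurable[⨆ a ∈ ({.userSize n} : Set (Source K₁ K₂)), D.sigma a] (D.userSize n) :=
    (comap_measurable (D.userSize n)).mono
      (le_iSup₂_of_le (f := fun a _ => D.sigma a) (.userSize n) (Set.mem_singleton _) le_rfl) le_rfl
  have hu : Measurable[⨆ a ∈ ({.userSize n}ᶜ : Set (Source K₁ K₂)), D.sigma a] (D.userDisp n l) :=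
    (comap_measurable (D.userDisp n l)).mono
      (le_iSup₂_of_le (f := fun a _ => D.sigma a) (.userDisp n l) (by simp) le_rfl) le_rfl
  have hd : Disjoint ({.userSize n} : Set (Source K₁ K₂)) {.userSize n}ᶜ := disjoint_compl_right
  exact hD.indepFun hd hs (hu.prodMk (hx.prodMk (ho.prodMk hm)))

lemma IsModel.indepFun_userDisp (hD : IsModel p D μ) (n l : ℕ) (u : ℕ × ℕ) :
    IndepFun (D.userDisp n l) (fun ω => ((fun m => D.parent p.q m ω), D.rest p u ω)) μ := by
  have hm := Data.measurable_marks_of_mem (D := D) (T := {.userDisp n l}ᶜ)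
    (p.range_markSource_subset (some : ℕ → Option ℕ) (some u) fun a h => by rintro rfl; simp [Source.group] at h)
  have ho := Data.measurable_other_of_mem (D := D) (T := {.userDisp n l}ᶜ)
    (p.range_otherSource_subset fun a h0 _ h => by rintro rfl; simp [Source.group] at h0)
  have hx := Data.measurable_parent_of_mem (D := D) (k := p.q) (T := {.userDisp n l}ᶜ) (by simp)
  have hu : Measurable[⨆ a ∈ ({.userDisp n l} : Set (Source K₁ K₂)), D.sigma a] (D.userDisp n l) :=
    (comap_measurable (D.userDisp n l)).mono
      (le_iSup₂_of_le (f := fun a _ => D.sigma a) (.userDisp n l) (Set.mem_singleton _) le_rfl) le_rfl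
  have hd : Disjoint ({.userDisp n l} : Set (Source K₁ K₂)) {.userDisp n l}ᶜ := disjoint_compl_right
  exact hD.indepFun hd hu (hx.prodMk (ho.prodMk hm))

lemma IsModel.measurable_rest (hD : IsModel p D μ) (u : ℕ × ℕ) : Measurable (D.rest p u) :=
  hD.measurable_other.prodMk (hD.measurable_marks _ _)

/-- The tail probabilities of a Poisson variable sum to its mean, which is the case `v = 1` of the
size-biased generating function. -/
lemma IsModel.tsum_lintegral_userSize (hD : IsModel p D μ) (n : ℕ) :
    ∑' l, ∫⁻ ω, (if l < D.userSize n ω then 1 else 0) ∂μ = ENNReal.ofReal p.mbarU := by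
  have hite l : Measurable fun ω => if l < D.userSize n ω then (1 : ℝ≥0∞) else 0 :=
    Measurable.ite (measurableSet_lt measurable_const (hD.userSize_measurable n)) measurable_const measurable_const
  have h2 (n : ℕ) : (∑' l : ℕ, if l < n then (1 : ℝ≥0∞) else 0) = n := by
    rw [tsum_eq_sum (s := Finset.range n) (fun l hl => if_neg fun h => hl (Finset.mem_range.2 h)),
      Finset.sum_congr rfl fun l hl => if_pos (Finset.mem_range.1 hl)]
    simp
  rw [← lintegral_tsum fun l => (hite l).aemeasurable]
  simp_rw [h2]
  have h3 := lintegral_mul_pow_poissonMeasure p.mbarU.toNNReal (v := 1) le_rfl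
  simp only [one_pow, mul_one, tsub_self, mul_zero, expNeg_zero] at h3
  exact ((hD.userSize_law n).lintegral_comp (f := fun n : ℕ => (n : ℝ≥0∞)) Measurable.of_discrete.aemeasurable).trans h3

variable [Countable K₁] [Countable K₂] [IsProbabilityMeasure μ]

omit [Countable K₁] [Countable K₂] in
/-- Averages over a user decompose into averages over the size of the user cluster, the
displacement of the user, the parent process and the rest of the network. -/
lemma IsModel.lintegral_user (hD : IsModel p D μ) (n l : ℕ)
    {F : Plane → (ℕ → Plane) → (p.Other → ℕ → Plane) × p.Marks ℕ → ℝ≥0∞}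
    (hF : Measurable fun a : Plane × (ℕ → Plane) × ((p.Other → ℕ → Plane) × p.Marks ℕ) => F a.1 a.2.1 a.2.2) :
    ∫⁻ ω, (if l < D.userSize n ω then 1 else 0) *
        F (D.userDisp n l ω) (fun m => D.parent p.q m ω) (D.rest p (n, l) ω) ∂μ =
      (∫⁻ ω, if l < D.userSize n ω then 1 else 0 ∂μ) * ∫⁻ u, ∫⁻ ω, ∫⁻ ω', F u (fun m => D.parent p.q m ω)
        (D.rest p (n, l) ω') ∂μ ∂μ ∂(densityLaw p.gU) := by
  have hx := hD.measurable_parent p.q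
  have hr := hD.measurable_rest (n, l)
  have hu := hD.userDisp_measurable n l
  have hG : Measurable fun ω => F (D.userDisp n l ω) (fun m => D.parent p.q m ω) (D.rest p (n, l) ω) :=
    hF.comp (hu.prodMk (hx.prodMk hr))
  have h1 := lintegral_of_indepFun (hD.userSize_measurable n) (hu.prodMk (hx.prodMk hr)) (hD.indepFun_userSize n l (n, l))
    (F := fun a y => (if l < a then 1 else 0) * F y.1 y.2.1 y.2.2) (Measurable.mul
      (Measurable.ite (measurableSet_lt measurable_const measurable_fst) measurable_const measurable_const)
      (hF.comp measurable_snd))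
  have hite : Measurable fun ω => if l < D.userSize n ω then (1 : ℝ≥0∞) else 0 :=
    Measurable.ite (measurableSet_lt measurable_const (hD.userSize_measurable n)) measurable_const measurable_const
  refine h1.trans ?_
  have h2 (ω : Ω) : ∫⁻ ω', (if l < D.userSize n ω then 1 else 0) *
      F (D.userDisp n l ω') (fun m => D.parent p.q m ω') (D.rest p (n, l) ω') ∂μ =
      (if l < D.userSize n ω then 1 else 0) *
      ∫⁻ ω', F (D.userDisp n l ω') (fun m => D.parent p.q m ω') (D.rest p (n, l) ω') ∂μ := lintegral_const_mul _ hG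
  simp_rw [h2]
  rw [lintegral_mul_const _ hite]
  congr 1
  refine (lintegral_of_indepFun_hasLaw hu (hD.userDisp_law n l) (hx.prodMk hr) (hD.indepFun_userDisp n l (n, l))
    (F := fun u y => F u y.1 y.2) hF).trans (lintegral_congr fun u => ?_)
  exact lintegral_of_indepFun hx hr (hD.indepFun_parent some (some (n, l))) (F := fun x w => F u x w)
    (hF.comp (measurable_const.prodMk measurable_id))

omit [Countable K₁] [Countable K₂] in
/-- Expected number of users in `B`. -/
lemma IsModel.tsum_lintegral_users (hD : IsModel p D μ) {B : Set Plane} (hB : MeasurableSet B) :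
    ∑' u : ℕ × ℕ, ∫⁻ ω, (if u.2 < D.userSize u.1 ω then 1 else 0) * B.indicator 1 (D.userPos p u ω) ∂μ =
      ENNReal.ofReal p.mbarU * (ENNReal.ofReal (p.lamP p.q) * volume B) := by
  have hm (n : ℕ) : Measurable fun a : Plane × (ℕ → Plane) => B.indicator (1 : Plane → ℝ≥0∞) (a.2 n + a.1) :=
    (measurable_one.indicator hB).comp (((measurable_pi_apply n).comp measurable_snd).add measurable_fst)
  have h1 (n l : ℕ) := hD.lintegral_user n l (F := fun u x _ => B.indicator 1 (x n + u))
    ((hm n).comp (measurable_fst.prodMk (measurable_fst.comp measurable_snd)))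
  have h0 (n l : ℕ) : ∫⁻ ω, (if l < D.userSize n ω then 1 else 0) * B.indicator 1 (D.userPos p (n, l) ω) ∂μ =
      (∫⁻ ω, if l < D.userSize n ω then 1 else 0 ∂μ) * ∫⁻ u, ∫⁻ ω, B.indicator 1 (D.parent p.q n ω + u) ∂μ
        ∂(densityLaw p.gU) := by
    refine (h1 n l).trans ?_
    simp
  have hx := hD.measurable_parent p.q
  rw [ENNReal.tsum_prod']
  simp_rw [h0, ENNReal.tsum_mul_right, hD.tsum_lintegral_userSize]
  rw [ENNReal.tsum_mul_left, ← lintegral_tsum]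
  · congr 1
    have h2 (u : Plane) : ∑' n, ∫⁻ ω, B.indicator (1 : Plane → ℝ≥0∞) (D.parent p.q n ω + u) ∂μ =
        ENNReal.ofReal (p.lamP p.q) * volume B := by
      have hB' : Measurable fun x : Plane => B.indicator (1 : Plane → ℝ≥0∞) (x + u) :=
        (measurable_one.indicator hB).comp (measurable_id.add_const u)
      refine (lintegral_tsum fun n => (hB'.comp ((hD.parent_ppp p.q).measurable n)).aemeasurable).symm.trans ?_
      -- With `F` independent of the measure, Mecke's formula is Campbell's: the mean number of
      -- points in a translate of `B`.
      refine ((hD.parent_ppp p.q).lintegral_tsum_erase (F := fun x _ => B.indicator 1 (x + u))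
        (hB'.comp measurable_fst)).trans ?_
      simp only [lintegral_const, measure_univ, mul_one]
      rw [lintegral_add_right_eq_self (fun x => B.indicator (1 : Plane → ℝ≥0∞) x) u, lintegral_indicator_one hB]
    simp [h2]
  · intro n
    exact (Measurable.lintegral_prod_right (f := fun u ω => B.indicator (1 : Plane → ℝ≥0∞) (D.parent p.q n ω + u))
      ((hm n).comp (measurable_fst.prodMk (hx.comp measurable_snd)))).aemeasurable

/-- Expected number of users in `B`, each weighted with the number of serving base stations. -/
lemma IsModel.tsum_lintegral_users_goodCount (hD : IsModel p D μ) {B : Set Plane} (hB : MeasurableSet B)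
    (hBv : volume B ≠ ∞) (σ : Bool)
    (i : K₁ ⊕ K₂) :
    ∑' u : ℕ × ℕ, ∫⁻ ω, (if u.2 < D.userSize u.1 ω then 1 else 0) *
      (B.indicator 1 (D.userPos p u ω) * (D.userView p u ω).goodCount p σ i) ∂μ =
      ENNReal.ofReal p.mbarU * (ENNReal.ofReal (p.lamP p.q) * volume B) *
        ∫⁻ u, p.typicalMean σ i (-u) ∂(densityLaw p.gU) := by
  -- The shift to the user depends on its own parent `x n`, so parents and displacement are fixed
  -- before the rest of the network is averaged.
  let F : ℕ → Plane → (ℕ → Plane) → (p.Other → ℕ → Plane) × p.Marks ℕ → ℝ≥0∞ := fun n u x w =>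
    B.indicator 1 (x n + u) * p.netCount σ i (fun m => x m - (x n + u)) (fun a m => w.1 a m - (x n + u)) w.2
  have hF n : Measurable fun a : Plane × (ℕ → Plane) × ((p.Other → ℕ → Plane) × p.Marks ℕ) => F n a.1 a.2.1 a.2.2 := by
    have ho : Measurable fun a : Plane × (ℕ → Plane) × ((p.Other → ℕ → Plane) × p.Marks ℕ) => a.2.1 n + a.1 :=
      ((measurable_pi_apply n).comp (measurable_fst.comp measurable_snd)).add measurable_fst
    refine ((measurable_one.indicator hB).comp ho).mul (p.measurable_netCount σ i ?_ ?_ ?_)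
    · exact measurable_pi_lambda _ fun m => ((measurable_pi_apply m).comp (measurable_fst.comp measurable_snd)).sub ho
    · refine measurable_pi_lambda _ fun a => measurable_pi_lambda _ fun m => Measurable.sub ?_ ho
      exact (measurable_pi_apply m).comp ((measurable_pi_apply a).comp
        (measurable_fst.comp (measurable_snd.comp measurable_snd)))
    · exact measurable_snd.comp (measurable_snd.comp measurable_snd)
  let R : ℕ → Plane → Ω → ℝ≥0∞ := fun n u ω => B.indicator 1 (D.parent p.q n ω + u) *
    p.tierMean σ i (pointMeasure fun m => D.parent p.q m ω - (D.parent p.q n ω + u))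
  have hR (n l : ℕ) (u : Plane) (ω : Ω) :
      ∫⁻ ω', F n u (fun m => D.parent p.q m ω) (D.rest p (n, l) ω') ∂μ = R n u ω := by
    simp only [F, R]
    rw [← hD.lintegral_netCount (Option.some_injective ℕ) (some (n, l)) σ i _ (D.parent p.q n ω + u)]
    refine lintegral_const_mul _ (p.measurable_netCount σ i measurable_const ?_ (hD.measurable_marks _ _))
    exact measurable_pi_lambda _ fun a => measurable_pi_lambda _ fun m =>
      (measurable_plane_sub _).comp ((measurable_pi_apply m).comp ((measurable_pi_apply a).comp hD.measurable_other))
  -- `R` does not depend on the label of the user within its cluster, so its measurability is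
  -- inherited from the label `0`.
  have hRm (n : ℕ) : Measurable fun a : Plane × Ω => R n a.1 a.2 := by
    simp_rw [← hR n 0]
    refine Measurable.lintegral_prod_right (f := fun (a : Plane × Ω) ω' => F n a.1 (fun m => D.parent p.q m a.2)
      (D.rest p (n, 0) ω')) ?_
    exact (hF n).comp ((measurable_fst.comp measurable_fst).prodMk
      (((hD.measurable_parent p.q).comp (measurable_snd.comp measurable_fst)).prodMk
        ((hD.measurable_rest (n, 0)).comp measurable_snd)))
  have h0 (n l : ℕ) : ∫⁻ ω, (if l < D.userSize n ω then 1 else 0) *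
      (B.indicator 1 (D.userPos p (n, l) ω) * (D.userView p (n, l) ω).goodCount p σ i) ∂μ =
      (∫⁻ ω, if l < D.userSize n ω then 1 else 0 ∂μ) * ∫⁻ u, ∫⁻ ω, R n u ω ∂μ ∂(densityLaw p.gU) := by
    have h1 := hD.lintegral_user n l (hF n)
    simp_rw [hR] at h1
    refine Eq.trans (lintegral_congr fun ω => ?_) h1
    rw [D.goodCount_userView]
    rfl
  rw [ENNReal.tsum_prod']
  simp_rw [h0, ENNReal.tsum_mul_right, hD.tsum_lintegral_userSize]
  rw [ENNReal.tsum_mul_left, ← lintegral_tsum fun n => (Measurable.lintegral_prod_right (hRm n)).aemeasurable,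
    mul_assoc]
  congr 1
  have h2 (u : Plane) : ∑' n, ∫⁻ ω, R n u ω ∂μ = ENNReal.ofReal (p.lamP p.q) * volume B * p.typicalMean σ i (-u) := by
    refine (lintegral_tsum fun n => ((hRm n).comp measurable_prodMk_left).aemeasurable).symm.trans ?_
    rw [mul_assoc]
    exact p.lintegral_tsum_tierMean (hD.parent_ppp p.q) σ i u hB
  simp_rw [h2]
  exact lintegral_const_mul' _ _ (ENNReal.mul_ne_top ENNReal.ofReal_ne_top hBv)

end Users

/-! ### Ties and infinite powers are negligible -/

section Ties

variable {K₁ K₂ : Type*} (p : Params K₁ K₂)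

lemma Params.meanPow_inj {k : K₁ ⊕ K₂} {y y' : Plane} (h : p.meanPow k y = p.meanPow k y') : ‖y‖ = ‖y'‖ := by
  have h1 : ENNReal.ofReal (p.P k) ≠ 0 := by simpa using p.P_pos k
  have h2 := (ENNReal.mul_right_inj h1 ENNReal.ofReal_ne_top).1 h
  rw [ENNReal.rpow_neg, ENNReal.rpow_neg, inv_inj] at h2
  have hα : p.α ≠ 0 := by linarith [p.two_lt_α]
  have h3 := ENNReal.rpow_left_injective hα h2
  simpa [enorm_eq_iff_norm_eq] using h3

/-- Equal mean powers within a tier force equal distances, and circles are null, including the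
degenerate one at `t = ⊤`. -/
lemma Params.volume_meanPow_eq (k : K₁ ⊕ K₂) (t : ℝ≥0∞) : volume {y : Plane | p.meanPow k y = t} = 0 := by
  by_cases h : ∃ y₀, p.meanPow k y₀ = t
  · obtain ⟨y₀, rfl⟩ := h
    refine measure_mono_null (fun y hy => ?_) (Measure.addHaar_sphere volume (0 : Plane) ‖y₀‖)
    simpa using p.meanPow_inj hy
  · push Not at h
    simp [h]

lemma Params.volume_meanPow_add_eq (k : K₁ ⊕ K₂) (t : ℝ≥0∞) (x : Plane) :
    volume {y : Plane | p.meanPow k (x + y) = t} = 0 := by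
  have := measure_preimage_add (volume : Measure Plane) x {y | p.meanPow k y = t}
  rw [p.volume_meanPow_eq] at this
  exact this

lemma densityLaw_absolutelyContinuous (g : Plane → ℝ) : densityLaw g ≪ volume :=
  withDensity_absolutelyContinuous _ _

lemma Params.factor_eq {i k : K₁ ⊕ K₂} {t : ℝ≥0∞} {y : Plane} (h : p.meanPow k y ≠ t) :
    p.factor true i t k y = p.factor false i t k y := by
  have h1 : Beats true t (p.meanPow k y) ↔ Beats false t (p.meanPow k y) := by
    simp only [Beats, if_true, Bool.false_eq_true, if_false]
    exact ⟨fun h' => lt_of_le_of_ne h' h.symm, le_of_lt⟩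
  classical
  unfold Params.factor fadeFactor
  exact if_congr h1 rfl rfl

/-- A displacement with a density does not charge circles, so a tie has no effect after averaging
over it. -/
lemma Params.meanFactor_eq (i : K₁ ⊕ K₂) (t : ℝ≥0∞) (k : K₁) (x : Plane) :
    p.meanFactor true i t k x = p.meanFactor false i t k x := by
  refine lintegral_congr_ae ((densityLaw_absolutelyContinuous _).ae_le ?_)
  have : ∀ᵐ s : Plane, p.meanPow (.inl k) (x + s) ≠ t := by
    simpa [ae_iff] using p.volume_meanPow_add_eq (.inl k) t x
  filter_upwards [this] with s hs
  exact p.factor_eq hs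

lemma Params.potential_inl_eq (i : K₁ ⊕ K₂) (t : ℝ≥0∞) (k : K₁) (x : Plane) :
    p.potential true i t (.inl k) x = p.potential false i t (.inl k) x := by
  simp only [Params.potential, p.meanFactor_eq]

lemma Params.void_eq (i : K₁ ⊕ K₂) (t : ℝ≥0∞) (k : K₁ ⊕ K₂) : p.void true i t k = p.void false i t k := by
  rcases k with k | k
  · simp only [Params.void, p.potential_inl_eq]
  · refine lintegral_congr_ae ?_
    have : ∀ᵐ y : Plane, p.meanPow (.inr k) y ≠ t := by
      simpa [ae_iff] using p.volume_meanPow_eq (.inr k) t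
    filter_upwards [this] with y hy
    simp only [Params.potential, p.factor_eq hy]

/-- Ties have already disappeared from the exponents, and the two variants of the noise differ only
at infinite power. -/
lemma Params.base_eq_of_ne_top (i : K₁ ⊕ K₂) (z : Plane) {t : ℝ≥0∞} (ht : t ≠ ⊤) :
    p.base true i z t = p.base false i z t := by
  simp [Params.base, p.potential_inl_eq, p.void_eq, Params.noise, HetNet.noise, ht]

lemma Params.ae_meanPow_add_ne_top (k : K₁ ⊕ K₂) (x : Plane) : ∀ᵐ y : Plane, p.meanPow k (x + y) ≠ ⊤ := by
  simpa [ae_iff] using p.volume_meanPow_add_eq k ⊤ x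

lemma Params.lintegral_base_eq (k : K₁) (z : Plane) :
    ∫⁻ v, p.base true (.inl k) z (p.meanPow (.inl k) (z + v)) ∂(densityLaw (p.g k)) =
      ∫⁻ v, p.base false (.inl k) z (p.meanPow (.inl k) (z + v)) ∂(densityLaw (p.g k)) := by
  refine lintegral_congr_ae ((densityLaw_absolutelyContinuous _).ae_le ?_)
  filter_upwards [p.ae_meanPow_add_ne_top (.inl k) z] with v hv
  exact p.base_eq_of_ne_top _ _ hv

lemma Params.ae_meanPow_add_ne_top' (k : K₁ ⊕ K₂) (x : Plane) : ∀ᵐ y : Plane, p.meanPow k (y + x) ≠ ⊤ := by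
  filter_upwards [p.ae_meanPow_add_ne_top k x] with y hy
  exact add_comm x y ▸ hy

lemma Params.expNeg_mul_base_eq (k : K₁) (z y : Plane) {t : ℝ≥0∞} (ht : t ≠ ⊤) :
    expNeg (p.potential true (.inl k) t (.inl k) y) * p.base true (.inl k) z t =
      expNeg (p.potential false (.inl k) t (.inl k) y) * p.base false (.inl k) z t := by
  rw [p.base_eq_of_ne_top _ _ ht, p.potential_inl_eq]

lemma Params.lintegral_expNeg_mul_base_eq (k : K₁) (z v : Plane) :
    ∫⁻ y, expNeg (p.potential true (.inl k) (p.meanPow (.inl k) (y + v)) (.inl k) y) *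
      p.base true (.inl k) z (p.meanPow (.inl k) (y + v)) =
      ∫⁻ y, expNeg (p.potential false (.inl k) (p.meanPow (.inl k) (y + v)) (.inl k) y) *
      p.base false (.inl k) z (p.meanPow (.inl k) (y + v)) := by
  have h := p.ae_meanPow_add_ne_top' (.inl k) v
  refine lintegral_congr_ae ?_
  filter_upwards [h] with y hy using p.expNeg_mul_base_eq k z y hy

/-- The serving position is always integrated against a density or Lebesgue measure, so infinite
power is negligible and the two ends of the sandwich have the same mean. -/
lemma Params.typicalMean_eq (i : K₁ ⊕ K₂) (z : Plane) : p.typicalMean true i z = p.typicalMean false i z := by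
  rcases i with k | k
  · simp only [Params.typicalMean, p.lintegral_base_eq, p.lintegral_expNeg_mul_base_eq]
  · have h : ∀ᵐ x : Plane, p.base true (.inr k) z (p.meanPow (.inr k) x) =
        p.base false (.inr k) z (p.meanPow (.inr k) x) := by
      filter_upwards [p.ae_meanPow_add_ne_top (.inr k) 0] with y hy
      rw [zero_add] at hy
      exact p.base_eq_of_ne_top _ _ hy
    simp only [Params.typicalMean, lintegral_congr_ae h]

/-- Mean number of base stations of tier `i` that serve the typical user with sufficient SINR. -/
def Params.tierCov (i : K₁ ⊕ K₂) : ℝ≥0∞ := ∫⁻ u, p.typicalMean true i (-u) ∂(densityLaw p.gU)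

end Ties

/-! ### Coverage and Palm probabilities -/

section Coverage

variable {K₁ K₂ Ω : Type*} [Fintype K₁] [Fintype K₂] [mΩ : MeasurableSpace Ω] {μ : Measure Ω}
  [IsProbabilityMeasure μ] {p : Params K₁ K₂} {D : Data K₁ K₂ Ω}

lemma IsModel.lintegral_goodCount_eq_tierCov (hD : IsModel p D μ) (σ : Bool) (i : K₁ ⊕ K₂) :
    ∫⁻ ω, (D.typicalView ω).goodCount p σ i ∂μ = p.tierCov i := by
  rw [hD.lintegral_goodCount_typicalView]
  cases σ
  · exact lintegral_congr fun u => (p.typicalMean_eq i _).symm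
  · rfl

omit [IsProbabilityMeasure μ] in
lemma IsModel.measurable_goodCount_typicalView (hD : IsModel p D μ) (σ : Bool) (i : K₁ ⊕ K₂) :
    Measurable fun ω => (D.typicalView ω).goodCount p σ i := by
  simp_rw [D.goodCount_typicalView]
  refine p.measurable_netCount σ i ?_ hD.measurable_other (hD.measurable_marks _ _)
  refine measurable_pi_lambda _ fun c => ?_
  rcases c with _ | n
  · exact hD.z₀_measurable
  · exact (hD.parent_ppp p.q).measurable n

omit [IsProbabilityMeasure μ] in
/-- A property has probability `∫ f` if its indicator is between functions with this integral. -/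
lemma measure_eq_of_le_of_le {S : Set Ω} {f g : Ω → ℝ≥0∞} (hg : Measurable g)
    (h1 : ∀ ω, f ω ≤ S.indicator 1 ω) (h2 : ∀ ω, S.indicator 1 ω ≤ g ω) (hfg : ∫⁻ ω, f ω ∂μ = ∫⁻ ω, g ω ∂μ) :
    μ S = ∫⁻ ω, f ω ∂μ := by
  refine le_antisymm ?_ ?_
  · rw [hfg]
    -- Markov's inequality for `g` bounds the outer measure of `S`, so `S` itself need not be
    -- measurable.
    have h3 : S ⊆ {ω | 1 ≤ g ω} := fun ω hω => by simpa [hω] using h2 ω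
    calc μ S ≤ μ {ω | 1 ≤ g ω} := measure_mono h3
      _ ≤ ∫⁻ ω, g ω ∂μ := by simpa using mul_meas_ge_le_lintegral hg 1
  · calc ∫⁻ ω, f ω ∂μ ≤ ∫⁻ ω, S.indicator 1 ω ∂μ := lintegral_mono h1
      _ ≤ μ S := lintegral_indicator_one_le S

lemma IsModel.measure_covered (hD : IsModel p D μ) (i : K₁ ⊕ K₂) :
    μ {ω | (D.typicalView ω).Covered p i} = p.tierCov i := by
  classical
  rw [← hD.lintegral_goodCount_eq_tierCov true i]
  refine measure_eq_of_le_of_le (hD.measurable_goodCount_typicalView false i) (fun ω => ?_) (fun ω => ?_) ?_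
  · exact ((D.typicalView ω).goodCount_true_le p i).trans_eq (by simp [Set.indicator_apply])
  · exact Eq.trans_le (by simp [Set.indicator_apply]) ((D.typicalView ω).le_goodCount_false p i)
  · rw [hD.lintegral_goodCount_eq_tierCov, hD.lintegral_goodCount_eq_tierCov]

/-- The counts summed over all tiers sandwich the indicator of the union, and their means add. The
bound by `1` on the strict total takes the place of disjointness of the tier events. -/
lemma IsModel.measure_exists_covered (hD : IsModel p D μ) :
    μ {ω | ∃ i, (D.typicalView ω).Covered p i} = ∑ i, p.tierCov i := by
  classical
  have hs (σ : Bool) : ∫⁻ ω, ∑ i, (D.typicalView ω).goodCount p σ i ∂μ = ∑ i, p.tierCov i := by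
    rw [lintegral_finsetSum _ fun i _ => hD.measurable_goodCount_typicalView σ i]
    simp_rw [hD.lintegral_goodCount_eq_tierCov]
  rw [← hs true]
  refine measure_eq_of_le_of_le (g := fun ω => ∑ i, (D.typicalView ω).goodCount p false i)
    (Finset.measurable_sum _ fun i _ => hD.measurable_goodCount_typicalView false i)
    (fun ω => ?_) (fun ω => ?_) ?_
  · exact ((D.typicalView ω).sum_goodCount_true_le p).trans_eq (by simp [Set.indicator_apply])
  · exact Eq.trans_le (by simp [Set.indicator_apply]) ((D.typicalView ω).le_sum_goodCount_false p)
  · rw [hs, hs]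

/-- Finiteness needs no estimate, since the mean is a probability. It is what allows the passage to
real integrals at the end. -/
lemma IsModel.tierCov_ne_top (hD : IsModel p D μ) (i : K₁ ⊕ K₂) : p.tierCov i ≠ ⊤ := by
  rw [← hD.measure_covered i]
  exact measure_ne_top _ _

lemma IsModel.tierCoverage_eq (hD : IsModel p D μ) (i : K₁ ⊕ K₂) : D.tierCoverage p μ i = (p.tierCov i).toReal := by
  rw [Data.tierCoverage, measureReal_def, hD.measure_covered]

lemma IsModel.coverage_eq_sum (hD : IsModel p D μ) : D.coverage p μ = ∑ i, D.tierCoverage p μ i := by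
  rw [Data.coverage, measureReal_def, hD.measure_exists_covered, ENNReal.toReal_sum fun i _ => hD.tierCov_ne_top i]
  simp_rw [hD.tierCoverage_eq]

open Classical in
omit [Fintype K₁] [Fintype K₂] [IsProbabilityMeasure μ] in
lemma Data.meanUsers_eq (p : Params K₁ K₂) (D : Data K₁ K₂ Ω) (B : Set Plane) (Q : View K₁ K₂ → Prop) :
    D.meanUsers p μ B Q = ∫⁻ ω, ∑' u : ℕ × ℕ, (if u.2 < D.userSize u.1 ω then 1 else 0) *
      (B.indicator 1 (D.userPos p u ω) * if Q (D.userView p u ω) then 1 else 0) ∂μ := by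
  refine lintegral_congr fun ω => ?_
  rw [← ENNReal.tsum_set_one]
  refine (tsum_subtype _ fun _ => (1 : ℝ≥0∞)).trans (tsum_congr fun u => ?_)
  by_cases h1 : u.2 < D.userSize u.1 ω <;> by_cases h2 : D.userPos p u ω ∈ B <;>
    by_cases h3 : Q (D.userView p u ω) <;> simp [h1, h2, h3]

omit [Fintype K₁] [Fintype K₂] [IsProbabilityMeasure μ] in
lemma IsModel.measurable_userPos (hD : IsModel p D μ) (u : ℕ × ℕ) : Measurable (D.userPos p u) :=
  ((hD.parent_ppp p.q).measurable u.1).add (hD.userDisp_measurable u.1 u.2)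

omit [Fintype K₁] [Fintype K₂] [IsProbabilityMeasure μ] in
lemma IsModel.measurable_userIndicator (hD : IsModel p D μ) (u : ℕ × ℕ) :
    Measurable fun ω => if u.2 < D.userSize u.1 ω then (1 : ℝ≥0∞) else 0 :=
  Measurable.ite (measurableSet_lt measurable_const (hD.userSize_measurable u.1)) measurable_const measurable_const

omit [Fintype K₁] [Fintype K₂] in
lemma IsModel.meanUsers_true (hD : IsModel p D μ) {B : Set Plane} (hB : MeasurableSet B) :
    D.meanUsers p μ B (fun _ => True) = ENNReal.ofReal p.mbarU * (ENNReal.ofReal (p.lamP p.q) * volume B) := by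
  rw [D.meanUsers_eq, lintegral_tsum, ← hD.tsum_lintegral_users hB]
  · simp
  · intro u
    refine ((hD.measurable_userIndicator u).mul (Measurable.mul ?_ ?_)).aemeasurable
    · exact (measurable_one.indicator hB).comp (hD.measurable_userPos u)
    · simp

omit [IsProbabilityMeasure μ] in
lemma IsModel.measurable_goodCount_userView (hD : IsModel p D μ) (u : ℕ × ℕ) (σ : Bool) (i : K₁ ⊕ K₂) :
    Measurable fun ω => (D.userView p u ω).goodCount p σ i := by
  simp_rw [D.goodCount_userView]
  refine p.measurable_netCount σ i ?_ ?_ (hD.measurable_marks _ _)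
  · exact measurable_pi_lambda _ fun n => ((hD.parent_ppp p.q).measurable n).sub (hD.measurable_userPos u)
  · exact measurable_pi_lambda _ fun a => measurable_pi_lambda _ fun n =>
      ((hD.other_ppp a).measurable n).sub (hD.measurable_userPos u)

/-- The mean number of users with a property lies between weighted mean numbers of users. -/
lemma IsModel.meanUsers_eq_of_le_of_le (hD : IsModel p D μ) {B : Set Plane} (hB : MeasurableSet B)
    (hBv : volume B ≠ ∞) (s : Finset (K₁ ⊕ K₂)) {Q : View K₁ K₂ → Prop} (h1 : open Classical in
      ∀ v : View K₁ K₂, ∑ i ∈ s, v.goodCount p true i ≤ if Q v then 1 else 0)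
    (h2 : open Classical in ∀ v : View K₁ K₂, (if Q v then 1 else 0) ≤ ∑ i ∈ s, v.goodCount p false i) :
    D.meanUsers p μ B Q = ENNReal.ofReal p.mbarU * (ENNReal.ofReal (p.lamP p.q) * volume B) * ∑ i ∈ s, p.tierCov i := by
  have hs (σ : Bool) : ∫⁻ ω, ∑' u : ℕ × ℕ, (if u.2 < D.userSize u.1 ω then 1 else 0) *
      (B.indicator 1 (D.userPos p u ω) * ∑ i ∈ s, (D.userView p u ω).goodCount p σ i) ∂μ =
      ENNReal.ofReal p.mbarU * (ENNReal.ofReal (p.lamP p.q) * volume B) * ∑ i ∈ s, p.tierCov i := by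
    have hm (u : ℕ × ℕ) (i : K₁ ⊕ K₂) : Measurable fun ω => (if u.2 < D.userSize u.1 ω then (1 : ℝ≥0∞) else 0) *
        (B.indicator 1 (D.userPos p u ω) * (D.userView p u ω).goodCount p σ i) :=
      (hD.measurable_userIndicator u).mul (((measurable_one.indicator hB).comp (hD.measurable_userPos u)).mul
        (hD.measurable_goodCount_userView u σ i))
    simp_rw [Finset.mul_sum]
    rw [lintegral_tsum fun u => (Finset.measurable_sum _ fun i _ => hm u i).aemeasurable]
    have h3 (u : ℕ × ℕ) := lintegral_finsetSum (μ := μ) s fun i _ => hm u i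
    simp_rw [h3]
    rw [Summable.tsum_finsetSum fun _ _ => ENNReal.summable]
    refine Finset.sum_congr rfl fun i _ => ?_
    rw [hD.tsum_lintegral_users_goodCount hB hBv]
    congr 1
    cases σ
    · exact lintegral_congr fun u => (p.typicalMean_eq i _).symm
    · rfl
  classical
  rw [D.meanUsers_eq]
  refine le_antisymm ?_ ?_
  · rw [← hs false]
    refine lintegral_mono fun ω => ENNReal.tsum_le_tsum fun u => ?_
    gcongr
    exact Eq.trans_le (if_congr Iff.rfl rfl rfl) (h2 _)
  · rw [← hs true]
    refine lintegral_mono fun ω => ENNReal.tsum_le_tsum fun u => ?_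
    gcongr
    exact (h1 _).trans_eq (if_congr Iff.rfl rfl rfl)

/-- Numerator and denominator share the mean number of users in `B`, which is positive and finite
and cancels. -/
lemma IsModel.palmProb_eq (hD : IsModel p D μ) {B : Set Plane} (hB : MeasurableSet B) (hB0 : 0 < volume B)
    (hBv : volume B < ∞) (s : Finset (K₁ ⊕ K₂)) {Q : View K₁ K₂ → Prop} (h1 : open Classical in
      ∀ v : View K₁ K₂, ∑ i ∈ s, v.goodCount p true i ≤ if Q v then 1 else 0)
    (h2 : open Classical in ∀ v : View K₁ K₂, (if Q v then 1 else 0) ≤ ∑ i ∈ s, v.goodCount p false i) :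
    D.palmProb p μ B Q = ∑ i ∈ s, p.tierCov i := by
  rw [Data.palmProb, hD.meanUsers_eq_of_le_of_le hB hBv.ne s h1 h2, hD.meanUsers_true hB]
  rw [mul_comm]
  refine ENNReal.mul_div_cancel_right ?_ ?_
  · refine mul_ne_zero ?_ (mul_ne_zero ?_ hB0.ne')
    · simpa using p.mbarU_pos
    · simpa using p.lamP_pos _
  · exact ENNReal.mul_ne_top ENNReal.ofReal_ne_top (ENNReal.mul_ne_top ENNReal.ofReal_ne_top hBv.ne)

lemma IsModel.palmProb_covered (hD : IsModel p D μ) {B : Set Plane} (hB : MeasurableSet B) (hB0 : 0 < volume B)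
    (hBv : volume B < ∞) (i : K₁ ⊕ K₂) :
    D.palmProb p μ B (fun v => v.Covered p i) = ENNReal.ofReal (D.tierCoverage p μ i) := by
  rw [hD.palmProb_eq hB hB0 hBv {i} (fun v => by simpa using v.goodCount_true_le p i)
    (fun v => by simpa using v.le_goodCount_false p i), hD.tierCoverage_eq, ENNReal.ofReal_toReal (hD.tierCov_ne_top i),
    Finset.sum_singleton]

lemma IsModel.palmProb_exists_covered (hD : IsModel p D μ) {B : Set Plane} (hB : MeasurableSet B)
    (hB0 : 0 < volume B) (hBv : volume B < ∞) :
    D.palmProb p μ B (fun v => ∃ i, v.Covered p i) = ENNReal.ofReal (D.coverage p μ) := by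
  refine (hD.palmProb_eq hB hB0 hBv Finset.univ (fun v => ?_) (fun v => ?_)).trans ?_
  · exact (v.sum_goodCount_true_le p).trans_eq (by congr!)
  · exact Eq.trans_le (by congr!) (v.le_sum_goodCount_false p)
  · simp_rw [hD.coverage_eq_sum, hD.tierCoverage_eq]
    rw [ENNReal.ofReal_sum_of_nonneg fun i _ => ENNReal.toReal_nonneg]
    exact Finset.sum_congr rfl fun i _ => (ENNReal.ofReal_toReal (hD.tierCov_ne_top i)).symm

end Coverage

/-! ### Polar coordinates and distance laws -/

section Polar

@[fun_prop] lemma measurable_vec2 {α : Type*} [MeasurableSpace α] {a b : α → ℝ} (ha : Measurable a) (hb : Measurable b) :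
    Measurable fun x => (!₂[a x, b x] : Plane) := by
  refine (MeasurableEquiv.toLp 2 (Fin 2 → ℝ)).measurable.comp (measurable_pi_lambda _ fun i => ?_)
  fin_cases i
  · exact ha
  · exact hb

lemma norm_polar {r : ℝ} (hr : 0 ≤ r) (θ : ℝ) : ‖(!₂[r * Real.cos θ, r * Real.sin θ] : Plane)‖ = r := by
  rw [EuclideanSpace.norm_eq]
  simp only [Real.norm_eq_abs, sq_abs, Fin.sum_univ_two, Matrix.cons_val_zero, Matrix.cons_val_one]
  rw [show (r * Real.cos θ) ^ 2 + (r * Real.sin θ) ^ 2 = r ^ 2 * (Real.sin θ ^ 2 + Real.cos θ ^ 2) by ring,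
    Real.sin_sq_add_cos_sq, mul_one, Real.sqrt_sq hr]

/-- The point `(z, 0)`. -/
def axis (z : ℝ) : Plane := !₂[z, 0]

@[fun_prop] lemma measurable_axis {α : Type*} [MeasurableSpace α] {a : α → ℝ} (ha : Measurable a) :
    Measurable fun x => axis (a x) := measurable_vec2 ha measurable_const

lemma norm_axis {z : ℝ} (hz : 0 ≤ z) : ‖axis z‖ = z := by simpa [axis] using norm_polar hz 0

lemma lintegral_plane_eq_prod (f : Plane → ℝ≥0∞) : ∫⁻ x, f x = ∫⁻ q : ℝ × ℝ, f !₂[q.1, q.2] := by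
  let e : (ℝ × ℝ) ≃ᵐ Plane := MeasurableEquiv.finTwoArrow.symm.trans (MeasurableEquiv.toLp 2 (Fin 2 → ℝ))
  have he : MeasurePreserving e := (PiLp.volume_preserving_toLp (Fin 2)).comp ((volume_preserving_finTwoArrow ℝ).symm _)
  rw [← he.lintegral_comp_emb e.measurableEmbedding]
  rfl

/-- Integration over a period does not depend on the period. -/
lemma lintegral_Ioc_periodic {f : ℝ → ℝ≥0∞} {T : ℝ} (hf : Function.Periodic f T) (hT : 0 < T) (t s : ℝ) :
    ∫⁻ x in Set.Ioc t (t + T), f x = ∫⁻ x in Set.Ioc s (s + T), f x := by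
  have : VAddInvariantMeasure (AddSubgroup.zmultiples T) ℝ volume :=
    ⟨fun c s _ => measure_preimage_add _ _ _⟩
  exact IsAddFundamentalDomain.setLIntegral_eq (G := AddSubgroup.zmultiples T) (isAddFundamentalDomain_Ioc hT t)
    (isAddFundamentalDomain_Ioc hT s) f hf.map_vadd_zmultiples

/-- `polarCoord` takes angles in `(-π, π)`; periodicity moves them to `(0, 2π]`, the range used by
`distDensity`. -/
lemma lintegral_plane_eq_polar {f : Plane → ℝ≥0∞} (hf : Measurable f) :
    ∫⁻ x, f x = ∫⁻ r in Set.Ioi (0 : ℝ), ENNReal.ofReal r *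
      ∫⁻ θ in Set.Ioc (0 : ℝ) (2 * Real.pi), f !₂[r * Real.cos θ, r * Real.sin θ] := by
  rw [lintegral_plane_eq_prod, ← lintegral_comp_polarCoord_symm, polarCoord_target, Measure.volume_eq_prod,
    ← Measure.prod_restrict, lintegral_prod _ (by simp only [polarCoord_symm_apply, smul_eq_mul]; fun_prop)]
  refine lintegral_congr fun r => ?_
  simp only [smul_eq_mul, polarCoord_symm_apply]
  rw [lintegral_const_mul _ (by fun_prop), restrict_Ioo_eq_restrict_Ioc]
  congr 1
  have h := lintegral_Ioc_periodic (f := fun θ => f !₂[r * Real.cos θ, r * Real.sin θ])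
    (T := 2 * Real.pi) (fun θ => by simp) (by positivity) (-Real.pi) 0
  rw [zero_add, show -Real.pi + 2 * Real.pi = Real.pi by ring] at h
  exact h

lemma lintegral_norm_plane {F : ℝ → ℝ≥0∞} (hF : Measurable F) :
    ∫⁻ x : Plane, F ‖x‖ = ENNReal.ofReal (2 * Real.pi) * ∫⁻ r in Set.Ioi (0 : ℝ), ENNReal.ofReal r * F r := by
  refine (lintegral_plane_eq_polar (hF.comp measurable_norm)).trans ?_
  rw [← lintegral_const_mul _ (by fun_prop)]
  refine setLIntegral_congr_fun measurableSet_Ioi fun r hr => ?_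
  simp only [Function.comp, norm_polar (le_of_lt hr)]
  rw [setLIntegral_const, Real.volume_Ioc, sub_zero]
  ring

/-- `distDensity` with values in `[0, ∞]`. -/
def distLaw (g : Plane → ℝ) (r z : ℝ) : ℝ≥0∞ :=
  ENNReal.ofReal r * ∫⁻ θ in Set.Ioc (0 : ℝ) (2 * Real.pi), ENNReal.ofReal (g !₂[r * Real.cos θ - z, r * Real.sin θ])

variable {g : Plane → ℝ}

lemma IsDensity.measurable_distLaw (hg : IsDensity g) {α : Type*} [MeasurableSpace α] {r z : α → ℝ}
    (hr : Measurable r) (hz : Measurable z) : Measurable fun a => distLaw g (r a) (z a) := by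
  have hm := hg.measurable
  refine (ENNReal.measurable_ofReal.comp hr).mul (Measurable.lintegral_prod_right
    (f := fun a θ => ENNReal.ofReal (g !₂[r a * Real.cos θ - z a, r a * Real.sin θ])) ?_)
  fun_prop

lemma IsDensity.toReal_distLaw (hg : IsDensity g) {r : ℝ} (hr : 0 ≤ r) (z : ℝ) :
    (distLaw g r z).toReal = distDensity g r z := by
  have hm := hg.measurable
  rw [distLaw, distDensity, ENNReal.toReal_mul, ENNReal.toReal_ofReal hr, intervalIntegral.integral_of_le (by positivity),
    integral_eq_lintegral_of_nonneg_ae (Eventually.of_forall fun θ => hg.nonneg _)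
      (Measurable.aestronglyMeasurable (by fun_prop))]

/-- Translating by the centre and passing to polar coordinates leaves the angular integral of the
shifted density, which is `distLaw`. -/
lemma IsDensity.lintegral_norm_axis (hg : IsDensity g) {F : ℝ → ℝ≥0∞} (hF : Measurable F) (z : ℝ) :
    ∫⁻ s, F ‖axis z + s‖ ∂(densityLaw g) = ∫⁻ r in Set.Ioi (0 : ℝ), F r * distLaw g r z := by
  have hm := hg.measurable
  rw [densityLaw, lintegral_withDensity_eq_lintegral_mul _ (by fun_prop) (by fun_prop)]
  have h1 : ∫⁻ s : Plane, ENNReal.ofReal (g s) * F ‖axis z + s‖ =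
      ∫⁻ y : Plane, ENNReal.ofReal (g (y - axis z)) * F ‖y‖ := by
    refine Eq.trans ?_ (lintegral_add_left_eq_self (fun y : Plane => ENNReal.ofReal (g (y - axis z)) * F ‖y‖) (axis z))
    simp
  refine h1.trans ((lintegral_plane_eq_polar (by fun_prop)).trans ?_)
  refine setLIntegral_congr_fun measurableSet_Ioi fun r hr => ?_
  simp only [norm_polar (le_of_lt hr)]
  rw [lintegral_mul_const _ (by fun_prop), distLaw]
  have h2 (θ : ℝ) : (!₂[r * Real.cos θ, r * Real.sin θ] : Plane) - axis z = !₂[r * Real.cos θ - z, r * Real.sin θ] := by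
    ext i
    fin_cases i <;> simp [axis]
  simp only [h2]
  ring

lemma IsDensity.lintegral_norm (hg : IsDensity g) {F : ℝ → ℝ≥0∞} (hF : Measurable F) :
    ∫⁻ s, F ‖s‖ ∂(densityLaw g) = ∫⁻ r in Set.Ioi (0 : ℝ), F r * distLaw g r 0 := by
  have h : axis 0 = 0 := norm_eq_zero.1 (norm_axis le_rfl)
  simpa [h] using hg.lintegral_norm_axis hF 0

/-- Reflection in the line orthogonal to `x - y`. -/
lemma exists_isometry_map {x y : Plane} (h : ‖x‖ = ‖y‖) : ∃ e : Plane ≃ₗᵢ[ℝ] Plane, e x = y :=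
  ⟨_, Submodule.reflection_sub h⟩

/-- For an isotropic density, the law of the distance of `x + s` only depends on the norm of `x`. -/
lemma lintegral_norm_add_congr (hg : IsDensity g) (hi : ∀ x y, ‖x‖ = ‖y‖ → g x = g y) {F : ℝ → ℝ≥0∞} (hF : Measurable F)
    {x y : Plane} (hxy : ‖x‖ = ‖y‖) :
    ∫⁻ s, F ‖x + s‖ ∂(densityLaw g) = ∫⁻ s, F ‖y + s‖ ∂(densityLaw g) := by
  have hm := hg.measurable
  obtain ⟨e, rfl⟩ := exists_isometry_map hxy
  symm
  rw [densityLaw, lintegral_withDensity_eq_lintegral_mul _ (by fun_prop) (by fun_prop),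
    lintegral_withDensity_eq_lintegral_mul _ (by fun_prop) (by fun_prop),
    ← (e.measurePreserving).lintegral_comp_emb e.toMeasurableEquiv.measurableEmbedding]
  refine lintegral_congr fun s => ?_
  simp only [Pi.mul_apply, ← map_add, LinearIsometryEquiv.norm_map, hi (e s) s (e.norm_map s)]

lemma lintegral_norm_add (hg : IsDensity g) (hi : ∀ x y, ‖x‖ = ‖y‖ → g x = g y) {F : ℝ → ℝ≥0∞} (hF : Measurable F)
    (x : Plane) : ∫⁻ s, F ‖x + s‖ ∂(densityLaw g) = ∫⁻ r in Set.Ioi (0 : ℝ), F r * distLaw g r ‖x‖ := by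
  rw [lintegral_norm_add_congr hg hi hF (norm_axis (norm_nonneg x)).symm, hg.lintegral_norm_axis hF]

lemma IsDensity.lintegral_distLaw (hg : IsDensity g) (z : ℝ) : ∫⁻ r in Set.Ioi (0 : ℝ), distLaw g r z = 1 := by
  have := isProbabilityMeasure_densityLaw hg
  simpa using (hg.lintegral_norm_axis measurable_one z).symm

lemma IsDensity.ae_distLaw_lt_top (hg : IsDensity g) (z : ℝ) : ∀ᵐ r ∂(volume.restrict (Set.Ioi (0 : ℝ))), distLaw g r z < ⊤ :=
  ae_lt_top (hg.measurable_distLaw measurable_id measurable_const) (by simp [hg.lintegral_distLaw])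

/-- For every `z` the distance law is finite at almost every `r`; the formulas have the quantifiers
in the other order, and exchanging null sets provides it. At exceptional pairs with `r > 0`, where
`distLaw` is infinite, `distDensity` has the default value `0`. -/
lemma IsDensity.ae_ae_distLaw_lt_top (hg : IsDensity g) : ∀ᵐ r ∂(volume.restrict (Set.Ioi (0 : ℝ))),
    ∀ᵐ z ∂(volume.restrict (Set.Ioi (0 : ℝ))), distLaw g r z < ⊤ := by
  have hs : MeasurableSet {a : ℝ × ℝ | distLaw g a.2 a.1 < ⊤} :=
    measurableSet_lt (hg.measurable_distLaw measurable_snd measurable_fst) measurable_const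
  rw [← Measure.ae_ae_comm hs]
  exact Eventually.of_forall fun z => hg.ae_distLaw_lt_top z

end Polar

lemma one_sub_expNeg_le (x : ℝ≥0∞) : 1 - expNeg x ≤ x := by
  rcases eq_or_ne x ⊤ with rfl | hx
  · exact le_top
  · rw [← ENNReal.ofReal_toReal hx, expNeg_ofReal ENNReal.toReal_nonneg, ← ENNReal.ofReal_one,
      ← ENNReal.ofReal_sub _ (Real.exp_pos _).le]
    refine ENNReal.ofReal_le_ofReal ?_
    linarith [Real.add_one_le_exp (-x.toReal)]

/-! ### The path-loss integral in `rho` -/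

section PathLoss

variable {α τ : ℝ}

lemma integrableOn_one_div_one_add_rpow (hα : 2 < α) {a : ℝ} (ha : 0 < a) :
    IntegrableOn (fun t : ℝ => 1 / (1 + t ^ (α / 2))) (Set.Ioi a) := by
  refine Integrable.mono' (integrableOn_Ioi_rpow_of_lt (a := -(α / 2)) (by linarith) ha)
    (Measurable.aestronglyMeasurable (by fun_prop)) ?_
  filter_upwards [self_mem_ae_restrict measurableSet_Ioi] with t ht
  have ht0 : 0 < t := ha.trans ht
  have h1 : 0 < t ^ (α / 2) := Real.rpow_pos_of_pos ht0 _
  rw [Real.norm_of_nonneg (by positivity), Real.rpow_neg ht0.le, ← one_div]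
  gcongr
  linarith

lemma image_sq_div_Ioi {c R : ℝ} (hc : 0 < c) (hR : 0 < R) :
    (fun y : ℝ => y ^ 2 / c) '' Set.Ioi R = Set.Ioi (R ^ 2 / c) := by
  ext t
  constructor
  · rintro ⟨y, hy, rfl⟩
    have hy' : R < y := hy
    show R ^ 2 / c < y ^ 2 / c
    gcongr
  · intro ht
    have ht' : R ^ 2 / c < t := ht
    rw [div_lt_iff₀ hc] at ht'
    have h0 : 0 ≤ t * c := (sq_nonneg R).trans ht'.le
    exact ⟨√(t * c), Real.lt_sqrt_of_sq_lt ht', by simp only [Real.sq_sqrt h0]; field_simp⟩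

/-- Prepares the substitution `t = y ^ 2 / (R ^ 2 * τ ^ (2 / α))` by exhibiting its derivative as a
factor. -/
lemma sub_gain_eq (hτ : 0 < τ) (hα : 2 < α) {R y : ℝ} (hR : 0 < R) (hy : 0 < y) :
    y * (1 - 1 / (1 + τ * (R ^ α / y ^ α))) =
      R ^ 2 * τ ^ (2 / α) / 2 * (2 * y / (R ^ 2 * τ ^ (2 / α)) * (1 / (1 + (y ^ 2 / (R ^ 2 * τ ^ (2 / α))) ^ (α / 2)))) := by
  have h1 : (y ^ 2 / (R ^ 2 * τ ^ (2 / α))) ^ (α / 2) = y ^ α / (R ^ α * τ) := by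
    have h2 (x : ℝ) (hx : 0 ≤ x) : (x ^ 2) ^ (α / 2) = x ^ α := by
      rw [← Real.rpow_natCast, ← Real.rpow_mul hx]
      congr 1
      push_cast
      ring
    rw [Real.div_rpow (by positivity) (by positivity), Real.mul_rpow (by positivity) (by positivity), h2 _ hy.le,
      h2 _ hR.le, ← Real.rpow_mul hτ.le, show 2 / α * (α / 2) = 1 by field_simp, Real.rpow_one]
  have h3 : 0 < y ^ α := Real.rpow_pos_of_pos hy _
  have h4 : 0 < R ^ α := Real.rpow_pos_of_pos hR _
  have h5 : 0 < τ ^ (2 / α) := Real.rpow_pos_of_pos hτ _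
  rw [h1]
  field_simp
  ring

lemma lintegral_sub_gain (hτ : 0 < τ) (hα : 2 < α) {R : ℝ} (hR : 0 < R) :
    ∫⁻ y in Set.Ioi R, ENNReal.ofReal y * ENNReal.ofReal (1 - 1 / (1 + τ * (R ^ α / y ^ α))) =
      ENNReal.ofReal (R ^ 2 * τ ^ (2 / α) / 2 * ∫ t in Set.Ioi (τ ^ (-(2 / α))), 1 / (1 + t ^ (α / 2))) := by
  have h5 : 0 < τ ^ (2 / α) := Real.rpow_pos_of_pos hτ _
  set c := R ^ 2 * τ ^ (2 / α) with hc
  have hc0 : 0 < c := by positivity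
  -- The lower limit `y = R` corresponds to `t = τ ^ (-(2 / α))`.
  have h0 : R ^ 2 / c = τ ^ (-(2 / α)) := by
    rw [hc, Real.rpow_neg hτ.le]
    field_simp
  have h6 : 0 < τ ^ (-(2 / α)) := Real.rpow_pos_of_pos hτ _
  rw [ENNReal.ofReal_mul (by positivity), ofReal_integral_eq_lintegral_ofReal
    (integrableOn_one_div_one_add_rpow hα h6) ?_, ← h0, ← image_sq_div_Ioi hc0 hR,
    lintegral_image_eq_lintegral_abs_deriv_mul measurableSet_Ioi (f' := fun y => 2 * y / c) ?_ ?_,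
    ← lintegral_const_mul _ (by fun_prop)]
  · refine setLIntegral_congr_fun measurableSet_Ioi fun y hy => ?_
    have hy0 : 0 < y := hR.trans hy
    have h7 : 0 ≤ 2 * y / c := by positivity
    simp only [abs_of_nonneg h7]
    rw [← ENNReal.ofReal_mul hy0.le, ← ENNReal.ofReal_mul h7, ← ENNReal.ofReal_mul (by positivity),
      sub_gain_eq hτ hα hR hy0]
  · intro y _
    have := ((hasDerivAt_pow 2 y).div_const c).hasDerivWithinAt (s := Set.Ioi R)
    simpa using this
  · intro y hy y' hy' h
    have hy0 : 0 < y := hR.trans hy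
    have hy1 : 0 < y' := hR.trans hy'
    have h8 : y ^ 2 = y' ^ 2 := by
      have := congrArg (· * c) h
      simpa [hc0.ne'] using this
    exact (pow_left_inj₀ hy0.le hy1.le two_ne_zero).1 h8
  · filter_upwards [self_mem_ae_restrict measurableSet_Ioi] with t ht
    have ht0 : 0 < t := h6.trans ht
    simp only [Pi.zero_apply]
    positivity

lemma lintegral_id_Ioc {R : ℝ} (hR : 0 ≤ R) : ∫⁻ y in Set.Ioc 0 R, ENNReal.ofReal y = ENNReal.ofReal (R ^ 2 / 2) := by
  rw [← ofReal_integral_eq_lintegral_ofReal]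
  · rw [← intervalIntegral.integral_of_le hR, integral_id]
    simp
  · exact (continuous_id.integrableOn_Icc).mono_set Set.Ioc_subset_Icc_self
  · filter_upwards [self_mem_ae_restrict measurableSet_Ioc] with t ht using ht.1.le

end PathLoss

/-! ### Factors and exponents at a given serving distance -/

section Radial

variable {K₁ K₂ : Type*} (p : Params K₁ K₂)

/-- Mean power received from a base station of tier `k` at distance `r`. -/
def Params.powAt (k : K₁ ⊕ K₂) (r : ℝ) : ℝ≥0∞ := ENNReal.ofReal (p.P k) * ENNReal.ofReal r ^ (-p.α)

lemma Params.meanPow_eq_powAt (k : K₁ ⊕ K₂) (y : Plane) : p.meanPow k y = p.powAt k ‖y‖ := by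
  rw [Params.meanPow, Params.powAt, ofReal_norm]

@[fun_prop] lemma Params.measurable_powAt (k : K₁ ⊕ K₂) : Measurable (p.powAt k) := by
  unfold Params.powAt
  fun_prop

lemma Params.powAt_of_pos (k : K₁ ⊕ K₂) {r : ℝ} (hr : 0 < r) : p.powAt k r = ENNReal.ofReal (p.P k / r ^ p.α) := by
  rw [Params.powAt, ENNReal.ofReal_rpow_of_pos hr, ← ENNReal.ofReal_mul (p.P_pos k).le, Real.rpow_neg hr.le, div_eq_mul_inv]

lemma Params.Pbar_pos (k i : K₁ ⊕ K₂) : 0 < p.Pbar k i :=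
  Real.rpow_pos_of_pos (div_pos (p.P_pos k) (p.P_pos i)) _

lemma Params.Pbar_mul_rpow (k i : K₁ ⊕ K₂) {r : ℝ} (hr : 0 < r) :
    (p.Pbar k i * r) ^ p.α = p.P k / p.P i * r ^ p.α := by
  have := p.two_lt_α
  have h := (div_pos (p.P_pos k) (p.P_pos i)).le
  rw [Real.mul_rpow (p.Pbar_pos k i).le hr.le, Params.Pbar, ← Real.rpow_mul h, one_div_mul_cancel (by linarith), Real.rpow_one]

/-- Mean factor of a base station of tier `k` at distance `y` for a serving distance `r`. -/
def Params.gain (i k : K₁ ⊕ K₂) (r y : ℝ) : ℝ := 1 / (1 + p.τ i * ((p.Pbar k i * r) ^ p.α / y ^ p.α))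

lemma Params.gain_nonneg (i k : K₁ ⊕ K₂) {r y : ℝ} (hr : 0 < r) (hy : 0 < y) : 0 ≤ p.gain i k r y := by
  have := p.τ_pos i
  have := p.Pbar_pos k i
  unfold Params.gain
  positivity

/-- Gives the exclusion radius of tier `k`, which becomes the lower limit of integration in `C`. -/
lemma Params.beats_powAt_iff (i k : K₁ ⊕ K₂) {r y : ℝ} (hr : 0 < r) (hy : 0 < y) :
    Beats true (p.powAt i r) (p.powAt k y) ↔ y ≤ p.Pbar k i * r := by
  have h1 := p.P_pos i
  have h2 := p.P_pos k
  have h3 : 0 < y ^ p.α := Real.rpow_pos_of_pos hy _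
  have h4 : 0 < r ^ p.α := Real.rpow_pos_of_pos hr _
  have h5 := p.Pbar_pos k i
  rw [← Real.rpow_le_rpow_iff hy.le (by positivity) (show 0 < p.α by linarith [p.two_lt_α]), p.Pbar_mul_rpow k i hr]
  simp only [Beats, if_true]
  rw [p.powAt_of_pos i hr, p.powAt_of_pos k hy, ENNReal.ofReal_le_ofReal_iff (by positivity), div_le_div_iff₀ h4 h3,
    div_mul_eq_mul_div, le_div_iff₀ h1, mul_comm (p.P i)]

lemma Params.fadeFactor_powAt (i k : K₁ ⊕ K₂) {r y : ℝ} (hr : 0 < r) (hy : 0 < y) :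
    fadeFactor true (ENNReal.ofReal (p.τ i)) (p.powAt i r) (p.powAt k y) =
      (Set.Ioi (p.Pbar k i * r)).indicator (fun y => ENNReal.ofReal (p.gain i k r y)) y := by
  classical
  have h1 := p.P_pos i
  have h2 := p.P_pos k
  have h3 : 0 < y ^ p.α := Real.rpow_pos_of_pos hy _
  have h4 : 0 < r ^ p.α := Real.rpow_pos_of_pos hr _
  have h6 := p.τ_pos i
  unfold fadeFactor
  rw [Set.indicator_apply]
  refine (if_congr (p.beats_powAt_iff i k hr hy) rfl rfl).trans ?_
  by_cases h : y ≤ p.Pbar k i * r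
  · rw [if_pos h, if_neg (by simpa using h)]
  · rw [if_neg h, if_pos (by simpa using h), Params.gain, p.Pbar_mul_rpow k i hr, p.powAt_of_pos i hr, p.powAt_of_pos k hy,
      ← ENNReal.ofReal_mul h6.le, ← ENNReal.ofReal_div_of_pos (by positivity), ← ENNReal.ofReal_one,
      ← ENNReal.ofReal_add zero_le_one (by positivity), ← ENNReal.ofReal_inv_of_pos (by positivity), one_div]
    congr 3
    field_simp

/-- The potential of a cluster with centre at distance `z`, for a serving distance `r`. -/
def Params.potentialAt (i : K₁ ⊕ K₂) (k : K₁) (r z : ℝ) : ℝ≥0∞ := p.potential true i (p.powAt i r) (.inl k) (axis z)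

lemma Params.meanFactor_eq_distLaw (i : K₁ ⊕ K₂) (t : ℝ≥0∞) (k : K₁) (x : Plane) :
    p.meanFactor true i t k x = ∫⁻ y in Set.Ioi (0 : ℝ),
      fadeFactor true (ENNReal.ofReal (p.τ i)) t (p.powAt (.inl k) y) * distLaw (p.g k) y ‖x‖ := by
  simp only [Params.meanFactor, Params.factor, p.meanPow_eq_powAt]
  exact lintegral_norm_add (p.g_density k) (p.g_isotropic k)
    (measurable_fadeFactor true _ measurable_const (p.measurable_powAt _)) x

lemma Params.potential_inl_eq_potentialAt (i : K₁ ⊕ K₂) (k : K₁) (r : ℝ) (x : Plane) :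
    p.potential true i (p.powAt i r) (.inl k) x = p.potentialAt i k r ‖x‖ := by
  simp only [Params.potentialAt, Params.potential, p.meanFactor_eq_distLaw, norm_axis (norm_nonneg x)]

@[fun_prop]
lemma Params.measurable_potentialAt {β : Type*} [MeasurableSpace β] (i : K₁ ⊕ K₂) (k : K₁) {r z : β → ℝ}
    (hr : Measurable r) (hz : Measurable z) : Measurable fun a => p.potentialAt i k (r a) (z a) :=
  p.measurable_potential true i _ ((p.measurable_powAt i).comp hr) (measurable_axis hz)

lemma Params.meanFactor_powAt (i : K₁ ⊕ K₂) (k : K₁) {r : ℝ} (hr : 0 < r) (x : Plane) :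
    p.meanFactor true i (p.powAt i r) k x = ∫⁻ y in Set.Ioi (p.Pbar (.inl k) i * r),
      ENNReal.ofReal (p.gain i (.inl k) r y) * distLaw (p.g k) y ‖x‖ := by
  have h0 : 0 ≤ p.Pbar (.inl k) i * r := mul_nonneg (p.Pbar_pos _ _).le hr.le
  rw [p.meanFactor_eq_distLaw]
  have h1 : ∫⁻ y in Set.Ioi (0 : ℝ), fadeFactor true (ENNReal.ofReal (p.τ i)) (p.powAt i r) (p.powAt (.inl k) y) *
      distLaw (p.g k) y ‖x‖ = ∫⁻ y in Set.Ioi (0 : ℝ), (Set.Ioi (p.Pbar (.inl k) i * r)).indicator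
        (fun y => ENNReal.ofReal (p.gain i (.inl k) r y) * distLaw (p.g k) y ‖x‖) y := by
    refine setLIntegral_congr_fun measurableSet_Ioi fun y hy => ?_
    simp only [p.fadeFactor_powAt i (.inl k) hr hy]
    by_cases h : y ∈ Set.Ioi (p.Pbar (.inl k) i * r) <;> simp [h]
  rw [h1, setLIntegral_indicator measurableSet_Ioi, Set.inter_eq_left.2 (Set.Ioi_subset_Ioi h0)]

lemma Params.toReal_meanFactor (i : K₁ ⊕ K₂) (k : K₁) {r : ℝ} (hr : 0 < r) (x : Plane) :
    (p.meanFactor true i (p.powAt i r) k x).toReal = ∫ y in Set.Ioi (p.Pbar (.inl k) i * r),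
      p.fd k y ‖x‖ / (1 + p.τ i * ((p.Pbar (.inl k) i * r) ^ p.α / y ^ p.α)) := by
  have h0 : 0 ≤ p.Pbar (.inl k) i * r := mul_nonneg (p.Pbar_pos _ _).le hr.le
  have hm : Measurable fun y => p.gain i (.inl k) r y := by
    unfold Params.gain
    fun_prop
  rw [p.meanFactor_powAt i k hr, ← integral_toReal]
  · refine setIntegral_congr_fun measurableSet_Ioi fun y hy => ?_
    have hy0 : 0 < y := h0.trans_lt hy
    simp only [ENNReal.toReal_mul, ENNReal.toReal_ofReal (p.gain_nonneg i (.inl k) hr hy0),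
      (p.g_density k).toReal_distLaw hy0.le]
    rw [Params.gain, Params.fd]
    ring
  · exact ((ENNReal.measurable_ofReal.comp hm).mul
      ((p.g_density k).measurable_distLaw measurable_id measurable_const)).aemeasurable
  · filter_upwards [ae_mono (Measure.restrict_mono (Set.Ioi_subset_Ioi h0) le_rfl) ((p.g_density k).ae_distLaw_lt_top ‖x‖)] with y hy
    exact ENNReal.mul_lt_top ENNReal.ofReal_lt_top hy

lemma Params.C_nonneg (k : K₁) (i : K₁ ⊕ K₂) (r z : ℝ) : 0 ≤ p.C k i r z := (Real.exp_pos _).le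

lemma Params.expNeg_potential (i : K₁ ⊕ K₂) (k : K₁) {r : ℝ} (hr : 0 < r) (x : Plane) :
    expNeg (p.potential true i (p.powAt i r) (.inl k) x) = ENNReal.ofReal (p.C k i r ‖x‖) := by
  have h1 := p.meanFactor_le_one true i (p.powAt i r) k x
  have h2 : p.meanFactor true i (p.powAt i r) k x ≠ ⊤ := ne_top_of_le_ne_top ENNReal.one_ne_top h1
  have h3 : (p.meanFactor true i (p.powAt i r) k x).toReal ≤ 1 := ENNReal.toReal_le_of_le_ofReal zero_le_one (by simpa using h1)
  have h4 := p.mbar_pos k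
  rw [Params.potential, ← ENNReal.ofReal_toReal h2, ← ENNReal.ofReal_one, ← ENNReal.ofReal_sub _ ENNReal.toReal_nonneg,
    ← ENNReal.ofReal_mul h4.le, expNeg_ofReal (mul_nonneg h4.le (by linarith)), p.toReal_meanFactor i k hr, Params.C, neg_mul]

lemma Params.expNeg_potentialAt (i : K₁ ⊕ K₂) (k : K₁) {r z : ℝ} (hr : 0 < r) (hz : 0 ≤ z) :
    expNeg (p.potentialAt i k r z) = ENNReal.ofReal (p.C k i r z) := by
  rw [Params.potentialAt, p.expNeg_potential i k hr, norm_axis hz]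

lemma Params.noise_powAt (i : K₁ ⊕ K₂) {r : ℝ} (hr : 0 < r) :
    p.noise true i (p.powAt i r) = ENNReal.ofReal (p.τ i * p.N₀ * r ^ p.α / p.P i) := by
  have h1 := p.P_pos i
  have h4 : 0 < r ^ p.α := Real.rpow_pos_of_pos hr _
  rw [Params.noise, HetNet.noise, p.powAt_of_pos i hr, if_neg (by simp), ← ENNReal.ofReal_mul (p.τ_pos i).le,
    ← ENNReal.ofReal_div_of_pos (by positivity)]
  congr 1
  field_simp

/-- With `R = Pbar k i * r`, the disc of radius `R` is fully excluded and gives `R ^ 2 / 2`, and its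
exterior gives the path-loss integral. After multiplication by `2π` these are the two summands of
`rho`. -/
lemma Params.lintegral_one_sub_factor (i k : K₁ ⊕ K₂) {r : ℝ} (hr : 0 < r) :
    ∫⁻ y, (1 - p.factor true i (p.powAt i r) k y) =
      ENNReal.ofReal (Real.pi * r ^ 2 * (p.Pbar k i ^ 2 * rho (p.τ i) p.α)) := by
  have hm : Measurable fun y => 1 - fadeFactor true (ENNReal.ofReal (p.τ i)) (p.powAt i r) (p.powAt k y) :=
    measurable_const.sub (measurable_fadeFactor true _ measurable_const (p.measurable_powAt _))
  have hR : 0 < p.Pbar k i * r := mul_pos (p.Pbar_pos _ _) hr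
  have hτ := p.τ_pos i
  have h0 := (lintegral_norm_plane hm)
  simp only [Params.factor, p.meanPow_eq_powAt]
  rw [h0, ← Set.Ioc_union_Ioi_eq_Ioi hR.le, lintegral_union measurableSet_Ioi Set.Ioc_disjoint_Ioi_same]
  have h1 : ∫⁻ y in Set.Ioc 0 (p.Pbar k i * r), ENNReal.ofReal y *
      (1 - fadeFactor true (ENNReal.ofReal (p.τ i)) (p.powAt i r) (p.powAt k y)) =
      ENNReal.ofReal ((p.Pbar k i * r) ^ 2 / 2) := by
    rw [← lintegral_id_Ioc hR.le]
    refine setLIntegral_congr_fun measurableSet_Ioc fun y hy => ?_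
    simp only [p.fadeFactor_powAt i k hr hy.1]
    rw [Set.indicator_of_notMem (by simpa using hy.2)]
    simp
  have h2 : ∫⁻ y in Set.Ioi (p.Pbar k i * r), ENNReal.ofReal y *
      (1 - fadeFactor true (ENNReal.ofReal (p.τ i)) (p.powAt i r) (p.powAt k y)) =
      ∫⁻ y in Set.Ioi (p.Pbar k i * r), ENNReal.ofReal y *
        ENNReal.ofReal (1 - 1 / (1 + p.τ i * ((p.Pbar k i * r) ^ p.α / y ^ p.α))) := by
    refine setLIntegral_congr_fun measurableSet_Ioi fun y hy => ?_
    have hy0 : 0 < y := hR.trans hy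
    simp only [p.fadeFactor_powAt i k hr hy0]
    rw [Set.indicator_of_mem hy, ← ENNReal.ofReal_one, ← ENNReal.ofReal_sub _ (p.gain_nonneg i k hr hy0)]
    rfl
  have h5 : 0 < p.τ i ^ (2 / p.α) := Real.rpow_pos_of_pos hτ _
  have h6 : 0 ≤ ∫ t in Set.Ioi (p.τ i ^ (-(2 / p.α))), 1 / (1 + t ^ (p.α / 2)) := by
    refine setIntegral_nonneg measurableSet_Ioi fun t ht => ?_
    have ht0 : 0 < t := (Real.rpow_pos_of_pos hτ _).trans ht
    positivity
  rw [h1, h2, lintegral_sub_gain hτ p.two_lt_α hR, ← ENNReal.ofReal_add (by positivity) (by positivity),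
    ← ENNReal.ofReal_mul (by positivity), rho]
  congr 1
  ring

lemma Params.void_inr (i : K₁ ⊕ K₂) (k : K₂) {r : ℝ} (hr : 0 < r) : p.void true i (p.powAt i r) (.inr k) =
    ENNReal.ofReal (Real.pi * r ^ 2 * (p.lam k * p.Pbar (.inr k) i ^ 2 * rho (p.τ i) p.α)) := by
  simp only [Params.void, Params.potential, expNeg_negLog (p.factor_le_one _ _ _ _ _)]
  rw [lintegral_const_mul', p.lintegral_one_sub_factor i _ hr, Params.intensity, Sum.elim_inr,
    ← ENNReal.ofReal_mul (p.lam_pos k).le]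
  · congr 1
    ring
  · exact ENNReal.ofReal_ne_top

/-- By Tonelli and translation invariance the displacement drops out, and the integral is `mbar`
times that of `1 - factor` over the plane, which has been computed and is finite. -/
lemma Params.lintegral_potential_ne_top (i : K₁ ⊕ K₂) (k : K₁) {r : ℝ} (hr : 0 < r) :
    ∫⁻ x, p.potential true i (p.powAt i r) (.inl k) x ≠ ⊤ := by
  have h1 (x : Plane) : p.potential true i (p.powAt i r) (.inl k) x = ENNReal.ofReal (p.mbar k) *
      ∫⁻ s, (1 - p.factor true i (p.powAt i r) (.inl k) (x + s)) ∂(densityLaw (p.g k)) := by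
    rw [Params.potential, lintegral_sub]
    · simp [Params.meanFactor]
    · exact p.measurable_factor true i _ measurable_const (measurable_id.const_add x)
    · exact ne_top_of_le_ne_top ENNReal.one_ne_top (p.meanFactor_le_one true i (p.powAt i r) k x)
    · exact Eventually.of_forall fun s => p.factor_le_one _ _ _ _ _
  simp only [h1]
  rw [lintegral_const_mul' _ _ ENNReal.ofReal_ne_top, lintegral_lintegral_swap]
  · have h2 (s : Plane) : ∫⁻ x, (1 - p.factor true i (p.powAt i r) (.inl k) (x + s)) =
        ∫⁻ x, (1 - p.factor true i (p.powAt i r) (.inl k) x) :=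
      lintegral_add_right_eq_self (fun x => 1 - p.factor true i (p.powAt i r) (.inl k) x) s
    simp only [h2, p.lintegral_one_sub_factor i _ hr]
    simp [ENNReal.mul_eq_top]
  · exact (measurable_const.sub (p.measurable_factor true i _ measurable_const
      (measurable_fst.add measurable_snd))).aemeasurable

lemma Params.void_inl (i : K₁ ⊕ K₂) (k : K₁) {r : ℝ} (hr : 0 < r) : p.void true i (p.powAt i r) (.inl k) =
    ENNReal.ofReal (2 * Real.pi * p.lamP k * ∫ z in Set.Ioi (0 : ℝ), (1 - p.C k i r z) * z) := by
  -- Finiteness, through `1 - exp (-x) ≤ x`, must be known before the void integral can be read as a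
  -- real one.
  have hfin : ∫⁻ x, (1 - expNeg (p.potential true i (p.powAt i r) (.inl k) x)) ≠ ⊤ :=
    ne_top_of_le_ne_top (p.lintegral_potential_ne_top i k hr) (lintegral_mono fun x => one_sub_expNeg_le _)
  have hm : Measurable fun z => 1 - expNeg (p.potentialAt i k r z) := by fun_prop
  have h1 : ∫⁻ x, (1 - expNeg (p.potential true i (p.powAt i r) (.inl k) x)) = ENNReal.ofReal (2 * Real.pi) *
      ∫⁻ z in Set.Ioi (0 : ℝ), ENNReal.ofReal z * (1 - expNeg (p.potentialAt i k r z)) := by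
    simp only [p.potential_inl_eq_potentialAt]
    exact lintegral_norm_plane hm
  have hpi : ENNReal.ofReal (2 * Real.pi) ≠ 0 := by simpa using Real.pi_pos
  have hfin2 : ∫⁻ z in Set.Ioi (0 : ℝ), ENNReal.ofReal z * (1 - expNeg (p.potentialAt i k r z)) ≠ ⊤ := by
    intro h
    rw [h1, h, ENNReal.mul_top hpi] at hfin
    exact hfin rfl
  have h2 : (∫⁻ z in Set.Ioi (0 : ℝ), ENNReal.ofReal z * (1 - expNeg (p.potentialAt i k r z))).toReal =
      ∫ z in Set.Ioi (0 : ℝ), (1 - p.C k i r z) * z := by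
    have hm' : Measurable fun z => ENNReal.ofReal z * (1 - expNeg (p.potentialAt i k r z)) := by fun_prop
    rw [← integral_toReal hm'.aemeasurable (ae_lt_top hm' hfin2)]
    refine setIntegral_congr_fun measurableSet_Ioi fun z hz => ?_
    have hz0 : 0 < z := hz
    have hC : p.C k i r z ≤ 1 := by
      have := expNeg_le_one (p.potentialAt i k r z)
      rw [p.expNeg_potentialAt i k hr hz0.le] at this
      simpa using this
    simp only [p.expNeg_potentialAt i k hr hz0.le]
    rw [ENNReal.toReal_mul, ENNReal.toReal_ofReal hz0.le, ← ENNReal.ofReal_one, ← ENNReal.ofReal_sub _ (p.C_nonneg _ _ _ _),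
      ENNReal.toReal_ofReal (by linarith), mul_comm]
  have h3 : p.void true i (p.powAt i r) (.inl k) = ENNReal.ofReal (p.lamP k) *
      ∫⁻ x, (1 - expNeg (p.potential true i (p.powAt i r) (.inl k) x)) :=
    lintegral_const_mul' _ _ ENNReal.ofReal_ne_top
  have := p.lamP_pos k
  rw [h3, h1, ← ENNReal.ofReal_toReal hfin2, h2, ← mul_assoc, ← ENNReal.ofReal_mul (by positivity),
    ← ENNReal.ofReal_mul (by positivity)]
  congr 1
  ring

end Radial

/-! ### Tier means as integrals over the serving distance -/

section Distance

variable {K₁ K₂ : Type*} (p : Params K₁ K₂)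

/-- Factor of the noise and of the original network for service by tier `i` at distance `r`. -/
def Params.baseAt (i : K₁ ⊕ K₂) (r : ℝ) : ℝ≥0∞ :=
  expNeg (p.noise true i (p.powAt i r) + ∑' k, p.void true i (p.powAt i r) k)

/-- Factor of the representative cluster. -/
def Params.repAt (i : K₁ ⊕ K₂) (r : ℝ) : ℝ≥0∞ :=
  ∫⁻ z in Set.Ioi (0 : ℝ), expNeg (p.potentialAt i p.q r z) * distLaw p.gU z 0

/-- Factor of the cluster of the serving base station. -/
def Params.servingAt (k : K₁) (r : ℝ) : ℝ≥0∞ :=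
  ∫⁻ z in Set.Ioi (0 : ℝ), distLaw (p.g k) r z * expNeg (p.potentialAt (.inl k) k r z) * ENNReal.ofReal z

/-- Factor of the representative cluster when it contains the serving base station. -/
def Params.repServingAt (r : ℝ) : ℝ≥0∞ :=
  ∫⁻ z in Set.Ioi (0 : ℝ), distLaw (p.g p.q) r z * expNeg (p.potentialAt (.inl p.q) p.q r z) * distLaw p.gU z 0

lemma Params.base_powAt (i : K₁ ⊕ K₂) (z : Plane) (r : ℝ) :
    p.base true i z (p.powAt i r) = p.baseAt i r * expNeg (p.potentialAt i p.q r ‖z‖) := by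
  rw [Params.base, Params.baseAt, p.potential_inl_eq_potentialAt, expNeg_add, expNeg_add, expNeg_add]
  ring

@[fun_prop] lemma Params.measurable_baseAt [Countable K₁] [Countable K₂] (i : K₁ ⊕ K₂) : Measurable (p.baseAt i) := by
  refine measurable_expNeg.comp (Measurable.add (p.measurable_noise true i (p.measurable_powAt i)) ?_)
  exact Measurable.tsum fun k => p.measurable_void true i (p.measurable_powAt i) k

@[fun_prop] lemma Params.measurable_distLaw_g {β : Type*} [MeasurableSpace β] (k : K₁) {r z : β → ℝ}
    (hr : Measurable r) (hz : Measurable z) : Measurable fun a => distLaw (p.g k) (r a) (z a) :=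
  (p.g_density k).measurable_distLaw hr hz

@[fun_prop] lemma Params.measurable_distLaw_gU {β : Type*} [MeasurableSpace β] {r z : β → ℝ}
    (hr : Measurable r) (hz : Measurable z) : Measurable fun a => distLaw p.gU (r a) (z a) :=
  p.gU_density.measurable_distLaw hr hz

@[fun_prop] lemma Params.measurable_repAt (i : K₁ ⊕ K₂) : Measurable (p.repAt i) :=
  Measurable.lintegral_prod_right (f := fun r z => expNeg (p.potentialAt i p.q r z) * distLaw p.gU z 0) (by fun_prop)

@[fun_prop] lemma Params.measurable_servingAt (k : K₁) : Measurable (p.servingAt k) :=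
  Measurable.lintegral_prod_right (f := fun r z => distLaw (p.g k) r z * expNeg (p.potentialAt (.inl k) k r z) *
    ENNReal.ofReal z) (by fun_prop)

@[fun_prop] lemma Params.measurable_repServingAt : Measurable p.repServingAt :=
  Measurable.lintegral_prod_right (f := fun r z => distLaw (p.g p.q) r z *
    expNeg (p.potentialAt (.inl p.q) p.q r z) * distLaw p.gU z 0) (by fun_prop)

lemma Params.lintegral_gU_norm {F : ℝ → ℝ≥0∞} (hF : Measurable F) :
    ∫⁻ u, F ‖-u‖ ∂(densityLaw p.gU) = ∫⁻ z in Set.Ioi (0 : ℝ), F z * distLaw p.gU z 0 := by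
  simp only [norm_neg]
  exact p.gU_density.lintegral_norm hF

lemma Params.lintegral_base_powAt (i : K₁ ⊕ K₂) (r : ℝ) :
    ∫⁻ u, p.base true i (-u) (p.powAt i r) ∂(densityLaw p.gU) = p.baseAt i r * p.repAt i r := by
  simp only [p.base_powAt]
  rw [lintegral_const_mul _ (by fun_prop)]
  exact congrArg _ (p.lintegral_gU_norm (F := fun z => expNeg (p.potentialAt i p.q r z)) (by fun_prop))

variable [Countable K₁] [Countable K₂]

/-- For a centre `y` the serving distance has law `distLaw` at `‖y‖`. Everything else depends on `y`
through its norm, so the plane integral becomes radial and can be performed inside the integral over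
the serving distance. -/
lemma Params.lintegral_serving (k : K₁) (u : Plane) :
    ∫⁻ v, (ENNReal.ofReal (p.lamP k) * ∫⁻ y,
      expNeg (p.potential true (.inl k) (p.meanPow (.inl k) (y + v)) (.inl k) y) *
        p.base true (.inl k) u (p.meanPow (.inl k) (y + v))) ∂(densityLaw (p.g k)) =
    ENNReal.ofReal (2 * Real.pi * p.lamP k) * ∫⁻ r in Set.Ioi (0 : ℝ),
      p.base true (.inl k) u (p.powAt (.inl k) r) * p.servingAt k r := by
  let H (y : Plane) (r : ℝ) : ℝ≥0∞ := expNeg (p.potentialAt (.inl k) k r ‖y‖) *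
    (p.baseAt (.inl k) r * expNeg (p.potentialAt (.inl k) p.q r ‖u‖))
  let G (w r : ℝ) : ℝ≥0∞ := expNeg (p.potentialAt (.inl k) k r w) *
    (p.baseAt (.inl k) r * expNeg (p.potentialAt (.inl k) p.q r ‖u‖)) * distLaw (p.g k) r w
  have hG : Measurable (Function.uncurry G) := by
    simp only [G, Function.uncurry_def]
    fun_prop
  simp only [p.meanPow_eq_powAt, p.potential_inl_eq_potentialAt, p.base_powAt]
  rw [lintegral_const_mul' _ _ ENNReal.ofReal_ne_top, lintegral_lintegral_swap]
  · have h1 (y : Plane) : ∫⁻ v, H y ‖y + v‖ ∂(densityLaw (p.g k)) = ∫⁻ r in Set.Ioi (0 : ℝ), G ‖y‖ r :=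
      lintegral_norm_add (p.g_density k) (p.g_isotropic k) (by simp only [H]; fun_prop) y
    refine (congrArg _ ((lintegral_congr h1).trans (lintegral_norm_plane (F := fun w => ∫⁻ r in Set.Ioi (0 : ℝ), G w r)
      (Measurable.lintegral_prod_right hG)))).trans ?_
    have h2 : ∫⁻ w in Set.Ioi (0 : ℝ), ENNReal.ofReal w * ∫⁻ r in Set.Ioi (0 : ℝ), G w r =
        ∫⁻ w in Set.Ioi (0 : ℝ), ∫⁻ r in Set.Ioi (0 : ℝ), ENNReal.ofReal w * G w r :=
      lintegral_congr fun w => (lintegral_const_mul' _ _ ENNReal.ofReal_ne_top).symm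
    have h3 : ∫⁻ r in Set.Ioi (0 : ℝ), ∫⁻ w in Set.Ioi (0 : ℝ), ENNReal.ofReal w * G w r =
        ∫⁻ r in Set.Ioi (0 : ℝ), p.baseAt (.inl k) r * expNeg (p.potentialAt (.inl k) p.q r ‖u‖) * p.servingAt k r := by
      refine lintegral_congr fun r => ?_
      rw [Params.servingAt, ← lintegral_const_mul _ (by fun_prop)]
      refine lintegral_congr fun w => ?_
      simp only [G]
      ring
    rw [h2, lintegral_lintegral_swap, h3, ← mul_assoc, mul_comm (2 * Real.pi), ENNReal.ofReal_mul (p.lamP_pos k).le]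
    exact ((ENNReal.measurable_ofReal.comp measurable_fst).mul hG).aemeasurable
  · exact Measurable.aemeasurable (by fun_prop)

lemma Params.lintegral_repServing (u : Plane) :
    ∫⁻ v, p.base true (.inl p.q) u (p.meanPow (.inl p.q) (u + v)) ∂(densityLaw (p.g p.q)) =
      ∫⁻ r in Set.Ioi (0 : ℝ), p.baseAt (.inl p.q) r * expNeg (p.potentialAt (.inl p.q) p.q r ‖u‖) *
        distLaw (p.g p.q) r ‖u‖ := by
  simp only [p.meanPow_eq_powAt, p.base_powAt]
  exact lintegral_norm_add (F := fun r => p.baseAt (.inl p.q) r * expNeg (p.potentialAt (.inl p.q) p.q r ‖u‖))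
    (p.g_density _) (p.g_isotropic _) (by fun_prop) u

lemma Params.lintegral_lintegral_serving (k : K₁) :
    ∫⁻ u, (ENNReal.ofReal (p.mbar k) * ∫⁻ v, (ENNReal.ofReal (p.lamP k) * ∫⁻ y,
      expNeg (p.potential true (.inl k) (p.meanPow (.inl k) (y + v)) (.inl k) y) *
        p.base true (.inl k) (-u) (p.meanPow (.inl k) (y + v))) ∂(densityLaw (p.g k))) ∂(densityLaw p.gU) =
    ENNReal.ofReal (p.mbar k) * ∫⁻ r in Set.Ioi (0 : ℝ), p.baseAt (.inl k) r *
      (ENNReal.ofReal (2 * Real.pi * p.lamP k) * (p.servingAt k r * p.repAt (.inl k) r)) := by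
  simp only [p.lintegral_serving]
  rw [lintegral_const_mul' _ _ ENNReal.ofReal_ne_top, lintegral_const_mul' _ _ ENNReal.ofReal_ne_top,
    lintegral_lintegral_swap]
  · congr 1
    rw [← lintegral_const_mul' _ _ ENNReal.ofReal_ne_top]
    refine lintegral_congr fun r => ?_
    rw [lintegral_mul_const, p.lintegral_base_powAt]
    · ring
    · simp only [p.base_powAt]
      fun_prop
  · simp only [p.base_powAt]
    exact Measurable.aemeasurable (by fun_prop)

/-- The representative centre enters the law of the serving distance, its own potential and `gU` at
once, so the average over it stays one joint integral `repServingAt` instead of a product. -/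
lemma Params.lintegral_lintegral_repServing :
    ∫⁻ u, (ENNReal.ofReal (p.mbar p.q) * ∫⁻ v, p.base true (.inl p.q) (-u) (p.meanPow (.inl p.q) (-u + v))
      ∂(densityLaw (p.g p.q))) ∂(densityLaw p.gU) =
    ENNReal.ofReal (p.mbar p.q) * ∫⁻ r in Set.Ioi (0 : ℝ), p.baseAt (.inl p.q) r * p.repServingAt r := by
  simp only [p.lintegral_repServing]
  rw [lintegral_const_mul' _ _ ENNReal.ofReal_ne_top, lintegral_lintegral_swap]
  · congr 1
    refine lintegral_congr fun r => ?_
    refine (p.lintegral_gU_norm (F := fun z => p.baseAt (.inl p.q) r * expNeg (p.potentialAt (.inl p.q) p.q r z) *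
      distLaw (p.g p.q) r z) (by fun_prop)).trans ?_
    rw [Params.repServingAt, ← lintegral_const_mul _ (by fun_prop)]
    refine lintegral_congr fun z => ?_
    ring
  · exact Measurable.aemeasurable (by fun_prop)

lemma Params.tierCov_of_ne {k : K₁} (hk : k ≠ p.q) : p.tierCov (.inl k) =
    ENNReal.ofReal (p.mbar k) * ∫⁻ r in Set.Ioi (0 : ℝ), p.baseAt (.inl k) r *
      (ENNReal.ofReal (2 * Real.pi * p.lamP k) * (p.servingAt k r * p.repAt (.inl k) r)) := by
  rw [← p.lintegral_lintegral_serving]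
  refine lintegral_congr fun u => ?_
  simp only [Params.typicalMean, if_neg hk, zero_add]

lemma Params.tierCov_q : p.tierCov (.inl p.q) =
    ENNReal.ofReal (p.mbar p.q) * ∫⁻ r in Set.Ioi (0 : ℝ), p.baseAt (.inl p.q) r *
      (p.repServingAt r +
        ENNReal.ofReal (2 * Real.pi * p.lamP p.q) * (p.servingAt p.q r * p.repAt (.inl p.q) r)) := by
  simp only [mul_add (p.baseAt _ _)]
  rw [lintegral_add_left (by fun_prop), mul_add, ← p.lintegral_lintegral_serving, ← p.lintegral_lintegral_repServing,
    ← lintegral_add_left]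
  · refine lintegral_congr fun u => ?_
    simp only [Params.typicalMean, if_true]
  · simp only [p.lintegral_repServing]
    refine measurable_const.mul (Measurable.lintegral_prod_right (f := fun u r => p.baseAt (.inl p.q) r *
      expNeg (p.potentialAt (.inl p.q) p.q r ‖-u‖) * distLaw (p.g p.q) r ‖-u‖) ?_)
    fun_prop

lemma Params.tierCov_inr (k : K₂) : p.tierCov (.inr k) =
    ENNReal.ofReal (2 * Real.pi * p.lam k) * ∫⁻ r in Set.Ioi (0 : ℝ), p.baseAt (.inr k) r *
      (p.repAt (.inr k) r * ENNReal.ofReal r) := by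
  simp only [Params.tierCov, Params.typicalMean, p.meanPow_eq_powAt]
  rw [lintegral_const_mul' _ _ ENNReal.ofReal_ne_top, lintegral_lintegral_swap]
  · simp only [p.lintegral_base_powAt]
    rw [lintegral_norm_plane (F := fun r => p.baseAt (.inr k) r * p.repAt (.inr k) r) (by fun_prop), ← mul_assoc,
      ← ENNReal.ofReal_mul (p.lam_pos k).le, mul_comm (p.lam k)]
    congr 1
    refine lintegral_congr fun r => ?_
    ring
  · simp only [p.base_powAt]
    exact Measurable.aemeasurable (by fun_prop)

end Distance

/-! ### Passage to real-valued integrals -/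

section Real

variable {K₁ K₂ : Type*} (p : Params K₁ K₂)

/-- The identity is asked for only where `f` is finite, so that `toReal` may be distributed over a
sum inside the integrand. -/
lemma toReal_lintegral_eq_integral {f : ℝ → ℝ≥0∞} {g : ℝ → ℝ} {s : Set ℝ} (hf : Measurable f)
    (hfin : ∫⁻ r in s, f r ≠ ⊤) (h : ∀ᵐ r ∂(volume.restrict s), f r < ⊤ → (f r).toReal = g r) :
    (∫⁻ r in s, f r).toReal = ∫ r in s, g r := by
  rw [← integral_toReal hf.aemeasurable (ae_lt_top hf hfin)]
  refine integral_congr_ae ?_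
  filter_upwards [h, ae_lt_top hf hfin] with r h1 h2 using h1 h2

/-- Value of `baseAt`. -/
def Params.reduced [Fintype K₁] [Fintype K₂] (i : K₁ ⊕ K₂) (r : ℝ) : ℝ :=
  Real.exp (-(p.τ i * p.N₀ * r ^ p.α / p.P i)) *
    (∏ j : K₁, Real.exp (-(2 * Real.pi * p.lamP j * ∫ z in Set.Ioi (0 : ℝ), (1 - p.C j i r z) * z))) *
    Real.exp (-(Real.pi * r ^ 2 * ∑ j : K₂, p.lam j * p.Pbar (.inr j) i ^ 2 * rho (p.τ i) p.α))

lemma Params.C_le_one (k : K₁) (i : K₁ ⊕ K₂) {r z : ℝ} (hr : 0 < r) (hz : 0 ≤ z) : p.C k i r z ≤ 1 := by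
  have := expNeg_le_one (p.potentialAt i k r z)
  rw [p.expNeg_potentialAt i k hr hz] at this
  simpa using this

lemma rho_nonneg {τ α : ℝ} (hτ : 0 < τ) : 0 ≤ rho τ α := by
  have h5 : 0 < τ ^ (2 / α) := Real.rpow_pos_of_pos hτ _
  have h6 : 0 ≤ ∫ t in Set.Ioi (τ ^ (-(2 / α))), 1 / (1 + t ^ (α / 2)) := by
    refine setIntegral_nonneg measurableSet_Ioi fun t ht => ?_
    have ht0 : 0 < t := (Real.rpow_pos_of_pos hτ _).trans ht
    positivity
  unfold rho
  positivity

lemma Params.reduced_pos [Fintype K₁] [Fintype K₂] (i : K₁ ⊕ K₂) (r : ℝ) : 0 < p.reduced i r := by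
  have : 0 < ∏ j : K₁, Real.exp (-(2 * Real.pi * p.lamP j * ∫ z in Set.Ioi (0 : ℝ), (1 - p.C j i r z) * z)) :=
    Finset.prod_pos fun j _ => Real.exp_pos _
  unfold Params.reduced
  positivity

lemma Params.baseAt_of_pos [Fintype K₁] [Fintype K₂] (i : K₁ ⊕ K₂) {r : ℝ} (hr : 0 < r) :
    p.baseAt i r = ENNReal.ofReal (p.reduced i r) := by
  have h1 : 0 ≤ p.τ i * p.N₀ * r ^ p.α / p.P i := by
    have := p.τ_pos i
    have := p.N₀_nonneg
    have := p.P_pos i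
    positivity
  have h2 (k : K₁) : 0 ≤ 2 * Real.pi * p.lamP k * ∫ z in Set.Ioi (0 : ℝ), (1 - p.C k i r z) * z := by
    have := p.lamP_pos k
    refine mul_nonneg (by positivity) (setIntegral_nonneg measurableSet_Ioi fun z hz => ?_)
    have hz0 : 0 < z := hz
    exact mul_nonneg (by linarith [p.C_le_one k i hr hz0.le]) hz0.le
  have h3 (k : K₂) : 0 ≤ Real.pi * r ^ 2 * (p.lam k * p.Pbar (.inr k) i ^ 2 * rho (p.τ i) p.α) := by
    have := p.lam_pos k
    have := rho_nonneg (α := p.α) (p.τ_pos i)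
    positivity
  have h4 : Real.exp (-(Real.pi * r ^ 2 * ∑ j : K₂, p.lam j * p.Pbar (.inr j) i ^ 2 * rho (p.τ i) p.α)) =
      ∏ j : K₂, Real.exp (-(Real.pi * r ^ 2 * (p.lam j * p.Pbar (.inr j) i ^ 2 * rho (p.τ i) p.α))) := by
    rw [← Real.exp_sum, Finset.sum_neg_distrib, ← Finset.mul_sum]
  rw [Params.baseAt, expNeg_add, p.noise_powAt i hr, expNeg_ofReal h1, tsum_fintype, Fintype.sum_sum_type, expNeg_add,
    expNeg_sum, expNeg_sum]
  simp only [p.void_inl i _ hr, p.void_inr i _ hr, expNeg_ofReal (h2 _), expNeg_ofReal (h3 _)]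
  rw [← ENNReal.ofReal_prod_of_nonneg fun _ _ => (Real.exp_pos _).le,
    ← ENNReal.ofReal_prod_of_nonneg fun _ _ => (Real.exp_pos _).le,
    ← ENNReal.ofReal_mul (Finset.prod_nonneg fun _ _ => (Real.exp_pos _).le), ← ENNReal.ofReal_mul (Real.exp_pos _).le,
    Params.reduced, h4, mul_assoc (Real.exp _)]

lemma Params.toReal_repAt (i : K₁ ⊕ K₂) {r : ℝ} (hr : 0 < r) :
    (p.repAt i r).toReal = ∫ z₀ in Set.Ioi (0 : ℝ), p.C p.q i r z₀ * p.fdU z₀ := by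
  rw [Params.repAt, ← integral_toReal (Measurable.aemeasurable (by fun_prop))]
  · refine setIntegral_congr_fun measurableSet_Ioi fun z hz => ?_
    have hz0 : 0 < z := hz
    simp only [p.expNeg_potentialAt i _ hr hz0.le, ENNReal.toReal_mul, ENNReal.toReal_ofReal (p.C_nonneg _ _ _ _),
      p.gU_density.toReal_distLaw hz0.le, Params.fdU]
  · filter_upwards [p.gU_density.ae_distLaw_lt_top 0] with z hz
    exact ENNReal.mul_lt_top (expNeg_ne_top _).lt_top hz

/-- Restricted to almost every `r` because only there is `distLaw` known to be finite at almost
every `z`. -/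
lemma Params.ae_toReal_servingAt (k : K₁) : ∀ᵐ r ∂(volume.restrict (Set.Ioi (0 : ℝ))),
    (p.servingAt k r).toReal = ∫ z in Set.Ioi (0 : ℝ), p.fd k r z * p.C k (.inl k) r z * z := by
  filter_upwards [(p.g_density k).ae_ae_distLaw_lt_top, self_mem_ae_restrict measurableSet_Ioi] with r h hr
  have hr0 : 0 < r := hr
  rw [Params.servingAt, ← integral_toReal (Measurable.aemeasurable (by fun_prop))]
  · refine setIntegral_congr_fun measurableSet_Ioi fun z hz => ?_
    have hz0 : 0 < z := hz
    simp only [p.expNeg_potentialAt _ _ hr0 hz0.le, ENNReal.toReal_mul, ENNReal.toReal_ofReal (p.C_nonneg _ _ _ _),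
      (p.g_density k).toReal_distLaw hr0.le, Params.fd, ENNReal.toReal_ofReal hz0.le]
  · filter_upwards [h] with z hz
    exact ENNReal.mul_lt_top (ENNReal.mul_lt_top hz (expNeg_ne_top _).lt_top) ENNReal.ofReal_lt_top

lemma Params.ae_toReal_repServingAt : ∀ᵐ r ∂(volume.restrict (Set.Ioi (0 : ℝ))),
    (p.repServingAt r).toReal =
      ∫ z₀ in Set.Ioi (0 : ℝ), p.fd p.q r z₀ * p.C p.q (.inl p.q) r z₀ * p.fdU z₀ := by
  filter_upwards [(p.g_density p.q).ae_ae_distLaw_lt_top, self_mem_ae_restrict measurableSet_Ioi] with r h hr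
  have hr0 : 0 < r := hr
  rw [Params.repServingAt, ← integral_toReal (Measurable.aemeasurable (by fun_prop))]
  · refine setIntegral_congr_fun measurableSet_Ioi fun z hz => ?_
    have hz0 : 0 < z := hz
    simp only [p.expNeg_potentialAt _ _ hr0 hz0.le, ENNReal.toReal_mul, ENNReal.toReal_ofReal (p.C_nonneg _ _ _ _),
      (p.g_density _).toReal_distLaw hr0.le, Params.fd, Params.fdU, p.gU_density.toReal_distLaw hz0.le]
  · filter_upwards [h, p.gU_density.ae_distLaw_lt_top 0] with z hz hz'
    exact ENNReal.mul_lt_top (ENNReal.mul_lt_top hz (expNeg_ne_top _).lt_top) hz'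

variable [Fintype K₁] [Fintype K₂]

lemma ne_top_of_ofReal_mul_ne_top {c : ℝ} {x : ℝ≥0∞} (hc : 0 < c) (h : ENNReal.ofReal c * x ≠ ⊤) : x ≠ ⊤ := by
  rintro rfl
  rw [ENNReal.mul_top (by simpa using hc)] at h
  exact h rfl

lemma Params.toReal_tierCov_of_ne {k : K₁} (hk : k ≠ p.q) (h : p.tierCov (.inl k) ≠ ⊤) :
    (p.tierCov (.inl k)).toReal = 2 * Real.pi * p.lamP k * p.mbar k * ∫ r in Set.Ioi (0 : ℝ), p.reduced (.inl k) r *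
      ((∫ z₀ in Set.Ioi (0 : ℝ), p.C p.q (.inl k) r z₀ * p.fdU z₀) *
        ∫ z in Set.Ioi (0 : ℝ), p.fd k r z * p.C k (.inl k) r z * z) := by
  have h1 := p.mbar_pos k
  have h2 := p.lamP_pos k
  rw [p.tierCov_of_ne hk] at h ⊢
  rw [ENNReal.toReal_mul, ENNReal.toReal_ofReal h1.le, toReal_lintegral_eq_integral (by fun_prop)
    (ne_top_of_ofReal_mul_ne_top h1 h) (g := fun r => 2 * Real.pi * p.lamP k * (p.reduced (.inl k) r *
      ((∫ z₀ in Set.Ioi (0 : ℝ), p.C p.q (.inl k) r z₀ * p.fdU z₀) *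
        ∫ z in Set.Ioi (0 : ℝ), p.fd k r z * p.C k (.inl k) r z * z))), integral_const_mul]
  · ring
  · filter_upwards [p.ae_toReal_servingAt k, self_mem_ae_restrict measurableSet_Ioi] with r hr hr0 _
    rw [p.baseAt_of_pos _ hr0, ENNReal.toReal_mul, ENNReal.toReal_mul, ENNReal.toReal_mul, hr, p.toReal_repAt _ hr0,
      ENNReal.toReal_ofReal (p.reduced_pos _ _).le, ENNReal.toReal_ofReal (by positivity)]
    ring

lemma Params.toReal_tierCov_q (h : p.tierCov (.inl p.q) ≠ ⊤) :
    (p.tierCov (.inl p.q)).toReal = p.mbar p.q * ∫ r in Set.Ioi (0 : ℝ), p.reduced (.inl p.q) r *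
      ((∫ z₀ in Set.Ioi (0 : ℝ), p.fd p.q r z₀ * p.C p.q (.inl p.q) r z₀ * p.fdU z₀) +
        2 * Real.pi * p.lamP p.q * (∫ z in Set.Ioi (0 : ℝ), p.fd p.q r z * p.C p.q (.inl p.q) r z * z) *
          ∫ z₀ in Set.Ioi (0 : ℝ), p.C p.q (.inl p.q) r z₀ * p.fdU z₀) := by
  have h1 := p.mbar_pos p.q
  have h2 := p.lamP_pos p.q
  rw [p.tierCov_q] at h ⊢
  rw [ENNReal.toReal_mul, ENNReal.toReal_ofReal h1.le, toReal_lintegral_eq_integral (by fun_prop)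
    (ne_top_of_ofReal_mul_ne_top h1 h)]
  filter_upwards [p.ae_toReal_servingAt p.q, p.ae_toReal_repServingAt, self_mem_ae_restrict measurableSet_Ioi]
    with r hr hr' hr0 hfin
  rw [p.baseAt_of_pos _ hr0] at hfin ⊢
  -- Positivity of `reduced` carries finiteness of the integrand over to the bracket, hence to both
  -- summands.
  obtain ⟨h3, h4⟩ := ENNReal.add_ne_top.1 (ne_top_of_ofReal_mul_ne_top (p.reduced_pos _ _) hfin.ne)
  rw [ENNReal.toReal_mul, ENNReal.toReal_add h3 h4, ENNReal.toReal_mul, ENNReal.toReal_mul, hr, hr', p.toReal_repAt _ hr0,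
    ENNReal.toReal_ofReal (p.reduced_pos _ _).le, ENNReal.toReal_ofReal (by positivity), mul_assoc (2 * Real.pi * p.lamP p.q)]

lemma Params.toReal_tierCov_inr (k : K₂) (h : p.tierCov (.inr k) ≠ ⊤) :
    (p.tierCov (.inr k)).toReal = 2 * Real.pi * p.lam k * ∫ r in Set.Ioi (0 : ℝ), p.reduced (.inr k) r *
      ((∫ z₀ in Set.Ioi (0 : ℝ), p.C p.q (.inr k) r z₀ * p.fdU z₀) * r) := by
  have h1 : 0 < 2 * Real.pi * p.lam k := mul_pos (by positivity) (p.lam_pos k)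
  rw [p.tierCov_inr] at h ⊢
  rw [ENNReal.toReal_mul, ENNReal.toReal_ofReal h1.le, toReal_lintegral_eq_integral (by fun_prop)
    (ne_top_of_ofReal_mul_ne_top h1 h)]
  filter_upwards [self_mem_ae_restrict measurableSet_Ioi] with r hr0 _
  have hr : 0 < r := hr0
  rw [p.baseAt_of_pos _ hr, ENNReal.toReal_mul, ENNReal.toReal_mul, p.toReal_repAt _ hr,
    ENNReal.toReal_ofReal (p.reduced_pos _ _).le, ENNReal.toReal_ofReal hr.le]

end Real

end HetNet
end

theorem theorem2 {K₁ K₂ Ω : Type*} [Fintype K₁] [Fintype K₂] [MeasurableSpace Ω]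
    (μ : Measure Ω) [IsProbabilityMeasure μ]
    (p : Params K₁ K₂) (D : Data K₁ K₂ Ω) (hD : IsModel p D μ) :
    -- a typical user of the user process is covered with the same probabilities as the user at
    -- the origin for which tier `q` has the additional independent representative cluster
    (∀ B : Set Plane, MeasurableSet B → 0 < volume B → volume B < ∞ →
      (∀ i, D.palmProb p μ B (fun v => v.Covered p i) =
        ENNReal.ofReal (D.tierCoverage p μ i)) ∧
      D.palmProb p μ B (fun v => ∃ i, v.Covered p i) = ENNReal.ofReal (D.coverage p μ)) ∧
    -- the coverage probability is the sum of the tier coverage probabilities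
    D.coverage p μ = ∑ i, D.tierCoverage p μ i ∧
    -- cluster tiers other than `q`
    (∀ i : K₁, i ≠ p.q →
      D.tierCoverage p μ (.inl i) =
        2 * Real.pi * p.lamP i * p.mbar i * ∫ r in Set.Ioi (0 : ℝ),
          Real.exp (-(p.τ (.inl i) * p.N₀ * r ^ p.α / p.P (.inl i))) *
          (∏ j : K₁, Real.exp (-(2 * Real.pi * p.lamP j *
            ∫ z in Set.Ioi (0 : ℝ), (1 - p.C j (.inl i) r z) * z))) *
          (∫ z₀ in Set.Ioi (0 : ℝ), p.C p.q (.inl i) r z₀ * p.fdU z₀) *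
          Real.exp (-(Real.pi * r ^ 2 * ∑ j : K₂,
            p.lam j * p.Pbar (.inr j) (.inl i) ^ 2 * rho (p.τ (.inl i)) p.α)) *
          ∫ z in Set.Ioi (0 : ℝ), p.fd i r z * p.C i (.inl i) r z * z) ∧
    -- tier `q`
    (D.tierCoverage p μ (.inl p.q) =
        p.mbar p.q * ∫ r in Set.Ioi (0 : ℝ),
          Real.exp (-(p.τ (.inl p.q) * p.N₀ * r ^ p.α / p.P (.inl p.q))) *
          (∏ j : K₁, Real.exp (-(2 * Real.pi * p.lamP j *
            ∫ z in Set.Ioi (0 : ℝ), (1 - p.C j (.inl p.q) r z) * z))) *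
          Real.exp (-(Real.pi * r ^ 2 * ∑ j : K₂,
            p.lam j * p.Pbar (.inr j) (.inl p.q) ^ 2 * rho (p.τ (.inl p.q)) p.α)) *
          ((∫ z₀ in Set.Ioi (0 : ℝ), p.fd p.q r z₀ * p.C p.q (.inl p.q) r z₀ * p.fdU z₀) +
            2 * Real.pi * p.lamP p.q *
              (∫ z in Set.Ioi (0 : ℝ), p.fd p.q r z * p.C p.q (.inl p.q) r z * z) *
              ∫ z₀ in Set.Ioi (0 : ℝ), p.C p.q (.inl p.q) r z₀ * p.fdU z₀)) ∧
    -- Poisson tiers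
    (∀ i : K₂,
      D.tierCoverage p μ (.inr i) =
        2 * Real.pi * p.lam i * ∫ r in Set.Ioi (0 : ℝ),
          Real.exp (-(p.τ (.inr i) * p.N₀ * r ^ p.α / p.P (.inr i))) *
          (∏ j : K₁, Real.exp (-(2 * Real.pi * p.lamP j *
            ∫ z in Set.Ioi (0 : ℝ), (1 - p.C j (.inr i) r z) * z))) *
          (∫ z₀ in Set.Ioi (0 : ℝ), p.C p.q (.inr i) r z₀ * p.fdU z₀) *
          Real.exp (-(Real.pi * r ^ 2 * ∑ j : K₂,
            p.lam j * p.Pbar (.inr j) (.inr i) ^ 2 * rho (p.τ (.inr i)) p.α)) *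
          r) := by
  refine ⟨fun B hB hB0 hBv => ⟨fun i => hD.palmProb_covered hB hB0 hBv i, hD.palmProb_exists_covered hB hB0 hBv⟩,
    hD.coverage_eq_sum, fun i hi => ?_, ?_, fun i => ?_⟩
  · rw [hD.tierCoverage_eq, p.toReal_tierCov_of_ne hi (hD.tierCov_ne_top _)]
    congr 1
    refine integral_congr_ae (Filter.Eventually.of_forall fun r => ?_)
    simp only [Params.reduced]
    ring
  · rw [hD.tierCoverage_eq, p.toReal_tierCov_q (hD.tierCov_ne_top _)]
    rfl
  · rw [hD.tierCoverage_eq, p.toReal_tierCov_inr i (hD.tierCov_ne_top _)]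
    congr 1
    refine integral_congr_ae (Filter.Eventually.of_forall fun r => ?_)
    simp only [Params.reduced]
    ring
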